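/- **Setting.** Let $\beta\in(0,1)$ and assume (f) $f\in C^1[0,1]$, $f(0)=0$; write $h=\dot f$; (g) $g\in C^0[0,1]$, $g>0$ in $(0,1)$, $g(0)=g(1)=0$; (D$_{np}$) $D\in C^1[0,1]$, $D<0$ in $(0,\beta)$, $D>0$ in $(\beta,1)$. Consider $$\rho_t+f(\rho)_x=(D(\rho)\rho_x)_x+g(\rho).\qquad (E)$$ For an open interval $I\subseteq\mathbb R$, a function $\varphi:I\to[0,1]$ is the profile of a *traveling wave* (TW) of (E) with speed $c\in\mathbb R$ if it is continuous and locally absolutely continuous (hence differentiable a.e.), $D(\varphi)\varphi'\in L^1_{\rm loc}(I)$, and $$\int_I \big(D(\varphi)\varphi'-f(\varphi)+c\varphi\big)\psi'-g(\varphi)\psi\,d\xi=0\qquad\text{for all }\psi\in C_0^\infty(I).$$ A *wavefront* with speed $c$ is a TW with $I=\mathbb R$ whose profile is non-increasing with $\varphi(-\infty)=1$, $\varphi(+\infty)=0$. A *semi-wavefront from $1$ to $\beta$* is a TW on some $(-\infty,b)$, $b\in\mathbb R$, with non-increasing profile, $\varphi(-\infty)=1$, $\varphi(b^-)=\beta$;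 a *semi-wavefront from $\beta$ to $0$* is a TW on some $(a,\infty)$, $a\in\mathbb R$, with non-increasing profile, $\varphi(a^+)=\beta$, $\varphi(+\infty)=0$. A profile $\varphi$ is *classical in an open set $U$* if in $U$ it is differentiable, $D(\varphi)\varphi'$ is locally absolutely continuous, and $(D(\varphi)\varphi')'+(c-h(\varphi))\varphi'+g(\varphi)=0$ a.e. It is *classical at $\ell$* if it is classical in a neighborhood of every point where it takes the value $\ell$. It is *sharp at $\ell$ in an open interval $J$*, reached at $\xi_\ell\in J$, if $\varphi(\xi_\ell)=\ell$, $\varphi$ is classical in $J\setminus\{\xi_\ell\}$ and $\varphi$ is not differentiable at $\xi_\ell$. The equality $\varphi'(\xi^\pm)=L\in[-\infty,\infty)$ means that both the one-sided difference quotients of $\varphi$ at $\xi$ and the derivative $\varphi'(x)$, $x\to\xi^\pm$, converge to $L$. Finally $$s_\pm(\beta,c)=\tfrac12\Big[h(\beta)-c\pm\sqrt{(h(\beta)-c)^2-4\dot D(\beta)g(\beta)}\Big].$$ **Theorem.** There are real numbers $c^*_{p,l}$, $c^*_{n,r}$ (depending only on $f,D,g,\beta$), uniquely determined by the following properties: for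 every $c\in\mathbb R$ there exist semi-wavefronts with speed $c$ from $1$ to $\beta$ and from $\beta$ to $0$; for every semi-wavefront from $1$ to $\beta$ on $(-\infty,b)$ with speed $c$, $(D(\varphi)\varphi')(b^-)$ exists, and it is $0$ if $c\ge c^*_{p,l}$ and negative (finite) if $c<c^*_{p,l}$; for every semi-wavefront from $\beta$ to $0$ on $(a,\infty)$ with speed $c$, $(D(\varphi)\varphi')(a^+)$ exists, and it is $0$ if $c\ge c^*_{n,r}$ and positive (finite) if $c<c^*_{n,r}$. Put $c^*_{np}=\max\{c^*_{n,r},c^*_{p,l}\}$. Then (E) admits a wavefront with speed $c$ if and only if $c\ge c^*_{np}$, and for given $c$ any two wavefront profiles differ by a shift. Let $c\ge c^*_{np}$ and let $\varphi$ be the profile of a wavefront with speed $c$. Then $(h(\beta)-c)^2\ge4\dot D(\beta)g(\beta)$; $\varphi$ is differentiable with $\varphi'(\xi)<0$ whenever $\varphi(\xi)\in(0,1)\setminus\{\beta\}$; and there is a unique $\xi_\beta$ with $\varphi(\xi_\beta)=\beta$. Moreover $$\varphi'(\xi_\beta^-)=\begin{cases}\dfrac{g(\beta)}{s_-(\beta,c)}&\text{if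 }c>c^*_{p,l},\\[2mm]\dfrac{g(\beta)}{s_+(\beta,c^*_{p,l})}&\text{if }c=c^*_{p,l},\ \dot D(\beta)>0,\\[2mm]-\infty&\text{if }c=c^*_{p,l},\ \dot D(\beta)=0,\end{cases}\qquad \varphi'(\xi_\beta^+)=\begin{cases}\dfrac{g(\beta)}{s_-(\beta,c)}&\text{if }c>c^*_{n,r},\\[2mm]\dfrac{g(\beta)}{s_+(\beta,c^*_{n,r})}&\text{if }c=c^*_{n,r},\ \dot D(\beta)>0,\\[2mm]-\infty&\text{if }c=c^*_{n,r},\ \dot D(\beta)=0,\end{cases}$$ where the quantities $s_\pm$ that occur are negative. Finally: (i) if $D(0)D(1)<0$, then $\varphi$ is classical in $\mathbb R\setminus\{\xi_\beta\}$; (ii) if $D(0)=0$ and either $c>h(0)$, or $c=h(0)$ and $\dot D(0)<0$, then $\varphi$ is classical at $0$, and indeed classical in $(\xi_\beta,\infty)$; if $D(1)=0$ and either $c>h(1)$, or $c=h(1)$ and $\dot D(1)<0$, then $\varphi$ is classical at $1$, and indeed classical in $(-\infty,\xi_\beta)$; (iii) if $D(0)=0$ and $c<h(0)$, then $\varphi$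 is sharp at $0$ in $(\xi_\beta,\infty)$, reached at some $\xi_0>\xi_\beta$, with $\varphi(\xi)=0$ if and only if $\xi\ge\xi_0$, and $\varphi'(\xi_0^-)=\frac{h(0)-c}{\dot D(0)}$ if $\dot D(0)<0$, $\varphi'(\xi_0^-)=-\infty$ if $\dot D(0)=0$; if $D(1)=0$ and $c<h(1)$, then $\varphi$ is sharp at $1$ in $(-\infty,\xi_\beta)$, reached at some $\xi_1<\xi_\beta$, with $\varphi(\xi)=1$ if and only if $\xi\le\xi_1$, and $\varphi'(\xi_1^+)=\frac{h(1)-c}{\dot D(1)}$ if $\dot D(1)<0$, $\varphi'(\xi_1^+)=-\infty$ if $\dot D(1)=0$. -/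

import Mathlib

open Set Filter Topology MeasureTheory

/-- `φ` is the profile, on the open interval `I`, of a travelling-wave solution with speed `c` of
`ρ_t + f(ρ)_x = (D(ρ) ρ_x)_x + g(ρ)`. The profile is `[0,1]`-valued, continuous, a.e. differentiable,
`D(φ) φ'` is locally integrable, and the profile equation
`(D(φ) φ')' + (c - f'(φ)) φ' + g(φ) = 0` holds in the weak sense. Local absolute continuity says that
the a.e. derivative `φ'` occurring in the equation is the weak derivative of `φ`. -/
structure IsTravelingWave (f D g : ℝ → ℝ) (c : ℝ) (I : Set ℝ) (φ : ℝ → ℝ) : Prop where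
  continuousOn : ContinuousOn φ I
  mem_Icc : ∀ ξ ∈ I, φ ξ ∈ Icc (0 : ℝ) 1
  ae_differentiable : ∀ᵐ ξ ∂(volume.restrict I), DifferentiableAt ℝ φ ξ
  locally_ac : ∀ a b : ℝ, uIcc a b ⊆ I → AbsolutelyContinuousOnInterval φ a b
  locallyIntegrable_flux : LocallyIntegrableOn (fun ξ => D (φ ξ) * deriv φ ξ) I volume
  weak_eq : ∀ ψ : ℝ → ℝ, ContDiff ℝ (⊤ : ℕ∞) ψ → HasCompactSupport ψ → tsupport ψ ⊆ I →
    ∫ ξ in I, ((D (φ ξ) * deriv φ ξ - f (φ ξ) + c * φ ξ) * deriv ψ ξ - g (φ ξ) * ψ ξ) = 0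

/-- A wavefront from `1` to `0`: a global travelling wave whose profile is non-increasing, with limit
`1` at `-∞` and limit `0` at `+∞` (in particular it is not constant). -/
structure IsWavefront (f D g : ℝ → ℝ) (c : ℝ) (φ : ℝ → ℝ) : Prop where
  travelingWave : IsTravelingWave f D g c univ φ
  antitone : Antitone φ
  tendsto_atBot : Tendsto φ atBot (𝓝 1)
  tendsto_atTop : Tendsto φ atTop (𝓝 0)

/-- A non-increasing semi-wavefront from `1` on `(-∞, b)`, connecting `1` to `β`. -/
structure IsSemiWavefrontFromOne (f D g : ℝ → ℝ) (β c b : ℝ) (φ : ℝ → ℝ) : Prop where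
  travelingWave : IsTravelingWave f D g c (Iio b) φ
  antitoneOn : AntitoneOn φ (Iio b)
  tendsto_atBot : Tendsto φ atBot (𝓝 1)
  tendsto_left : Tendsto φ (𝓝[<] b) (𝓝 β)

/-- A non-increasing semi-wavefront to `0` on `(a, ∞)`, connecting `β` to `0`. -/
structure IsSemiWavefrontToZero (f D g : ℝ → ℝ) (β c a : ℝ) (φ : ℝ → ℝ) : Prop where
  travelingWave : IsTravelingWave f D g c (Ioi a) φ
  antitoneOn : AntitoneOn φ (Ioi a)
  tendsto_right : Tendsto φ (𝓝[>] a) (𝓝 β)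
  tendsto_atTop : Tendsto φ atTop (𝓝 0)

/-- `cpl` is the threshold of the semi-wavefronts from `1` to `β` (region where `D > 0`): such
semi-wavefronts exist for every speed `c`, and their flux `D(φ) φ'` at the left of the end point has
limit zero if `c ≥ cpl`, and a negative limit if `c < cpl`. These properties determine `cpl`. -/
def IsThresholdPL (f D g : ℝ → ℝ) (β cpl : ℝ) : Prop :=
  ∀ c : ℝ, (∃ b φ, IsSemiWavefrontFromOne f D g β c b φ) ∧
    ∀ b φ, IsSemiWavefrontFromOne f D g β c b φ →
      (cpl ≤ c → Tendsto (fun ξ => D (φ ξ) * deriv φ ξ) (𝓝[<] b) (𝓝 0)) ∧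
      (c < cpl → ∃ l < 0, Tendsto (fun ξ => D (φ ξ) * deriv φ ξ) (𝓝[<] b) (𝓝 l))

/-- `cnr` is the threshold of the semi-wavefronts from `β` to `0` (region where `D < 0`): such
semi-wavefronts exist for every speed `c`, and their flux `D(φ) φ'` at the right of the end point has
limit zero if `c ≥ cnr`, and a positive limit if `c < cnr`. These properties determine `cnr`. -/
def IsThresholdNR (f D g : ℝ → ℝ) (β cnr : ℝ) : Prop :=
  ∀ c : ℝ, (∃ a φ, IsSemiWavefrontToZero f D g β c a φ) ∧
    ∀ a φ, IsSemiWavefrontToZero f D g β c a φ →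
      (cnr ≤ c → Tendsto (fun ξ => D (φ ξ) * deriv φ ξ) (𝓝[>] a) (𝓝 0)) ∧
      (c < cnr → ∃ l > 0, Tendsto (fun ξ => D (φ ξ) * deriv φ ξ) (𝓝[>] a) (𝓝 l))

/-- The derivative of a function given on `[0,1]` (one-sided at the end points). -/
noncomputable def unitDeriv (q : ℝ → ℝ) (ρ : ℝ) : ℝ := derivWithin q (Icc (0 : ℝ) 1) ρ

/-- The discriminant `(h(γ) - c)² - 4 D'(γ) g(γ)`, where `h = f'`. -/
noncomputable def sDiscr (f D g : ℝ → ℝ) (γ c : ℝ) : ℝ :=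
  (unitDeriv f γ - c) ^ 2 - 4 * unitDeriv D γ * g γ

/-- `s₋(γ, c)`. -/
noncomputable def sMinus (f D g : ℝ → ℝ) (γ c : ℝ) : ℝ :=
  (1 / 2) * (unitDeriv f γ - c - √(sDiscr f D g γ c))

/-- `s₊(γ, c)`. -/
noncomputable def sPlus (f D g : ℝ → ℝ) (γ c : ℝ) : ℝ :=
  (1 / 2) * (unitDeriv f γ - c + √(sDiscr f D g γ c))

/-- `φ'(ξ⁻) = L`, where `L` may be `-∞`: both the left difference quotients of `φ` at `ξ` and the
derivative `φ'(x)` converge to `L` as `x → ξ⁻`. -/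
def HasLeftSlope (φ : ℝ → ℝ) (ξ : ℝ) (L : EReal) : Prop :=
  (∀ᶠ x in 𝓝[<] ξ, DifferentiableAt ℝ φ x) ∧
  Tendsto (fun x => ((slope φ ξ x : ℝ) : EReal)) (𝓝[<] ξ) (𝓝 L) ∧
  Tendsto (fun x => ((deriv φ x : ℝ) : EReal)) (𝓝[<] ξ) (𝓝 L)

/-- `φ'(ξ⁺) = L`, where `L` may be `-∞`: both the right difference quotients of `φ` at `ξ` and the
derivative `φ'(x)` converge to `L` as `x → ξ⁺`. -/
def HasRightSlope (φ : ℝ → ℝ) (ξ : ℝ) (L : EReal) : Prop :=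
  (∀ᶠ x in 𝓝[>] ξ, DifferentiableAt ℝ φ x) ∧
  Tendsto (fun x => ((slope φ ξ x : ℝ) : EReal)) (𝓝[>] ξ) (𝓝 L) ∧
  Tendsto (fun x => ((deriv φ x : ℝ) : EReal)) (𝓝[>] ξ) (𝓝 L)

/-- The profile `φ` is classical in the open set `U`: it is differentiable, `D(φ) φ'` is (locally)
absolutely continuous, and `(D(φ) φ')' + (c - f'(φ)) φ' + g(φ) = 0` holds a.e. in `U`. -/
structure IsClassicalOn (f D g : ℝ → ℝ) (c : ℝ) (φ : ℝ → ℝ) (U : Set ℝ) : Prop where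
  differentiableAt : ∀ ξ ∈ U, DifferentiableAt ℝ φ ξ
  flux_ac : ∀ a b : ℝ, uIcc a b ⊆ U →
    AbsolutelyContinuousOnInterval (fun ξ => D (φ ξ) * deriv φ ξ) a b
  ode : ∀ᵐ ξ ∂(volume.restrict U),
    HasDerivAt (fun x => D (φ x) * deriv φ x)
      (-((c - unitDeriv f (φ ξ)) * deriv φ ξ + g (φ ξ))) ξ

/-- `φ` is classical at the value `l`: it is classical in a neighbourhood of every point at which it
takes the value `l`. -/
def IsClassicalAt (f D g : ℝ → ℝ) (c : ℝ) (φ : ℝ → ℝ) (l : ℝ) : Prop :=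
  ∀ ξ, φ ξ = l → ∃ ε > 0, IsClassicalOn f D g c φ (Ioo (ξ - ε) (ξ + ε))

/-- The profile `φ`, considered in the open interval `I`, is sharp at the value `l`, reached at the
point `ξ`: `φ` is classical in `I \ {ξ}` and not differentiable at `ξ`. -/
structure IsSharpAt (f D g : ℝ → ℝ) (c : ℝ) (φ : ℝ → ℝ) (I : Set ℝ) (l ξ : ℝ) : Prop where
  mem : ξ ∈ I
  eq : φ ξ = l
  classical : IsClassicalOn f D g c φ (I \ {ξ})
  not_differentiableAt : ¬ DifferentiableAt ℝ φ ξ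

/-!
Along a decreasing profile `φ` the flux `W = D(φ) φ'` is a function of the density. On the part of the
profile with values in `(0, β)`, where `D < 0`, it is `W = z(φ)`, where `z > 0` solves the singular
first-order problem `z' = h - c - D g / z`, `z(0) = 0` (`fluxProfile`). This problem has exactly one
solution on `[0, β]` for every `c`: existence follows by approximation with regular problems
(`exists_singularSolution`), and uniqueness from the monotone dependence of `z` on the data
(`IsSingularSolution.mono`), which also shows that `z` decreases in `c`. Hence `z(β) = 0` exactly for
`c` at or above a threshold (`fluxThreshold`). Conversely, the profile is recovered from `z` by inverting
the time `T` with `T' = D / z` (`IsAdmissible.exists_isTimeFunction`). So the semi-wavefront to zero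
exists for every `c`, is unique up to shifts, and leaves the level `β` with flux `z(β)`.

The change of variables `φ(ξ) ↦ 1 - φ(-ξ)` turns semi-wavefronts from `1` into semi-wavefronts to zero
of a reflected equation with the same speed, so the part of the profile with values in `(β, 1)` needs
no separate treatment. The flux is nonnegative on the right of the point `ξβ` where `φ = β` and
nonpositive on its left. As it is continuous (a consequence of the weak form of the equation,
`IsTravelingWave.exists_isStrongProfile`), the two parts can be joined if and only if both end fluxes
vanish, that is, if and only if `c` is at least both thresholds.

Since `φ' = z(φ) / D(φ)`, slopes and regularity of `φ` are read off from the behaviour of the quotient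
`-D / z` at `β` and at `0`. Where `-D / z` crosses a level `m`, the direction of
the crossing is given by the sign of the quadratic polynomial `slopePoly`. At `β` this forces the
quotient to converge to a root of the polynomial, which is the larger one above the threshold and the
smaller one at it (`IsAdmissible.larger_root`, `IsAdmissible.smaller_root`); these give `s₋` and `s₊`.
At `0` the polynomial is linear in `m`. If `h(0) < c`, or `h(0) = c` and `D'(0) < 0`, it is negative for
all `m > 0` and the quotient diverges, so that `φ'` tends to zero where `φ` does and the profile is
classical. If `c < h(0)`, the quotient tends to the root, which is finite: the profile reaches `0` at a
finite point with a nonzero slope, and is sharp there.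
-/

/-! ### Singular first-order problems -/

/-- A function which starts nonnegative and whose derivative is nonnegative wherever the function is
negative stays nonnegative. All comparison arguments below are instances of this. -/
lemma nonneg_of_deriv_nonneg_of_neg {w w' : ℝ → ℝ} {a b : ℝ} (hab : a ≤ b)
    (hw : ContinuousOn w (Icc a b)) (ha : 0 ≤ w a)
    (hd : ∀ x ∈ Ioo a b, HasDerivAt w (w' x) x) (hneg : ∀ x ∈ Ioo a b, w x < 0 → 0 ≤ w' x) :
    0 ≤ w b := by
  by_contra! hb
  let S := Icc a b ∩ w ⁻¹' Ici 0
  have hSc : IsCompact S := isCompact_Icc.of_isClosed_subset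
    (hw.preimage_isClosed_of_isClosed isClosed_Icc isClosed_Ici) inter_subset_left
  have hSn : S.Nonempty := ⟨a, ⟨le_rfl, hab⟩, ha⟩
  obtain ⟨s, ⟨⟨has, hsb⟩, hs0⟩, hsm⟩ := hSc.exists_isGreatest hSn
  have hs0' : 0 ≤ w s := hs0
  have hsb' : s < b := lt_of_le_of_ne hsb (fun h => by subst h; linarith)
  have hlt : ∀ x ∈ Ioo s b, w x < 0 := by
    intro x hx
    by_contra! h
    exact absurd (hsm ⟨⟨has.trans hx.1.le, hx.2.le⟩, h⟩) (not_le.2 hx.1)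
  obtain ⟨x, hx, hxe⟩ := exists_hasDerivAt_eq_slope w w' hsb'
    (hw.mono (Icc_subset_Icc_left has)) (fun x hx => hd x ⟨has.trans_lt hx.1, hx.2⟩)
  have h1 := hneg x ⟨has.trans_lt hx.1, hx.2⟩ (hlt x hx)
  rw [hxe, le_div_iff₀ (by linarith)] at h1
  linarith

/-- `z` solves the singular problem `z' = k + q / z`, `z > 0` on `(0, b)`, `z(0) = 0`, and is
continuous up to the end points. -/
structure IsSingularSolution (k q : ℝ → ℝ) (b : ℝ) (z : ℝ → ℝ) : Prop where
  continuousOn : ContinuousOn z (Icc 0 b)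
  zero : z 0 = 0
  pos : ∀ x ∈ Ioo 0 b, 0 < z x
  hasDerivAt : ∀ x ∈ Ioo 0 b, HasDerivAt z (k x + q x / z x) x

lemma IsSingularSolution.end_nonneg {k q z : ℝ → ℝ} {b : ℝ} (hb : 0 < b)
    (h : IsSingularSolution k q b z) : 0 ≤ z b := by
  have hc : ContinuousWithinAt z (Ioo 0 b) b :=
    (h.continuousOn b ⟨hb.le, le_rfl⟩).mono Ioo_subset_Icc_self
  have : (𝓝[Ioo 0 b] b).NeBot := by
    rw [← mem_closure_iff_nhdsWithin_neBot, closure_Ioo hb.ne]; exact ⟨hb.le, le_rfl⟩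
  exact ge_of_tendsto hc (eventually_nhdsWithin_of_forall fun x hx => (h.pos x hx).le)

lemma IsSingularSolution.nonneg {k q z : ℝ → ℝ} {b : ℝ} (hb : 0 < b)
    (h : IsSingularSolution k q b z) {x : ℝ} (hx : x ∈ Icc 0 b) : 0 ≤ z x := by
  rcases eq_or_lt_of_le hx.1 with h0 | h0
  · rw [← h0, h.zero]
  rcases eq_or_lt_of_le hx.2 with h1 | h1
  · rw [h1]; exact h.end_nonneg hb
  · exact (h.pos x ⟨h0, h1⟩).le

/-- Solutions decrease when the forcing term `k` does. -/
lemma IsSingularSolution.mono {k₁ k₂ q z₁ z₂ : ℝ → ℝ} {b : ℝ}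
    (hq : ∀ x ∈ Ioo 0 b, 0 ≤ q x) (hk : ∀ x ∈ Ioo 0 b, k₂ x ≤ k₁ x)
    (h₁ : IsSingularSolution k₁ q b z₁) (h₂ : IsSingularSolution k₂ q b z₂)
    {x : ℝ} (hx : x ∈ Icc 0 b) : z₂ x ≤ z₁ x := by
  have hI : Icc 0 x ⊆ Icc 0 b := Icc_subset_Icc_right hx.2
  have hI' : Ioo 0 x ⊆ Ioo 0 b := Ioo_subset_Ioo_right hx.2
  refine sub_nonneg.1 (nonneg_of_deriv_nonneg_of_neg (w := fun t => z₁ t - z₂ t) hx.1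
    ((h₁.continuousOn.mono hI).sub (h₂.continuousOn.mono hI)) (by simp [h₁.zero, h₂.zero])
    (fun t ht => (h₁.hasDerivAt t (hI' ht)).sub (h₂.hasDerivAt t (hI' ht))) ?_)
  intro t ht hlt
  have h1 := h₁.pos t (hI' ht)
  have := hk t (hI' ht)
  have : q t / z₂ t ≤ q t / z₁ t :=
    div_le_div_of_nonneg_left (hq t (hI' ht)) h1 (by linarith)
  linarith

/-- Solutions depend on the forcing term in a Lipschitz way: the flow is a contraction. -/
lemma IsSingularSolution.sub_le {k q z₁ z₂ : ℝ → ℝ} {b d : ℝ} (hd : 0 ≤ d)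
    (hq : ∀ x ∈ Ioo 0 b, 0 ≤ q x)
    (h₁ : IsSingularSolution (fun x => k x + d) q b z₁) (h₂ : IsSingularSolution k q b z₂)
    {x : ℝ} (hx : x ∈ Icc 0 b) : z₁ x - z₂ x ≤ d * x := by
  have hI : Icc 0 x ⊆ Icc 0 b := Icc_subset_Icc_right hx.2
  have hI' : Ioo 0 x ⊆ Ioo 0 b := Ioo_subset_Ioo_right hx.2
  refine sub_nonneg.1 (nonneg_of_deriv_nonneg_of_neg (w := fun t => d * t - (z₁ t - z₂ t)) hx.1
    ((continuousOn_const.mul continuousOn_id).sub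
      ((h₁.continuousOn.mono hI).sub (h₂.continuousOn.mono hI))) (by simp [h₁.zero, h₂.zero])
    (fun t ht => ((hasDerivAt_id t).const_mul d).sub
      ((h₁.hasDerivAt t (hI' ht)).sub (h₂.hasDerivAt t (hI' ht)))) ?_)
  intro t ht _
  have h2 := h₂.pos t (hI' ht)
  have hm := h₁.mono hq (fun y _ => by linarith) h₂ (x := t)
    ⟨ht.1.le, ht.2.le.trans hx.2⟩
  have : q t / z₁ t ≤ q t / z₂ t := div_le_div_of_nonneg_left (hq t (hI' ht)) h2 hm
  linarith

/-- Away from the singularity: if `k + p / ε ≥ 0`, the level `ε` is a lower barrier, and the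
solution of `z' = k + p / z` with `z(0) = ε` exists on the whole interval. -/
lemma exists_regular_solution {k p : ℝ → ℝ} {b ε : ℝ} (hb : 0 ≤ b) (hε : 0 < ε)
    (hk : ContinuousOn k (Icc 0 b)) (hp : ContinuousOn p (Icc 0 b))
    (h : ∀ x ∈ Icc 0 b, 0 ≤ k x + p x / ε) :
    ∃ z : ℝ → ℝ, z 0 = ε ∧ ContinuousOn z (Icc 0 b) ∧ (∀ x ∈ Icc 0 b, ε ≤ z x) ∧
      ∀ x ∈ Ioo 0 b, HasDerivAt z (k x + p x / z x) x := by
  obtain ⟨Ck, hCk⟩ := isCompact_Icc.exists_bound_of_continuousOn hk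
  obtain ⟨Cp, hCp⟩ := isCompact_Icc.exists_bound_of_continuousOn hp
  have h0 : (0 : ℝ) ∈ Icc 0 b := ⟨le_rfl, hb⟩
  have hCk0 : 0 ≤ Ck := (norm_nonneg _).trans (hCk 0 h0)
  have hCp0 : 0 ≤ Cp := (norm_nonneg _).trans (hCp 0 h0)
  have hmax : ∀ z : ℝ, 0 < max z ε := fun z => lt_max_of_lt_right hε
  have hPL : IsPicardLindelof (fun x z => k x + p x / max z ε) (tmin := 0) (tmax := b)
      ⟨0, h0⟩ ε ⟨(Ck + Cp / ε) * b, by positivity⟩ 0 ⟨Ck + Cp / ε, by positivity⟩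
      ⟨Cp / ε ^ 2, by positivity⟩ := by
    constructor
    · intro t ht
      refine LipschitzOnWith.of_dist_le_mul fun z _ w _ => ?_
      have e : (k t + p t / max z ε) - (k t + p t / max w ε)
          = p t * (max w ε - max z ε) / (max z ε * max w ε) := by
        have := (hmax z).ne'; have := (hmax w).ne'; field_simp; ring
      rw [Real.dist_eq, Real.dist_eq, e, abs_div, abs_mul, abs_of_pos (mul_pos (hmax z) (hmax w))]
      have h1 : |max w ε - max z ε| ≤ |z - w| := by
        rw [abs_sub_comm z w]; exact abs_max_sub_max_le_abs w z ε
      have h2 : |p t| ≤ Cp := hCp t ht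
      have h3 : ε ^ 2 ≤ max z ε * max w ε := by
        rw [sq]; exact mul_le_mul (le_max_right _ _) (le_max_right _ _) hε.le (hmax z).le
      calc |p t| * |max w ε - max z ε| / (max z ε * max w ε)
          ≤ Cp * |z - w| / ε ^ 2 := by gcongr
        _ = Cp / ε ^ 2 * |z - w| := by ring
    · intro z _
      exact hk.add (hp.div_const _)
    · intro t ht z _
      refine (norm_add_le _ _).trans (add_le_add (hCk t ht) ?_)
      rw [norm_div, Real.norm_of_nonneg (hmax z).le]
      have := hCp t ht
      have : ε ≤ max z ε := le_max_right _ _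
      gcongr
    · simp only [sub_zero, sub_self]
      rw [max_eq_left hb]
      change (Ck + Cp / ε) * b ≤ (Ck + Cp / ε) * b - 0
      simp
  obtain ⟨z, hz0, hz⟩ := hPL.exists_eq_forall_mem_Icc_hasDerivWithinAt₀
  have hz0 : z 0 = ε := hz0
  have hc : ContinuousOn z (Icc 0 b) := HasDerivWithinAt.continuousOn hz
  have hzd : ∀ x ∈ Ioo 0 b, HasDerivAt z (k x + p x / max (z x) ε) x := fun x hx =>
    (hz x (Ioo_subset_Icc_self hx)).hasDerivAt (Icc_mem_nhds hx.1 hx.2)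
  have hge : ∀ x ∈ Icc 0 b, ε ≤ z x := by
    intro x hx
    refine sub_nonneg.1 (nonneg_of_deriv_nonneg_of_neg (w := fun t => z t - ε) hx.1
      ((hc.mono (Icc_subset_Icc_right hx.2)).sub continuousOn_const) (by simp [hz0])
      (fun t ht => (hzd t ⟨ht.1, ht.2.trans_le hx.2⟩).sub_const ε) ?_)
    intro t ht hlt
    rw [max_eq_right (by linarith)]
    exact h t ⟨ht.1.le, ht.2.le.trans hx.2⟩
  refine ⟨z, hz0, hc, hge, fun x hx => ?_⟩
  have := hzd x hx
  rwa [max_eq_left (hge x (Ioo_subset_Icc_self hx))] at this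

/-- A pointwise limit of solutions of `z' = k + p n / z` that are uniformly bounded away from zero
solves the limit equation. -/
lemma hasDerivAt_of_tendsto_solutions {k q : ℝ → ℝ} {p : ℕ → ℝ → ℝ} {z : ℕ → ℝ → ℝ}
    {Z : ℝ → ℝ} {x₁ x₂ C η : ℝ} (hη : 0 < η)
    (hk : ContinuousOn k (Icc x₁ x₂)) (hq : ContinuousOn q (Icc x₁ x₂))
    (hpc : ∀ n, ContinuousOn (p n) (Icc x₁ x₂))
    (hkC : ∀ x ∈ Icc x₁ x₂, |k x| ≤ C) (hpC : ∀ n, ∀ x ∈ Icc x₁ x₂, |p n x| ≤ C)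
    (hp : ∀ x ∈ Icc x₁ x₂, Tendsto (fun n => p n x) atTop (𝓝 (q x)))
    (hz : ∀ n, ∀ x ∈ Icc x₁ x₂, HasDerivAt (z n) (k x + p n x / z n x) x)
    (hzη : ∀ n, ∀ x ∈ Icc x₁ x₂, η ≤ z n x)
    (hZ : ∀ x ∈ Icc x₁ x₂, Tendsto (fun n => z n x) atTop (𝓝 (Z x))) :
    ∀ x ∈ Ioo x₁ x₂, HasDerivAt Z (k x + q x / Z x) x := by
  intro x hx
  have hle : x₁ ≤ x₂ := (hx.1.trans hx.2).le
  have h1 : x₁ ∈ Icc x₁ x₂ := ⟨le_rfl, hle⟩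
  have hC0 : 0 ≤ C := (abs_nonneg _).trans (hkC x₁ h1)
  have hZη : ∀ y ∈ Icc x₁ x₂, η ≤ Z y := fun y hy =>
    ge_of_tendsto' (hZ y hy) fun n => hzη n y hy
  have hbound : ∀ n, ∀ y ∈ Icc x₁ x₂, ‖k y + p n y / z n y‖ ≤ C + C / η := by
    intro n y hy
    refine (norm_add_le _ _).trans (add_le_add (hkC y hy) ?_)
    have h2 := hzη n y hy
    rw [norm_div, Real.norm_of_nonneg (hη.le.trans h2)]
    have := hpC n y hy
    gcongr
    exact this
  -- the approximations are uniformly Lipschitz, hence so is the limit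
  have hlip : ∀ y ∈ Icc x₁ x₂, ∀ y' ∈ Icc x₁ x₂, |Z y - Z y'| ≤ (C + C / η) * |y - y'| := by
    intro y hy y' hy'
    refine le_of_tendsto' ((hZ y hy).sub (hZ y' hy')).abs fun n => ?_
    have := (convex_Icc x₁ x₂).norm_image_sub_le_of_norm_hasDerivWithin_le
      (fun t ht => (hz n t ht).hasDerivWithinAt) (hbound n) hy' hy
    simpa [Real.norm_eq_abs] using this
  have hZc : ContinuousOn Z (Icc x₁ x₂) := by
    refine LipschitzOnWith.continuousOn (K := ⟨C + C / η, by positivity⟩) ?_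
    exact LipschitzOnWith.of_dist_le_mul fun y hy y' hy' => by
      rw [Real.dist_eq, Real.dist_eq]; exact hlip y hy y' hy'
  have hrhs : ContinuousOn (fun y => k y + q y / Z y) (Icc x₁ x₂) :=
    hk.add (hq.div hZc fun y hy => (hη.trans_le (hZη y hy)).ne')
  have hint : ∀ y ∈ Icc x₁ x₂, Z y = Z x₁ + ∫ t in x₁..y, (k t + q t / Z t) := by
    intro y hy
    have hsub : Icc x₁ y ⊆ Icc x₁ x₂ := Icc_subset_Icc_right hy.2
    have hcn : ∀ n, ContinuousOn (fun t => k t + p n t / z n t) (Icc x₁ x₂) := fun n =>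
      hk.add ((hpc n).div (fun t ht => (hz n t ht).continuousAt.continuousWithinAt)
        fun t ht => (hη.trans_le (hzη n t ht)).ne')
    have e : ∀ n, ∫ t in x₁..y, (k t + p n t / z n t) = z n y - z n x₁ := by
      intro n
      refine intervalIntegral.integral_eq_sub_of_hasDerivAt (fun t ht => hz n t ?_) ?_
      · rw [uIcc_of_le hy.1] at ht; exact hsub ht
      · refine ContinuousOn.intervalIntegrable ?_
        rw [uIcc_of_le hy.1]; exact (hcn n).mono hsub
    have hlim : Tendsto (fun n => ∫ t in x₁..y, (k t + p n t / z n t)) atTop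
        (𝓝 (∫ t in x₁..y, (k t + q t / Z t))) := by
      refine intervalIntegral.tendsto_integral_filter_of_dominated_convergence
        (fun _ => C + C / η) (Eventually.of_forall fun n => ?_) (Eventually.of_forall fun n => ?_)
        intervalIntegrable_const ?_
      · refine ((hcn n).mono ?_).aestronglyMeasurable measurableSet_uIoc
        rw [uIoc_of_le hy.1]; exact Ioc_subset_Icc_self.trans hsub
      · refine Eventually.of_forall fun t ht => hbound n t ?_
        rw [uIoc_of_le hy.1] at ht; exact hsub (Ioc_subset_Icc_self ht)
      · refine Eventually.of_forall fun t ht => ?_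
        rw [uIoc_of_le hy.1] at ht
        have ht' := hsub (Ioc_subset_Icc_self ht)
        exact tendsto_const_nhds.add ((hp t ht').div (hZ t ht') (hη.trans_le (hZη t ht')).ne')
    simp only [e] at hlim
    have := tendsto_nhds_unique hlim ((hZ y hy).sub (hZ x₁ h1))
    linarith
  have hder : HasDerivAt (fun y => Z x₁ + ∫ t in x₁..y, (k t + q t / Z t)) (k x + q x / Z x) x := by
    refine HasDerivAt.const_add _ (intervalIntegral.integral_hasDerivAt_right ?_ ?_ ?_)
    · refine ContinuousOn.intervalIntegrable ?_
      rw [uIcc_of_le hx.1.le]; exact hrhs.mono (Icc_subset_Icc_right hx.2.le)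
    · exact hrhs.stronglyMeasurableAtFilter_nhdsWithin measurableSet_Icc x |>.filter_mono
        (by rw [nhdsWithin_eq_nhds.2 (Icc_mem_nhds hx.1 hx.2)])
    · exact hrhs.continuousAt (Icc_mem_nhds hx.1 hx.2)
  refine hder.congr_of_eventuallyEq ?_
  filter_upwards [Icc_mem_nhds hx.1 hx.2] with y hy using hint y hy

/-- Existence for the singular problem, as the decreasing limit of the regular solutions started at
the height `ε`, with `q` replaced by `q + C ε` so that `ε` is a lower barrier. -/
theorem exists_singularSolution {k q : ℝ → ℝ} {b : ℝ} (hb : 0 < b)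
    (hk : ContinuousOn k (Icc 0 b)) (hq : ContinuousOn q (Icc 0 b))
    (hq0 : ∀ x ∈ Ioo 0 b, 0 < q x) : ∃ z, IsSingularSolution k q b z := by
  obtain ⟨Ck, hCk⟩ := isCompact_Icc.exists_bound_of_continuousOn hk
  obtain ⟨Cq, hCq⟩ := isCompact_Icc.exists_bound_of_continuousOn hq
  have h0 : (0 : ℝ) ∈ Icc 0 b := ⟨le_rfl, hb.le⟩
  set C := max Ck 1 with hCdef
  have hC1 : 1 ≤ C := le_max_right _ _
  have hkC : ∀ x ∈ Icc 0 b, |k x| ≤ C := fun x hx => (hCk x hx).trans (le_max_left _ _)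
  have hCq0 : 0 ≤ Cq := (norm_nonneg _).trans (hCq 0 h0)
  have hqn : ∀ x ∈ Icc 0 b, 0 ≤ q x := by
    intro x hx
    have hcl : x ∈ closure (Ioo 0 b) := by rwa [closure_Ioo hb.ne]
    have : (𝓝[Ioo 0 b] x).NeBot := mem_closure_iff_nhdsWithin_neBot.1 hcl
    exact ge_of_tendsto ((hq x hx).mono Ioo_subset_Icc_self)
      (eventually_nhdsWithin_of_forall fun y hy => (hq0 y hy).le)
  let ε : ℕ → ℝ := fun n => 1 / ((n : ℝ) + 1)
  have hε : ∀ n, 0 < ε n := fun n => by positivity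
  have hε1 : ∀ n, ε n ≤ 1 := fun n => by
    simp only [ε]; rw [div_le_one (by positivity)]; linarith [n.cast_nonneg (α := ℝ)]
  have hεanti : ∀ n m, n ≤ m → ε m ≤ ε n := fun n m h =>
    one_div_le_one_div_of_le (by positivity) (by gcongr)
  have hεlim : Tendsto ε atTop (𝓝 0) := tendsto_one_div_add_atTop_nhds_zero_nat
  let p : ℕ → ℝ → ℝ := fun n x => q x + C * ε n
  have hpc : ∀ n, ContinuousOn (p n) (Icc 0 b) := fun n => hq.add continuousOn_const
  have hex : ∀ n, ∃ z : ℝ → ℝ, z 0 = ε n ∧ ContinuousOn z (Icc 0 b) ∧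
      (∀ x ∈ Icc 0 b, ε n ≤ z x) ∧ ∀ x ∈ Ioo 0 b, HasDerivAt z (k x + p n x / z x) x := by
    intro n
    refine exists_regular_solution hb.le (hε n) hk (hpc n) fun x hx => ?_
    have h1 := neg_le_of_abs_le (hkC x hx)
    have h2 : p n x / ε n = q x / ε n + C := by
      have := (hε n).ne'; simp only [p]; field_simp
    have h3 : 0 ≤ q x / ε n := div_nonneg (hqn x hx) (hε n).le
    linarith
  choose z hz0 hzc hzε hzd using hex
  have hzpos : ∀ n, ∀ x ∈ Icc 0 b, 0 < z n x := fun n x hx => (hε n).trans_le (hzε n x hx)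
  have hanti : ∀ n m, n ≤ m → ∀ x ∈ Icc 0 b, z m x ≤ z n x := by
    intro n m hnm x hx
    refine sub_nonneg.1 (nonneg_of_deriv_nonneg_of_neg (w := fun t => z n t - z m t) hx.1
      (((hzc n).sub (hzc m)).mono (Icc_subset_Icc_right hx.2))
      (by simpa [hz0] using hεanti n m hnm)
      (fun t ht => (hzd n t ⟨ht.1, ht.2.trans_le hx.2⟩).sub (hzd m t ⟨ht.1, ht.2.trans_le hx.2⟩)) ?_)
    intro t ht hlt
    have ht' : t ∈ Icc 0 b := ⟨ht.1.le, ht.2.le.trans hx.2⟩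
    have h1 : p m t / z m t ≤ p n t / z n t := by
      have h2 : p m t ≤ p n t := by
        have := mul_le_mul_of_nonneg_left (hεanti n m hnm) (zero_le_one.trans hC1)
        simp only [p]; linarith
      have h3 : 0 ≤ p n t := add_nonneg (hqn t ht') (mul_nonneg (by linarith) (hε n).le)
      exact div_le_div₀ h3 h2 (hzpos n t ht') (by linarith)
    linarith
  -- lower bound, uniform in `n`, on compact subintervals
  have hlow : ∀ x₁ x₂, 0 < x₁ → x₂ < b → ∃ η > 0, ∀ n, ∀ x ∈ Icc x₁ x₂, η ≤ z n x := by
    intro x₁ x₂ h1 h2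
    rcases lt_or_ge x₂ x₁ with h21 | h12
    · exact ⟨1, one_pos, fun n x hx => absurd (hx.1.trans hx.2) (not_le.2 h21)⟩
    have hsub : Icc (x₁ / 2) x₂ ⊆ Ioo 0 b := fun t ht => ⟨by linarith [ht.1], by linarith [ht.2]⟩
    obtain ⟨y, hy, hymin⟩ := isCompact_Icc.exists_isMinOn (s := Icc (x₁ / 2) x₂)
      ⟨x₂, by constructor <;> linarith⟩ ((hq.mono Ioo_subset_Icc_self).mono hsub)
    have hqy := hq0 y (hsub hy)
    set η := min 1 (q y / (C + 2 / x₁)) with hη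
    have hden : 0 < C + 2 / x₁ := by positivity
    have hη0 : 0 < η := lt_min one_pos (div_pos hqy hden)
    refine ⟨η, hη0, fun n x hx => ?_⟩
    have hxl : 0 < x - x₁ / 2 := by linarith [hx.1]
    have key := nonneg_of_deriv_nonneg_of_neg (a := x₁ / 2) (b := x)
      (w := fun t => z n t - η * ((t - x₁ / 2) / (x - x₁ / 2)))
      (w' := fun t => k t + p n t / z n t - η * (1 / (x - x₁ / 2))) (by linarith)
      (((hzc n).mono fun t ht => ⟨by linarith [ht.1], by linarith [ht.2, hx.2]⟩).sub
        (by fun_prop)) ?_ ?_ ?_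
    · simp only [div_self hxl.ne', mul_one] at key; linarith
    · simpa using (hzpos n _ ⟨by linarith, by linarith⟩).le
    · intro t ht
      refine (hzd n t ⟨by linarith [ht.1], by linarith [ht.2, hx.2]⟩).sub (HasDerivAt.const_mul η ?_)
      exact ((hasDerivAt_id t).sub_const _).div_const _
    · intro t ht hlt
      have htI : t ∈ Icc (x₁ / 2) x₂ := ⟨ht.1.le, ht.2.le.trans hx.2⟩
      have ht' : t ∈ Icc 0 b := Ioo_subset_Icc_self (hsub htI)
      have hk1 := neg_le_of_abs_le (hkC t ht')
      have hzt := hzpos n t ht'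
      have hfrac : (t - x₁ / 2) / (x - x₁ / 2) ≤ 1 := by
        rw [div_le_one hxl]; linarith [ht.2]
      have hzη : z n t ≤ η := by
        have := mul_le_mul_of_nonneg_left hfrac hη0.le
        linarith
      have hq1 : q y ≤ p n t := by
        have : q y ≤ q t := hymin htI
        have : 0 ≤ C * ε n := mul_nonneg (by linarith) (hε n).le
        simp only [p]; linarith
      have h3 : C + 2 / x₁ ≤ p n t / z n t := by
        rw [le_div_iff₀ hzt]
        calc (C + 2 / x₁) * z n t ≤ (C + 2 / x₁) * (q y / (C + 2 / x₁)) :=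
              mul_le_mul_of_nonneg_left (hzη.trans (min_le_right _ _)) hden.le
          _ = q y := mul_div_cancel₀ _ hden.ne'
          _ ≤ p n t := hq1
      have h4 : η * (1 / (x - x₁ / 2)) ≤ 2 / x₁ := by
        calc η * (1 / (x - x₁ / 2)) ≤ 1 * (1 / (x₁ / 2)) := by
              gcongr
              · exact min_le_left _ _
              · linarith [hx.1]
          _ = 2 / x₁ := by field_simp
      linarith
  -- upper bound, linear in `x`
  have hup : ∀ η, 0 < η → ∀ n, ε n ≤ η → ∀ x ∈ Icc 0 b, z n x ≤ η + (C + (Cq + C) / η) * x := by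
    intro η hη n hn x hx
    refine sub_nonneg.1 (nonneg_of_deriv_nonneg_of_neg
      (w := fun t => η + (C + (Cq + C) / η) * t - z n t) hx.1
      (ContinuousOn.sub (by fun_prop) ((hzc n).mono (Icc_subset_Icc_right hx.2)))
      (by simpa [hz0] using hn)
      (fun t ht => (((hasDerivAt_id t).const_mul _).const_add _).sub
        (hzd n t ⟨ht.1, ht.2.trans_le hx.2⟩)) ?_)
    intro t ht hlt
    have ht' : t ∈ Icc 0 b := ⟨ht.1.le, ht.2.le.trans hx.2⟩
    have hzη : η ≤ z n t := by
      have : 0 ≤ (C + (Cq + C) / η) * t := mul_nonneg (by positivity) ht.1.le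
      linarith
    have h1 := le_of_abs_le (hkC t ht')
    have h2 : p n t / z n t ≤ (Cq + C) / η := by
      have h3 : p n t ≤ Cq + C := by
        have := le_of_abs_le (hCq t ht')
        have := mul_le_mul_of_nonneg_left (hε1 n) (zero_le_one.trans hC1)
        simp only [p]; linarith
      gcongr
    linarith
  let Z₀ : ℝ → ℝ := fun x => ⨅ n, z n x
  have hZ₀ : ∀ x ∈ Icc 0 b, Tendsto (fun n => z n x) atTop (𝓝 (Z₀ x)) := fun x hx =>
    tendsto_atTop_ciInf (fun n m h => hanti n m h x hx)
      ⟨0, by rintro _ ⟨n, rfl⟩; exact (hzpos n x hx).le⟩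
  have hZd : ∀ x ∈ Ioo 0 b, HasDerivAt Z₀ (k x + q x / Z₀ x) x := by
    intro x hx
    have hx1 : x / 2 < x := by linarith [hx.1]
    have hx2 : x < (x + b) / 2 := by linarith [hx.2]
    have hsub : Icc (x / 2) ((x + b) / 2) ⊆ Ioo 0 b := fun t ht =>
      ⟨by linarith [ht.1, hx.1], by linarith [ht.2, hx.2]⟩
    have hsub' := hsub.trans Ioo_subset_Icc_self
    obtain ⟨η, hη, hlow'⟩ := hlow (x / 2) ((x + b) / 2) (by linarith [hx.1]) (by linarith [hx.2])
    refine hasDerivAt_of_tendsto_solutions (C := C + Cq) hη (hk.mono hsub') (hq.mono hsub')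
      (fun n => (hpc n).mono hsub') (fun t ht => (hkC t (hsub' ht)).trans (by linarith))
      (fun n t ht => ?_) (fun t ht => ?_) (fun n t ht => hzd n t (hsub ht)) hlow'
      (fun t ht => hZ₀ t (hsub' ht)) x ⟨hx1, hx2⟩
    · have h1 := hqn t (hsub' ht)
      have h2 := le_of_abs_le (hCq t (hsub' ht))
      have h3 := mul_le_mul_of_nonneg_left (hε1 n) (zero_le_one.trans hC1)
      have h4 : 0 ≤ C * ε n := mul_nonneg (by linarith) (hε n).le
      simp only [p]
      rw [abs_of_nonneg (by linarith)]; linarith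
    · simpa using tendsto_const_nhds.add (hεlim.const_mul C)
  have hZ0 : Z₀ 0 = 0 := by
    refine tendsto_nhds_unique (hZ₀ 0 h0) ?_
    simpa only [hz0] using hεlim
  have hZpos : ∀ x ∈ Ioo 0 b, 0 < Z₀ x := by
    intro x hx
    obtain ⟨η, hη, h⟩ := hlow x x hx.1 hx.2
    exact hη.trans_le (ge_of_tendsto' (hZ₀ x (Ioo_subset_Icc_self hx)) fun n => h n x ⟨le_rfl, le_rfl⟩)
  have hZup : ∀ η, 0 < η → ∀ x ∈ Icc 0 b, Z₀ x ≤ η + (C + (Cq + C) / η) * x := by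
    intro η hη x hx
    refine le_of_tendsto (hZ₀ x hx) ?_
    filter_upwards [hεlim.eventually (gt_mem_nhds hη)] with n hn using hup η hη n hn.le x hx
  -- `Z₀ + C x` is nondecreasing and bounded, so it has a limit at `b`
  have hmono : MonotoneOn (fun x => Z₀ x + C * x) (Ioo 0 b) := by
    refine monotoneOn_of_deriv_nonneg (convex_Ioo 0 b) ?_ ?_ ?_
    · exact fun x hx => ((hZd x hx).continuousAt.add (by fun_prop)).continuousWithinAt
    · rw [interior_Ioo]
      exact fun x hx => ((hZd x hx).add ((hasDerivAt_id x).const_mul C)).differentiableAt.differentiableWithinAt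
    · rw [interior_Ioo]
      intro x hx
      have hd : HasDerivAt (fun x => Z₀ x + C * x) (k x + q x / Z₀ x + C * 1) x :=
        (hZd x hx).add ((hasDerivAt_id x).const_mul C)
      rw [hd.deriv]
      have := neg_le_of_abs_le (hkC x (Ioo_subset_Icc_self hx))
      have := div_nonneg (hq0 x hx).le (hZpos x hx).le
      linarith
  have hbdd : BddAbove ((fun x => Z₀ x + C * x) '' Ioo 0 b) := by
    refine ⟨1 + (C + (Cq + C) / 1) * b + C * b, ?_⟩
    rintro _ ⟨x, hx, rfl⟩
    have h1 := hZup 1 one_pos x (Ioo_subset_Icc_self hx)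
    have h2 : (C + (Cq + C) / 1) * x ≤ (C + (Cq + C) / 1) * b :=
      mul_le_mul_of_nonneg_left hx.2.le (by positivity)
    have h3 : C * x ≤ C * b := mul_le_mul_of_nonneg_left hx.2.le (by linarith)
    simp only; linarith
  have hlim : ∃ l, Tendsto Z₀ (𝓝[<] b) (𝓝 l) := by
    have h1 := hmono.tendsto_nhdsWithin_Ioo_left (nonempty_Ioo.2 hb) hbdd
    refine ⟨_, (h1.sub ((continuous_const.mul continuous_id).tendsto b |>.mono_left
      nhdsWithin_le_nhds : Tendsto (fun x => C * x) (𝓝[<] b) _)).congr fun x => ?_⟩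
    exact add_sub_cancel_right (Z₀ x) (C * x)
  obtain ⟨l, hl⟩ := hlim
  refine ⟨Function.update Z₀ b l, ?_, ?_, ?_, ?_⟩
  · intro x hx
    rcases eq_or_lt_of_le hx.2 with hxb | hxb
    · subst hxb
      rw [continuousWithinAt_update_same]
      refine hl.mono_left (nhdsWithin_mono _ fun y hy => ?_)
      exact lt_of_le_of_ne hy.1.2 hy.2
    · rw [continuousWithinAt_update_of_ne hxb.ne]
      rcases eq_or_lt_of_le hx.1 with hx0 | hx0
      · subst hx0
        rw [Metric.continuousWithinAt_iff']
        intro r hr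
        have h1 : Tendsto (fun x : ℝ => r / 2 + (C + (Cq + C) / (r / 2)) * x) (𝓝[Icc 0 b] 0)
            (𝓝 (r / 2 + (C + (Cq + C) / (r / 2)) * 0)) :=
          (Continuous.tendsto (by fun_prop) 0).mono_left nhdsWithin_le_nhds
        filter_upwards [h1.eventually (gt_mem_nhds (show _ < r by linarith)), self_mem_nhdsWithin]
          with x hx1 hx2
        have h2 := hZup (r / 2) (by linarith) x hx2
        have h3 : 0 ≤ Z₀ x := ge_of_tendsto' (hZ₀ x hx2) fun n => (hzpos n x hx2).le
        rw [Real.dist_eq, hZ0, sub_zero, abs_of_nonneg h3]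
        linarith
      · exact (hZd x ⟨hx0, hxb⟩).continuousAt.continuousWithinAt
  · rw [Function.update_of_ne hb.ne, hZ0]
  · intro x hx
    rw [Function.update_of_ne hx.2.ne]; exact hZpos x hx
  · intro x hx
    rw [Function.update_of_ne hx.2.ne]
    refine (hZd x hx).congr_of_eventuallyEq ?_
    filter_upwards [Iio_mem_nhds hx.2] with y hy using Function.update_of_ne (ne_of_lt hy) _ _

/-! ### The flux as a function of the density, and its threshold speed -/

/-- The standing assumptions on the convection `f`, the diffusivity `D`, which changes sign from
negative to positive at `β`, and the reaction `g`. -/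
structure IsAdmissible (f D g : ℝ → ℝ) (β : ℝ) : Prop where
  f_contDiff : ContDiffOn ℝ 1 f (Icc 0 1)
  g_cont : ContinuousOn g (Icc 0 1)
  g_pos : ∀ ρ ∈ Ioo (0 : ℝ) 1, 0 < g ρ
  g_zero : g 0 = 0
  g_one : g 1 = 0
  β_mem : β ∈ Ioo (0 : ℝ) 1
  D_contDiff : ContDiffOn ℝ 1 D (Icc 0 1)
  D_neg : ∀ ρ ∈ Ioo 0 β, D ρ < 0
  D_pos : ∀ ρ ∈ Ioo β 1, 0 < D ρ

/-- The flux `z = D(φ) φ'`, as a function of `φ ∈ (0, β)`: it solves `z' = h - c - D g / z`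
with `z(0) = 0`. -/
abbrev IsFluxProfile (f D g : ℝ → ℝ) (β c : ℝ) (z : ℝ → ℝ) : Prop :=
  IsSingularSolution (fun x => unitDeriv f x - c) (fun x => -(D x * g x)) β z

/-- The solution of the flux equation with speed `c` (unique on `[0, β]`). -/
noncomputable def fluxProfile (f D g : ℝ → ℝ) (β c : ℝ) : ℝ → ℝ :=
  Classical.epsilon (IsFluxProfile f D g β c)

/-- The threshold speed: the least `c` for which the flux vanishes at `β`. -/
noncomputable def fluxThreshold (f D g : ℝ → ℝ) (β : ℝ) : ℝ :=
  sInf {c | fluxProfile f D g β c β = 0}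

lemma hasDerivWithinAt_unitDeriv {p : ℝ → ℝ} (hp : ContDiffOn ℝ 1 p (Icc 0 1)) {x : ℝ}
    (hx : x ∈ Icc (0 : ℝ) 1) : HasDerivWithinAt p (unitDeriv p x) (Icc 0 1) x :=
  (hp.differentiableOn one_ne_zero x hx).hasDerivWithinAt

lemma hasDerivAt_unitDeriv {p : ℝ → ℝ} (hp : ContDiffOn ℝ 1 p (Icc 0 1)) {x : ℝ}
    (hx : x ∈ Ioo (0 : ℝ) 1) : HasDerivAt p (unitDeriv p x) x :=
  (hasDerivWithinAt_unitDeriv hp (Ioo_subset_Icc_self hx)).hasDerivAt (Icc_mem_nhds hx.1 hx.2)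

lemma continuousOn_unitDeriv {p : ℝ → ℝ} (hp : ContDiffOn ℝ 1 p (Icc 0 1)) :
    ContinuousOn (unitDeriv p) (Icc 0 1) :=
  hp.continuousOn_derivWithin (uniqueDiffOn_Icc zero_lt_one) le_rfl

namespace IsAdmissible

variable {f D g : ℝ → ℝ} {β : ℝ}

lemma Icc_subset (S : IsAdmissible f D g β) : Icc 0 β ⊆ Icc 0 1 :=
  Icc_subset_Icc_right S.β_mem.2.le

lemma Ioo_subset (S : IsAdmissible f D g β) : Ioo 0 β ⊆ Ioo 0 1 :=
  Ioo_subset_Ioo_right S.β_mem.2.le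

lemma g_nonneg (S : IsAdmissible f D g β) {x : ℝ} (hx : x ∈ Icc (0 : ℝ) 1) : 0 ≤ g x := by
  rcases eq_or_lt_of_le hx.1 with h0 | h0
  · rw [← h0, S.g_zero]
  rcases eq_or_lt_of_le hx.2 with h1 | h1
  · rw [h1, S.g_one]
  · exact (S.g_pos x ⟨h0, h1⟩).le

lemma D_nonpos (S : IsAdmissible f D g β) {x : ℝ} (hx : x ∈ Icc 0 β) : D x ≤ 0 := by
  have hcl : x ∈ closure (Ioo 0 β) := by rwa [closure_Ioo S.β_mem.1.ne]
  have : (𝓝[Ioo 0 β] x).NeBot := mem_closure_iff_nhdsWithin_neBot.1 hcl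
  exact le_of_tendsto ((S.D_contDiff.continuousOn x (S.Icc_subset hx)).mono
    (Ioo_subset_Icc_self.trans S.Icc_subset))
    (eventually_nhdsWithin_of_forall fun y hy => (S.D_neg y hy).le)

lemma D_nonneg (S : IsAdmissible f D g β) {x : ℝ} (hx : x ∈ Icc β 1) : 0 ≤ D x := by
  have hcl : x ∈ closure (Ioo β 1) := by rwa [closure_Ioo S.β_mem.2.ne]
  have : (𝓝[Ioo β 1] x).NeBot := mem_closure_iff_nhdsWithin_neBot.1 hcl
  exact ge_of_tendsto ((S.D_contDiff.continuousOn x ⟨S.β_mem.1.le.trans hx.1, hx.2⟩).mono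
    fun y hy => ⟨S.β_mem.1.le.trans hy.1.le, hy.2.le⟩)
    (eventually_nhdsWithin_of_forall fun y hy => (S.D_pos y hy).le)

lemma D_β (S : IsAdmissible f D g β) : D β = 0 :=
  le_antisymm (S.D_nonpos ⟨S.β_mem.1.le, le_rfl⟩) (S.D_nonneg ⟨le_rfl, S.β_mem.2.le⟩)

lemma source_pos (S : IsAdmissible f D g β) : ∀ x ∈ Ioo 0 β, 0 < -(D x * g x) := fun x hx => by
  have := mul_neg_of_neg_of_pos (S.D_neg x hx) (S.g_pos x (S.Ioo_subset hx))
  linarith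

lemma isFluxProfile (S : IsAdmissible f D g β) (c : ℝ) :
    IsFluxProfile f D g β c (fluxProfile f D g β c) := by
  refine Classical.epsilon_spec (exists_singularSolution S.β_mem.1 ?_ ?_ S.source_pos)
  · exact ((continuousOn_unitDeriv S.f_contDiff).mono S.Icc_subset).sub continuousOn_const
  · exact (((S.D_contDiff.continuousOn).mul S.g_cont).mono S.Icc_subset).neg

lemma fluxProfile_anti (S : IsAdmissible f D g β) {c₁ c₂ x : ℝ} (hc : c₁ ≤ c₂)
    (hx : x ∈ Icc 0 β) : fluxProfile f D g β c₂ x ≤ fluxProfile f D g β c₁ x :=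
  (S.isFluxProfile c₁).mono (fun y hy => (S.source_pos y hy).le) (fun y _ => by linarith)
    (S.isFluxProfile c₂) hx

lemma fluxProfile_sub_le (S : IsAdmissible f D g β) {c₁ c₂ x : ℝ} (hc : c₁ ≤ c₂)
    (hx : x ∈ Icc 0 β) :
    fluxProfile f D g β c₁ x - fluxProfile f D g β c₂ x ≤ (c₂ - c₁) * x := by
  have e : (fun x => unitDeriv f x - c₁) = fun x => unitDeriv f x - c₂ + (c₂ - c₁) := by
    funext x; ring
  have h₁ : IsFluxProfile f D g β c₁ (fluxProfile f D g β c₁) := S.isFluxProfile c₁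
  rw [IsFluxProfile, e] at h₁
  exact h₁.sub_le (sub_nonneg.2 hc) (fun y hy => (S.source_pos y hy).le) (S.isFluxProfile c₂) hx

lemma D_bound (S : IsAdmissible f D g β) : ∃ M ≥ 0, ∀ x ∈ Icc 0 β, -D x ≤ M * (β - x) := by
  obtain ⟨M, hM⟩ := isCompact_Icc.exists_bound_of_continuousOn (continuousOn_unitDeriv S.D_contDiff)
  refine ⟨M, (norm_nonneg _).trans (hM 0 ⟨le_rfl, zero_le_one⟩), fun x hx => ?_⟩
  have := (convex_Icc (0 : ℝ) 1).norm_image_sub_le_of_norm_hasDerivWithin_le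
    (fun t ht => hasDerivWithinAt_unitDeriv S.D_contDiff ht) hM (S.Icc_subset hx)
    (S.Icc_subset ⟨S.β_mem.1.le, le_rfl⟩)
  rw [S.D_β, zero_sub, Real.norm_eq_abs, Real.norm_eq_abs, abs_of_nonneg (sub_nonneg.2 hx.2)] at this
  exact (le_abs_self _).trans this

/-- The threshold is attained, so that the flux vanishes at `β` exactly from the threshold on. -/
theorem fluxThreshold_le_iff (S : IsAdmissible f D g β) {c : ℝ} :
    fluxThreshold f D g β ≤ c ↔ fluxProfile f D g β c β = 0 := by
  set A : Set ℝ := {c | fluxProfile f D g β c β = 0} with hA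
  have hβI : β ∈ Icc 0 β := ⟨S.β_mem.1.le, le_rfl⟩
  have hnn : ∀ c, 0 ≤ fluxProfile f D g β c β := fun c => (S.isFluxProfile c).end_nonneg S.β_mem.1
  obtain ⟨H, hH⟩ := isCompact_Icc.exists_bound_of_continuousOn (continuousOn_unitDeriv S.f_contDiff)
  obtain ⟨G, hG⟩ := isCompact_Icc.exists_bound_of_continuousOn S.g_cont
  obtain ⟨M, hM0, hM⟩ := S.D_bound
  have hG0 : 0 ≤ G := (norm_nonneg _).trans (hG 0 ⟨le_rfl, zero_le_one⟩)
  have hup : ∀ c ∈ A, ∀ c', c ≤ c' → c' ∈ A := fun c hc c' h =>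
    le_antisymm ((S.fluxProfile_anti h hβI).trans_eq hc) (hnn c')
  -- for large speeds `β - x` is a supersolution
  have hne : A.Nonempty := by
    refine ⟨1 + H + M * G, le_antisymm ?_ (hnn _)⟩
    set c := 1 + H + M * G with hc
    have hz := S.isFluxProfile c
    set z := fluxProfile f D g β c
    have := nonneg_of_deriv_nonneg_of_neg (w := fun x => (β - x) - z x) S.β_mem.1.le
      ((continuousOn_const.sub continuousOn_id).sub hz.continuousOn)
      (by simpa [hz.zero] using S.β_mem.1.le)
      (fun x hx => ((hasDerivAt_id x).const_sub β).sub (hz.hasDerivAt x hx)) ?_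
    · simpa using this
    · intro x hx hneg
      have hx1 := Ioo_subset_Icc_self (S.Ioo_subset hx)
      have h1 := le_of_abs_le (hH x hx1)
      have h2 := le_of_abs_le (hG x hx1)
      have h3 : -(D x * g x) / z x ≤ M * G := by
        rw [div_le_iff₀ (hz.pos x hx)]
        calc -(D x * g x) = -D x * g x := by ring
          _ ≤ M * (β - x) * G := mul_le_mul (hM x (Ioo_subset_Icc_self hx)) h2
              (S.g_nonneg hx1) (mul_nonneg hM0 (by linarith [hx.2]))
          _ ≤ M * G * z x := by
              have := mul_le_mul_of_nonneg_left (show β - x ≤ z x by linarith) (mul_nonneg hM0 hG0)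
              linarith
      linarith
  have hbd : BddBelow A := by
    refine ⟨-H, fun c hc => ?_⟩
    by_contra! hlt
    have hz := S.isFluxProfile c
    set z := fluxProfile f D g β c with hzdef
    have := nonneg_of_deriv_nonneg_of_neg (w := fun x => z x - (-H - c) * x) S.β_mem.1.le
      (hz.continuousOn.sub (continuousOn_const.mul continuousOn_id)) (by simp [hz.zero])
      (fun x hx => (hz.hasDerivAt x hx).sub ((hasDerivAt_id x).const_mul (-H - c))) ?_
    · have h0 : z β = 0 := hc
      have := mul_pos (show 0 < -H - c by linarith) S.β_mem.1
      simp only [h0] at *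
      linarith
    · intro x hx _
      have h1 := neg_le_of_abs_le (hH x (Ioo_subset_Icc_self (S.Ioo_subset hx)))
      have := div_nonneg (S.source_pos x hx).le (hz.pos x hx).le
      linarith
  have hmem : sInf A ∈ A := by
    refine le_antisymm (le_of_forall_pos_le_add fun e he => ?_) (hnn _)
    obtain ⟨c, hc, hlt⟩ := exists_lt_of_csInf_lt hne (show sInf A < sInf A + e / β by
      have := div_pos he S.β_mem.1; linarith)
    have h1 := S.fluxProfile_sub_le (csInf_le hbd hc) hβI
    have h2 : (c - sInf A) * β ≤ e := by
      rw [← le_div_iff₀ S.β_mem.1]; linarith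
    have h0 : fluxProfile f D g β c β = 0 := hc
    linarith
  exact ⟨fun h => hup _ hmem c h, fun h => csInf_le hbd h⟩

end IsAdmissible

/-! ### Slopes at the end points -/

/-- The quadratic polynomial in `m`, with coefficients evaluated at the density `x`, whose sign
tells in which direction the ratio `-D / z` crosses the level `m` at `x`. -/
noncomputable def slopePoly (f D g : ℝ → ℝ) (c m x : ℝ) : ℝ :=
  g x * m ^ 2 + (unitDeriv f x - c) * m + unitDeriv D x

namespace IsAdmissible

variable {f D g : ℝ → ℝ} {β c m : ℝ} {z : ℝ → ℝ}

lemma continuousOn_slopePoly (S : IsAdmissible f D g β) (c m : ℝ) :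
    ContinuousOn (slopePoly f D g c m) (Icc 0 1) :=
  ((S.g_cont.mul continuousOn_const).add
    (((continuousOn_unitDeriv S.f_contDiff).sub continuousOn_const).mul continuousOn_const)).add
    (continuousOn_unitDeriv S.D_contDiff)

lemma hasDerivAt_level (S : IsAdmissible f D g β) (hz : IsFluxProfile f D g β c z) (m : ℝ) {x : ℝ}
    (hx : x ∈ Ioo 0 β) : HasDerivAt (fun t => m * z t + D t)
      (slopePoly f D g c m x - m * g x * ((m * z x + D x) / z x)) x := by
  convert! ((hz.hasDerivAt x hx).const_mul m).add
    (hasDerivAt_unitDeriv S.D_contDiff (S.Ioo_subset hx)) using 1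
  have := (hz.pos x hx).ne'
  rw [slopePoly]; field_simp; ring

lemma continuousOn_level (S : IsAdmissible f D g β) (hz : IsFluxProfile f D g β c z) (m : ℝ) :
    ContinuousOn (fun t => m * z t + D t) (Icc 0 β) :=
  (continuousOn_const.mul hz.continuousOn).add (S.D_contDiff.continuousOn.mono S.Icc_subset)

/-- Where the polynomial is nonnegative, `-D / z` cannot cross the level `m` upwards. -/
lemma level_nonneg (S : IsAdmissible f D g β) (hz : IsFluxProfile f D g β c z) (hm : 0 ≤ m)
    {x₀ x₁ : ℝ} (h0 : 0 ≤ x₀) (h01 : x₀ ≤ x₁) (h1 : x₁ ≤ β)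
    (hP : ∀ x ∈ Ioo x₀ x₁, 0 ≤ slopePoly f D g c m x) (hx₀ : 0 ≤ m * z x₀ + D x₀) :
    0 ≤ m * z x₁ + D x₁ := by
  have hI : Ioo x₀ x₁ ⊆ Ioo 0 β := Ioo_subset_Ioo h0 h1
  refine nonneg_of_deriv_nonneg_of_neg (w := fun t => m * z t + D t) h01
    ((S.continuousOn_level hz m).mono (Icc_subset_Icc h0 h1)) hx₀
    (fun x hx => S.hasDerivAt_level hz m (hI hx)) fun x hx hneg => ?_
  have h2 := div_neg_of_neg_of_pos hneg (hz.pos x (hI hx))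
  have h3 := mul_nonneg hm (S.g_pos x (S.Ioo_subset (hI hx))).le
  have := mul_nonpos_of_nonneg_of_nonpos h3 h2.le
  linarith [hP x hx]

/-- Where the polynomial is nonpositive, `-D / z` cannot cross the level `m` downwards. -/
lemma level_nonpos (S : IsAdmissible f D g β) (hz : IsFluxProfile f D g β c z) (hm : 0 ≤ m)
    {x₀ x₁ : ℝ} (h0 : 0 ≤ x₀) (h01 : x₀ ≤ x₁) (h1 : x₁ ≤ β)
    (hP : ∀ x ∈ Ioo x₀ x₁, slopePoly f D g c m x ≤ 0) (hx₀ : m * z x₀ + D x₀ ≤ 0) :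
    m * z x₁ + D x₁ ≤ 0 := by
  have hI : Ioo x₀ x₁ ⊆ Ioo 0 β := Ioo_subset_Ioo h0 h1
  refine neg_nonneg.1 (nonneg_of_deriv_nonneg_of_neg (w := fun t => -(m * z t + D t)) h01
    ((S.continuousOn_level hz m).mono (Icc_subset_Icc h0 h1)).neg (neg_nonneg.2 hx₀)
    (fun x hx => (S.hasDerivAt_level hz m (hI hx)).neg) fun x hx hneg => ?_)
  have h2 := div_pos (neg_neg_iff_pos.1 hneg) (hz.pos x (hI hx))
  have h3 := mul_nonneg hm (S.g_pos x (S.Ioo_subset (hI hx))).le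
  have := mul_nonneg h3 h2.le
  linarith [hP x hx]

lemma le_ratio_iff (hz : IsFluxProfile f D g β c z) {x : ℝ} (hx : x ∈ Ioo 0 β) :
    m ≤ -D x / z x ↔ m * z x + D x ≤ 0 := by
  rw [le_div_iff₀ (hz.pos x hx)]; constructor <;> intro h <;> linarith

lemma ratio_le_iff (hz : IsFluxProfile f D g β c z) {x : ℝ} (hx : x ∈ Ioo 0 β) :
    -D x / z x ≤ m ↔ 0 ≤ m * z x + D x := by
  rw [div_le_iff₀ (hz.pos x hx)]; constructor <;> intro h <;> linarith

lemma ratio_pos (S : IsAdmissible f D g β) (hz : IsFluxProfile f D g β c z) {x : ℝ}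
    (hx : x ∈ Ioo 0 β) : 0 < -D x / z x :=
  div_pos (neg_pos.2 (S.D_neg x hx)) (hz.pos x hx)

lemma eventually_near_zero (S : IsAdmissible f D g β) {U : Set ℝ} (hU : IsOpen U)
    (h : slopePoly f D g c m 0 ∈ U) :
    ∃ δ ∈ Ioo 0 β, ∀ x ∈ Icc 0 δ, slopePoly f D g c m x ∈ U := by
  have h1 : ∀ᶠ x in 𝓝[Icc 0 1] (0 : ℝ), slopePoly f D g c m x ∈ U :=
    (S.continuousOn_slopePoly c m 0 ⟨le_rfl, zero_le_one⟩).eventually (hU.mem_nhds h)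
  rw [nhdsWithin_Icc_eq_nhdsGE zero_lt_one] at h1
  obtain ⟨δ, hδ, hsub⟩ := mem_nhdsGE_iff_exists_Icc_subset.1
    (inter_mem h1 (Ico_mem_nhdsGE S.β_mem.1))
  have hδ0 : 0 < δ := hδ
  exact ⟨δ, ⟨hδ0, (hsub ⟨hδ0.le, le_rfl⟩).2.2⟩, fun x hx => (hsub hx).1⟩

lemma eventually_near_β (S : IsAdmissible f D g β) {U : Set ℝ} (hU : IsOpen U)
    (h : slopePoly f D g c m β ∈ U) :
    ∃ δ ∈ Ioo 0 β, ∀ x ∈ Icc δ β, slopePoly f D g c m x ∈ U := by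
  have h1 : ∀ᶠ x in 𝓝 β, slopePoly f D g c m x ∈ U :=
    ((S.continuousOn_slopePoly c m).continuousAt (Icc_mem_nhds S.β_mem.1 S.β_mem.2)).eventually
      (hU.mem_nhds h)
  obtain ⟨δ, hδ, hsub⟩ := mem_nhdsLE_iff_exists_Icc_subset.1
    (inter_mem (nhdsWithin_le_nhds h1) (Ioc_mem_nhdsLE S.β_mem.1))
  have hδ0 : δ < β := hδ
  exact ⟨δ, ⟨(hsub ⟨le_rfl, hδ0.le⟩).2.1, hδ0⟩, fun x hx => (hsub hx).1⟩

/-- Near `0`, a level at which the polynomial is negative stays below `-D / z`. -/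
lemma eventually_le_ratio_zero (S : IsAdmissible f D g β) (hz : IsFluxProfile f D g β c z)
    (hD0 : D 0 = 0) (hm : 0 ≤ m) (hP : slopePoly f D g c m 0 < 0) :
    ∀ᶠ x in 𝓝[>] 0, m ≤ -D x / z x := by
  obtain ⟨δ, hδ, h⟩ := S.eventually_near_zero isOpen_Iio hP
  filter_upwards [Ioo_mem_nhdsGT hδ.1] with x hx
  have hx' : x ∈ Ioo 0 β := ⟨hx.1, hx.2.trans hδ.2⟩
  rw [le_ratio_iff hz hx']
  refine S.level_nonpos hz hm le_rfl hx.1.le hx'.2.le (fun y hy => ?_) (by simp [hz.zero, hD0])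
  exact le_of_lt (h y ⟨hy.1.le, hy.2.le.trans hx.2.le⟩)

/-- Near `0`, a level at which the polynomial is positive stays above `-D / z`. -/
lemma eventually_ratio_le_zero (S : IsAdmissible f D g β) (hz : IsFluxProfile f D g β c z)
    (hD0 : D 0 = 0) (hm : 0 ≤ m) (hP : 0 < slopePoly f D g c m 0) :
    ∀ᶠ x in 𝓝[>] 0, -D x / z x ≤ m := by
  obtain ⟨δ, hδ, h⟩ := S.eventually_near_zero isOpen_Ioi hP
  filter_upwards [Ioo_mem_nhdsGT hδ.1] with x hx
  have hx' : x ∈ Ioo 0 β := ⟨hx.1, hx.2.trans hδ.2⟩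
  rw [ratio_le_iff hz hx']
  refine S.level_nonneg hz hm le_rfl hx.1.le hx'.2.le (fun y hy => ?_) (by simp [hz.zero, hD0])
  exact le_of_lt (h y ⟨hy.1.le, hy.2.le.trans hx.2.le⟩)

lemma unitDeriv_D_zero_nonpos (S : IsAdmissible f D g β) (hD0 : D 0 = 0) : unitDeriv D 0 ≤ 0 := by
  have h := (hasDerivWithinAt_unitDeriv S.D_contDiff ⟨le_rfl, zero_le_one⟩).mono
    (Ioo_subset_Icc_self.trans S.Icc_subset)
  have hcl : (0 : ℝ) ∈ closure (Ioo 0 β) := by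
    rw [closure_Ioo S.β_mem.1.ne]; exact ⟨le_rfl, S.β_mem.1.le⟩
  have : (𝓝[Ioo 0 β] (0 : ℝ)).NeBot := mem_closure_iff_nhdsWithin_neBot.1 hcl
  rw [hasDerivWithinAt_iff_tendsto_slope' (by simp)] at h
  refine le_of_tendsto h (eventually_nhdsWithin_of_forall fun y hy => ?_)
  rw [slope_def_field, hD0, sub_zero, sub_zero]
  exact div_nonpos_of_nonpos_of_nonneg (S.D_neg y hy).le hy.1.le

lemma unitDeriv_D_β_nonneg (S : IsAdmissible f D g β) : 0 ≤ unitDeriv D β := by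
  have h := (hasDerivAt_unitDeriv S.D_contDiff S.β_mem).hasDerivWithinAt (s := Ioo 0 β)
  have hcl : β ∈ closure (Ioo 0 β) := by
    rw [closure_Ioo S.β_mem.1.ne]; exact ⟨S.β_mem.1.le, le_rfl⟩
  have : (𝓝[Ioo 0 β] β).NeBot := mem_closure_iff_nhdsWithin_neBot.1 hcl
  rw [hasDerivWithinAt_iff_tendsto_slope' (by simp)] at h
  refine ge_of_tendsto h (eventually_nhdsWithin_of_forall fun y hy => ?_)
  rw [slope_def_field, S.D_β, sub_zero]
  exact div_nonneg_of_nonpos (S.D_neg y hy).le (by linarith [hy.2])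

/-- Fast waves approach `0` tangentially: `-D / z`, the inverse of the slope, blows up. -/
theorem tendsto_ratio_zero_atTop (S : IsAdmissible f D g β) (hz : IsFluxProfile f D g β c z)
    (hD0 : D 0 = 0) (hc : unitDeriv f 0 < c ∨ (c = unitDeriv f 0 ∧ unitDeriv D 0 < 0)) :
    Tendsto (fun x => -D x / z x) (𝓝[>] 0) atTop := by
  rw [tendsto_atTop]
  intro m
  have hm1 : (0 : ℝ) < max m 1 := lt_max_of_lt_right one_pos
  have hP : slopePoly f D g c (max m 1) 0 < 0 := by
    rw [slopePoly, S.g_zero, zero_mul, zero_add]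
    rcases hc with hc | ⟨hc, hc'⟩
    · have := S.unitDeriv_D_zero_nonpos hD0
      have := mul_neg_of_neg_of_pos (sub_neg.2 hc) hm1
      linarith
    · simpa [hc] using hc'
  filter_upwards [S.eventually_le_ratio_zero hz hD0 hm1.le hP] with x hx
  exact (le_max_left _ _).trans hx

/-- Slow waves reach `0` with the slope determined by the linear part of the polynomial. -/
theorem tendsto_ratio_zero (S : IsAdmissible f D g β) (hz : IsFluxProfile f D g β c z)
    (hD0 : D 0 = 0) (hc : c < unitDeriv f 0) :
    Tendsto (fun x => -D x / z x) (𝓝[>] 0) (𝓝 (-unitDeriv D 0 / (unitDeriv f 0 - c))) := by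
  have ha : 0 < unitDeriv f 0 - c := sub_pos.2 hc
  have h0 : 0 ≤ -unitDeriv D 0 / (unitDeriv f 0 - c) :=
    div_nonneg (neg_nonneg.2 (S.unitDeriv_D_zero_nonpos hD0)) ha.le
  rw [tendsto_order]
  constructor
  · intro m hm
    obtain ⟨m', hm', hm''⟩ := exists_between hm
    rcases lt_or_ge m' 0 with hneg | hpos
    · filter_upwards [Ioo_mem_nhdsGT S.β_mem.1] with x hx
      exact (hm'.trans hneg).trans (S.ratio_pos hz hx)
    · have hP : slopePoly f D g c m' 0 < 0 := by
        rw [lt_div_iff₀ ha] at hm''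
        rw [slopePoly, S.g_zero]; linarith
      filter_upwards [S.eventually_le_ratio_zero hz hD0 hpos hP] with x hx using hm'.trans_le hx
  · intro m hm
    obtain ⟨m', hm', hm''⟩ := exists_between hm
    have hP : 0 < slopePoly f D g c m' 0 := by
      rw [div_lt_iff₀ ha] at hm'
      rw [slopePoly, S.g_zero]; linarith
    filter_upwards [S.eventually_ratio_le_zero hz hD0 (h0.trans hm'.le) hP] with x hx
      using hx.trans_lt hm''

/-- If the flux vanishes at `β`, the ratio `-D / z` converges at `β` to a root `u` of the
polynomial. -/
theorem exists_tendsto_ratio_β (S : IsAdmissible f D g β) (hz : IsFluxProfile f D g β c z)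
    (hzβ : z β = 0) : ∃ u, 0 ≤ u ∧ Tendsto (fun x => -D x / z x) (𝓝[<] β) (𝓝 u) ∧
      slopePoly f D g c u β = 0 ∧
      HasDerivWithinAt z (unitDeriv f β - c + g β * u) (Iic β) β := by
  have hgβ := S.g_pos β S.β_mem
  have hnb : ∀ᶠ x in 𝓝[<] β, x ∈ Ioo 0 β := Ioo_mem_nhdsLT S.β_mem.1
  -- the ratio cannot oscillate around a level which is not a root
  have hdich : ∀ m, slopePoly f D g c m β ≠ 0 →
      (∀ᶠ x in 𝓝[<] β, m ≤ -D x / z x) ∨ (∀ᶠ x in 𝓝[<] β, -D x / z x ≤ m) := by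
    intro m hm
    rcases le_or_gt m 0 with hm0 | hm0
    · left; filter_upwards [hnb] with x hx using hm0.trans (S.ratio_pos hz hx).le
    rcases lt_or_gt_of_ne hm with hP | hP
    · obtain ⟨δ, hδ, h⟩ := S.eventually_near_β isOpen_Iio hP
      by_cases hex : ∃ x₀ ∈ Ioo δ β, m * z x₀ + D x₀ ≤ 0
      · obtain ⟨x₀, hx₀, hle⟩ := hex
        left
        filter_upwards [Ioo_mem_nhdsLT hx₀.2] with x hx
        have hx' : x ∈ Ioo 0 β := ⟨(hδ.1.trans hx₀.1).trans hx.1, hx.2⟩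
        rw [le_ratio_iff hz hx']
        exact S.level_nonpos hz hm0.le (hδ.1.trans hx₀.1).le hx.1.le hx.2.le
          (fun y hy => le_of_lt (h y ⟨(hx₀.1.trans hy.1).le, (hy.2.trans hx.2).le⟩)) hle
      · push Not at hex
        right
        filter_upwards [Ioo_mem_nhdsLT hδ.2] with x hx
        rw [ratio_le_iff hz ⟨hδ.1.trans hx.1, hx.2⟩]
        exact (hex x hx).le
    · obtain ⟨δ, hδ, h⟩ := S.eventually_near_β isOpen_Ioi hP
      by_cases hex : ∃ x₀ ∈ Ioo δ β, 0 ≤ m * z x₀ + D x₀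
      · obtain ⟨x₀, hx₀, hle⟩ := hex
        right
        filter_upwards [Ioo_mem_nhdsLT hx₀.2] with x hx
        have hx' : x ∈ Ioo 0 β := ⟨(hδ.1.trans hx₀.1).trans hx.1, hx.2⟩
        rw [ratio_le_iff hz hx']
        exact S.level_nonneg hz hm0.le (hδ.1.trans hx₀.1).le hx.1.le hx.2.le
          (fun y hy => le_of_lt (h y ⟨(hx₀.1.trans hy.1).le, (hy.2.trans hx.2).le⟩)) hle
      · push Not at hex
        left
        filter_upwards [Ioo_mem_nhdsLT hδ.2] with x hx
        rw [le_ratio_iff hz ⟨hδ.1.trans hx.1, hx.2⟩]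
        exact (hex x hx).le
  have hfcont : ContinuousAt (unitDeriv f) β :=
    (continuousOn_unitDeriv S.f_contDiff).continuousAt (Icc_mem_nhds S.β_mem.1 S.β_mem.2)
  have hgcont : ContinuousAt g β := S.g_cont.continuousAt (Icc_mem_nhds S.β_mem.1 S.β_mem.2)
  have hzcont : ContinuousWithinAt z (Icc 0 β) β := hz.continuousOn β ⟨S.β_mem.1.le, le_rfl⟩
  have hzderiv : ∀ x ∈ Ioo 0 β, HasDerivAt z (unitDeriv f x - c + g x * (-D x / z x)) x := by
    intro x hx
    convert! hz.hasDerivAt x hx using 1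
    ring
  -- a large level is not exceeded, since otherwise `z` would increase to `0`
  have hbdd : ∃ m, ∀ᶠ x in 𝓝[<] β, -D x / z x ≤ m := by
    set a := unitDeriv f β - c with ha
    set m := (|a| + 1) / g β + |unitDeriv D β| / g β + 1 with hm
    have hm1 : 1 ≤ m := by
      have : 0 ≤ (|a| + 1) / g β + |unitDeriv D β| / g β := by positivity
      linarith
    have e : g β * m = |a| + 1 + |unitDeriv D β| + g β := by rw [hm]; field_simp
    have h1 : 1 ≤ a + g β * m := by
      rw [e]; linarith [neg_abs_le a, abs_nonneg (unitDeriv D β)]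
    have hP : 0 < slopePoly f D g c m β := by
      have : slopePoly f D g c m β = (a + g β * m) * m + unitDeriv D β := by
        rw [slopePoly]; ring
      rw [this]
      have h2 : 1 * m ≤ (a + g β * m) * m := mul_le_mul_of_nonneg_right h1 (by linarith)
      linarith [S.unitDeriv_D_β_nonneg]
    rcases hdich m hP.ne' with h | h
    · exfalso
      have h3 : Tendsto (fun x => unitDeriv f x - c + g x * m) (𝓝 β) (𝓝 (a + g β * m)) :=
        (hfcont.sub continuousAt_const).add (hgcont.mul continuousAt_const)
      have h4 : ∀ᶠ x in 𝓝[<] β, 0 < unitDeriv f x - c + g x * m :=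
        nhdsWithin_le_nhds (h3.eventually (lt_mem_nhds (by linarith)))
      obtain ⟨δ, hδ, hsub⟩ := (mem_nhdsLT_iff_exists_Ioo_subset' S.β_mem.1).1
        (inter_mem (inter_mem h h4) hnb)
      have hδ : δ < β := hδ
      obtain ⟨p, hp1, hp2⟩ := exists_between hδ
      have hp := (hsub ⟨hp1, hp2⟩).2
      obtain ⟨x, hx, hxe⟩ := exists_hasDerivAt_eq_slope z _ hp2
        (hz.continuousOn.mono (Icc_subset_Icc_left hp.1.le))
        (fun x hx => hzderiv x ⟨hp.1.trans hx.1, hx.2⟩)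
      obtain ⟨⟨h5, h6⟩, h7⟩ := hsub (show x ∈ Ioo δ β from ⟨hp1.trans hx.1, hx.2⟩)
      have h8 := mul_le_mul_of_nonneg_left h5 (S.g_pos x (S.Ioo_subset h7)).le
      have h9 : (z β - z p) / (β - p) < 0 := by
        rw [hzβ]; exact div_neg_of_neg_of_pos (by linarith [hz.pos p hp]) (by linarith)
      have h6' : 0 < unitDeriv f x - c + g x * m := h6
      linarith
    · exact ⟨m, h⟩
  have hdense : Dense {m | slopePoly f D g c m β ≠ 0} := by
    let p : Polynomial ℝ := Polynomial.C (g β) * Polynomial.X ^ 2 +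
      Polynomial.C (unitDeriv f β - c) * Polynomial.X + Polynomial.C (unitDeriv D β)
    have hp : p ≠ 0 := fun h => by
      have h2 : p.coeff 2 = g β := by
        simp [p]
      rw [h, Polynomial.coeff_zero] at h2
      linarith
    have hfin := Polynomial.finite_setOfPred_isRoot hp
    refine (hfin.countable.dense_compl ℝ).mono ?_
    intro m hm h
    refine hm ?_
    simpa [p, Polynomial.IsRoot, slopePoly] using h
  obtain ⟨u, hu⟩ := tendsto_of_no_upcrossings hdense (f := 𝓝[<] β) (u := fun x => -D x / z x)
    (fun a ha b hb hab => by
      rintro ⟨h1, h2⟩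
      rcases hdich a ha with h | h
      · exact h1 (h.mono fun x hx => not_lt.2 hx)
      · exact h2 (h.mono fun x hx => not_lt.2 (hx.trans hab.le)))
    hbdd ⟨0, by
      show ∀ᶠ y in Filter.map _ _, 0 ≤ y
      rw [eventually_map]
      exact hnb.mono fun x hx => (S.ratio_pos hz hx).le⟩
  have hu0 : 0 ≤ u := ge_of_tendsto hu (hnb.mono fun x hx => (S.ratio_pos hz hx).le)
  have hder : HasDerivWithinAt z (unitDeriv f β - c + g β * u) (Iic β) β := by
    refine hasDerivWithinAt_Iic_of_tendsto_deriv (s := Ioo 0 β)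
      (fun x hx => (hzderiv x hx).differentiableAt.differentiableWithinAt)
      (hzcont.mono Ioo_subset_Icc_self) (Ioo_mem_nhdsLT S.β_mem.1) ?_
    have : Tendsto (fun x => unitDeriv f x - c + g x * (-D x / z x)) (𝓝[<] β)
        (𝓝 (unitDeriv f β - c + g β * u)) :=
      ((hfcont.tendsto.mono_left nhdsWithin_le_nhds).sub tendsto_const_nhds).add
        ((hgcont.tendsto.mono_left nhdsWithin_le_nhds).mul hu)
    exact this.congr' (hnb.mono fun x hx => (hzderiv x hx).deriv.symm)
  refine ⟨u, hu0, hu, ?_, hder⟩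
  -- compare the slopes of `D` and `z` at `β`
  have hs1 : Tendsto (slope z β) (𝓝[<] β) (𝓝 (unitDeriv f β - c + g β * u)) := by
    have := hasDerivWithinAt_iff_tendsto_slope.1 hder
    rwa [Iic_sdiff_right] at this
  have hs2 : Tendsto (slope D β) (𝓝[<] β) (𝓝 (unitDeriv D β)) := by
    have := hasDerivWithinAt_iff_tendsto_slope.1
      ((hasDerivAt_unitDeriv S.D_contDiff S.β_mem).hasDerivWithinAt (s := Iic β))
    rwa [Iic_sdiff_right] at this
  have hs3 : Tendsto (slope D β) (𝓝[<] β) (𝓝 (-(u * (unitDeriv f β - c + g β * u)))) := by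
    refine (hu.mul hs1).neg.congr' (hnb.mono fun x hx => ?_)
    have h1 := (hz.pos x hx).ne'
    have h2 : x - β ≠ 0 := by have := hx.2; intro h; linarith
    rw [slope_def_field, slope_def_field, S.D_β, hzβ]
    field_simp
    ring
  have := tendsto_nhds_unique hs2 hs3
  rw [slopePoly, this]; ring

/-- A function which is nonnegative on the left of a zero has a nonpositive left derivative there. -/
lemma _root_.HasDerivWithinAt.nonpos_of_nonneg_left {w : ℝ → ℝ} {l b a : ℝ} (hab : a < b)
    (hw : HasDerivWithinAt w l (Iic b) b) (h0 : w b = 0) (h : ∀ x ∈ Ioo a b, 0 ≤ w x) : l ≤ 0 := by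
  have hs := hasDerivWithinAt_iff_tendsto_slope.1 hw
  rw [Iic_sdiff_right] at hs
  refine le_of_tendsto hs ?_
  filter_upwards [Ioo_mem_nhdsLT hab] with x hx
  rw [slope_def_field, h0, sub_zero]
  exact div_nonpos_of_nonneg_of_nonpos (h x hx) (by linarith [hx.2])

/-- Above the threshold the limit of `-D / z` at `β` is the larger root. -/
lemma larger_root (S : IsAdmissible f D g β) (hc : fluxThreshold f D g β < c) {u : ℝ}
    (hu : slopePoly f D g c u β = 0)
    (hd : HasDerivWithinAt (fluxProfile f D g β c) (unitDeriv f β - c + g β * u) (Iic β) β) :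
    0 < u ∧ 0 < 2 * (g β * u) + (unitDeriv f β - c) := by
  set c₀ := fluxThreshold f D g β
  have hgβ := S.g_pos β S.β_mem
  have h0 : fluxProfile f D g β c₀ β = 0 := S.fluxThreshold_le_iff.1 le_rfl
  have h1 : fluxProfile f D g β c β = 0 := S.fluxThreshold_le_iff.1 hc.le
  obtain ⟨u₀, hu₀, -, hP₀, hd₀⟩ := S.exists_tendsto_ratio_β (S.isFluxProfile c₀) h0
  have hle := (hd₀.sub hd).nonpos_of_nonneg_left S.β_mem.1 (by simp [h0, h1])
    (fun x hx => sub_nonneg.2 (S.fluxProfile_anti hc.le (Ioo_subset_Icc_self hx)))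
  have hlt : u₀ < u := by
    by_contra! h
    have := mul_le_mul_of_nonneg_left h hgβ.le
    linarith
  have key : (u - u₀) * (g β * (u + u₀) + (unitDeriv f β - c)) = (c - c₀) * u₀ := by
    rw [slopePoly] at hu hP₀
    linear_combination hu - hP₀
  have h2 : 0 ≤ g β * (u + u₀) + (unitDeriv f β - c) := by
    by_contra! h
    have h3 := mul_neg_of_pos_of_neg (sub_pos.2 hlt) h
    have h4 := mul_nonneg (sub_nonneg.2 hc.le) hu₀
    linarith
  have h3 := mul_pos hgβ (sub_pos.2 hlt)
  exact ⟨hu₀.trans_lt hlt, by linarith⟩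

/-- At the threshold the limit of `-D / z` at `β` is the smaller root: otherwise a level between the
two roots would be a barrier, also for slightly smaller speeds, forcing their fluxes to vanish
at `β`. -/
lemma smaller_root (S : IsAdmissible f D g β) {u : ℝ} (hu0 : 0 ≤ u)
    (hlim : Tendsto (fun x => -D x / fluxProfile f D g β (fluxThreshold f D g β) x) (𝓝[<] β) (𝓝 u))
    (hu : slopePoly f D g (fluxThreshold f D g β) u β = 0)
    (hd : HasDerivWithinAt (fluxProfile f D g β (fluxThreshold f D g β))
      (unitDeriv f β - fluxThreshold f D g β + g β * u) (Iic β) β) :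
    2 * (g β * u) + (unitDeriv f β - fluxThreshold f D g β) ≤ 0 := by
  set c := fluxThreshold f D g β with hcdef
  have hgβ := S.g_pos β S.β_mem
  have hz := S.isFluxProfile c
  have hzβ : fluxProfile f D g β c β = 0 := S.fluxThreshold_le_iff.1 le_rfl
  set a := unitDeriv f β - c with ha
  by_contra! hpos
  have hσ := hd.nonpos_of_nonneg_left S.β_mem.1 hzβ fun x hx => (hz.pos x hx).le
  have hu1 : 0 < u := by
    rcases eq_or_lt_of_le hu0 with h | h
    · rw [← h] at hσ hpos; linarith
    · exact h
  obtain ⟨m, hm, hmu⟩ : ∃ m, max 0 (u - (2 * (g β * u) + a) / (2 * g β)) < m ∧ m < u :=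
    exists_between (max_lt hu1 (sub_lt_self _ (by positivity)))
  have hm0 : 0 < m := (le_max_left _ _).trans_lt hm
  have hm1 : 0 < g β * (m + u) + a := by
    have h1 := (le_max_right _ _).trans_lt hm
    have h2 := mul_lt_mul_of_pos_left h1 hgβ
    have h3 : g β * (u - (2 * (g β * u) + a) / (2 * g β)) = g β * u - (2 * (g β * u) + a) / 2 := by
      field_simp
    linarith
  have hP : slopePoly f D g c m β < 0 := by
    have e : slopePoly f D g c m β = (m - u) * (g β * (m + u) + a) := by
      rw [slopePoly] at hu ⊢
      linear_combination hu
    rw [e]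
    exact mul_neg_of_neg_of_pos (by linarith) hm1
  obtain ⟨r, hr, hr'⟩ : ∃ r, slopePoly f D g c m β < r ∧ r < 0 := exists_between hP
  obtain ⟨δ, hδ, h⟩ := S.eventually_near_β isOpen_Iio hr
  obtain ⟨p, hp1, hp2⟩ := ((hlim.eventually (lt_mem_nhds hmu)).and (Ioo_mem_nhdsLT hδ.2)).exists
  have hp : p ∈ Ioo 0 β := ⟨hδ.1.trans hp2.1, hp2.2⟩
  have hpm : m * fluxProfile f D g β c p + D p < 0 := by
    rw [lt_div_iff₀ (hz.pos p hp)] at hp1; linarith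
  set e := min (-r) (-(m * fluxProfile f D g β c p + D p)) with he
  have he0 : 0 < e := lt_min (neg_pos.2 hr') (neg_pos.2 hpm)
  set c' := c - e / m with hc'
  have hem : 0 < e / m := div_pos he0 hm0
  have hmul : m * (e / m) = e := mul_div_cancel₀ _ hm0.ne'
  have hz' := S.isFluxProfile c'
  have h1 : m * fluxProfile f D g β c' p + D p ≤ 0 := by
    have h2 := S.fluxProfile_sub_le (show c' ≤ c by linarith) (Ioo_subset_Icc_self hp)
    have h3 : (c - c') * p ≤ e / m := by
      have : (c - c') * p ≤ (c - c') * 1 :=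
        mul_le_mul_of_nonneg_left (hp.2.trans S.β_mem.2).le (by linarith)
      linarith
    have h4 := mul_le_mul_of_nonneg_left (h2.trans h3) hm0.le
    have h5 : e ≤ -(m * fluxProfile f D g β c p + D p) := min_le_right _ _
    linarith
  have h2 := S.level_nonpos hz' hm0.le hp.1.le hp.2.le le_rfl (fun x hx => by
    have h3 : slopePoly f D g c m x < r := h x ⟨(hp2.1.trans hx.1).le, hx.2.le⟩
    have h4 : slopePoly f D g c' m x = slopePoly f D g c m x + m * (e / m) := by
      rw [slopePoly, slopePoly, hc']; ring
    have h5 : e ≤ -r := min_le_left _ _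
    linarith) h1
  rw [S.D_β, add_zero] at h2
  have h3 : fluxProfile f D g β c' β ≤ 0 := by
    by_contra! h; have := mul_pos hm0 h; linarith
  have := S.fluxThreshold_le_iff.2 (le_antisymm h3 (hz'.end_nonneg S.β_mem.1))
  linarith

lemma sDiscr_eq_sq {u : ℝ} (hu : slopePoly f D g c u β = 0) :
    sDiscr f D g β c = (2 * (g β * u) + (unitDeriv f β - c)) ^ 2 := by
  rw [slopePoly] at hu
  rw [sDiscr]
  linear_combination (-4 * g β) * hu

theorem sDiscr_nonneg (S : IsAdmissible f D g β) (hc : fluxThreshold f D g β ≤ c) :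
    0 ≤ sDiscr f D g β c := by
  obtain ⟨u, -, -, hP, -⟩ := S.exists_tendsto_ratio_β (S.isFluxProfile c)
    (S.fluxThreshold_le_iff.1 hc)
  rw [sDiscr_eq_sq hP]; positivity

lemma tendsto_slope_of_ratio {u s : ℝ} {l : Filter ℝ} (hg : 0 < g β) (hu : 0 < u)
    (hs : s = -(g β * u)) (h : Tendsto (fun x => -D x / z x) l (𝓝 u)) :
    s < 0 ∧ Tendsto (fun x => z x / D x) l (𝓝 (g β / s)) := by
  refine ⟨by rw [hs]; exact neg_neg_of_pos (mul_pos hg hu), ?_⟩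
  have e : g β / s = -u⁻¹ := by rw [hs]; field_simp
  rw [e]
  refine (h.inv₀ hu.ne').neg.congr fun x => ?_
  rw [inv_div, div_neg, neg_neg]

/-- The slope of the profiles at `β`, above the threshold speed. -/
theorem tendsto_slope_β_of_lt (S : IsAdmissible f D g β) (hc : fluxThreshold f D g β < c) :
    sMinus f D g β c < 0 ∧ Tendsto (fun x => fluxProfile f D g β c x / D x) (𝓝[<] β)
      (𝓝 (g β / sMinus f D g β c)) := by
  obtain ⟨u, -, hlim, hP, hd⟩ := S.exists_tendsto_ratio_β (S.isFluxProfile c)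
    (S.fluxThreshold_le_iff.1 hc.le)
  obtain ⟨hu, hpos⟩ := S.larger_root hc hP hd
  refine tendsto_slope_of_ratio (S.g_pos β S.β_mem) hu ?_ hlim
  rw [sMinus, sDiscr_eq_sq hP, Real.sqrt_sq hpos.le]; ring

/-- The slope of the profiles at `β`, at the threshold speed and for `D'(β) > 0`. -/
theorem tendsto_slope_β_of_eq (S : IsAdmissible f D g β) (hc : c = fluxThreshold f D g β)
    (hD : 0 < unitDeriv D β) :
    sPlus f D g β c < 0 ∧ Tendsto (fun x => fluxProfile f D g β c x / D x) (𝓝[<] β)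
      (𝓝 (g β / sPlus f D g β c)) := by
  obtain ⟨u, hu0, hlim, hP, hd⟩ := S.exists_tendsto_ratio_β (S.isFluxProfile c)
    (S.fluxThreshold_le_iff.1 hc.ge)
  have hneg : 2 * (g β * u) + (unitDeriv f β - c) ≤ 0 := by
    subst hc; exact S.smaller_root hu0 hlim hP hd
  have hu : 0 < u := by
    rcases eq_or_lt_of_le hu0 with h | h
    · rw [← h, slopePoly] at hP; simp at hP; linarith
    · exact h
  refine tendsto_slope_of_ratio (S.g_pos β S.β_mem) hu ?_ hlim
  rw [sPlus, sDiscr_eq_sq hP, Real.sqrt_sq_eq_abs, abs_of_nonpos hneg]; ring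

/-- The slope of the profiles at `β` is infinite at the threshold speed if `D'(β) = 0`. -/
theorem tendsto_slope_β_atBot (S : IsAdmissible f D g β) (hc : c = fluxThreshold f D g β)
    (hD : unitDeriv D β = 0) :
    Tendsto (fun x => fluxProfile f D g β c x / D x) (𝓝[<] β) atBot := by
  obtain ⟨u, hu0, hlim, hP, hd⟩ := S.exists_tendsto_ratio_β (S.isFluxProfile c)
    (S.fluxThreshold_le_iff.1 hc.ge)
  have hneg : 2 * (g β * u) + (unitDeriv f β - c) ≤ 0 := by
    subst hc; exact S.smaller_root hu0 hlim hP hd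
  have hgβ := S.g_pos β S.β_mem
  have hu : u = 0 := by
    by_contra hne
    have hu : 0 < u := lt_of_le_of_ne hu0 (Ne.symm hne)
    have h1 : u * (g β * u + (unitDeriv f β - c)) = 0 := by
      rw [slopePoly, hD] at hP; linear_combination hP
    have h2 := (mul_eq_zero.1 h1).resolve_left hne
    have := mul_pos hgβ hu
    linarith
  rw [hu] at hlim
  have h1 : Tendsto (fun x => -D x / fluxProfile f D g β c x) (𝓝[<] β) (𝓝[>] 0) := by
    refine tendsto_nhdsWithin_iff.2 ⟨hlim, ?_⟩
    filter_upwards [Ioo_mem_nhdsLT S.β_mem.1] with x hx using S.ratio_pos (S.isFluxProfile c) hx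
  refine (tendsto_neg_atTop_atBot.comp (tendsto_inv_nhdsGT_zero.comp h1)).congr fun x => ?_
  simp only [Function.comp]
  rw [inv_div, div_neg, neg_neg]

end IsAdmissible

/-! ### Weak and strong forms of the profile equation -/

lemma continuous_mul_of_tsupport_subset {I : Set ℝ} (hI : IsOpen I) {N ψ : ℝ → ℝ}
    (hN : ContinuousOn N I) (hψ : Continuous ψ) (hsub : tsupport ψ ⊆ I) :
    Continuous fun x => N x * ψ x :=
  (hN.mul hψ.continuousOn).continuous_of_tsupport_subset hI (tsupport_mul_subset_right.trans hsub)

/-- Integration by parts against a test function supported in an open set. -/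
lemma setIntegral_mul_deriv_add {I : Set ℝ} (hI : IsOpen I) {N n ψ : ℝ → ℝ}
    (hN : ∀ x ∈ I, HasDerivAt N (n x) x) (hn : ContinuousOn n I)
    (hψ : ContDiff ℝ (⊤ : ℕ∞) ψ) (hc : HasCompactSupport ψ) (hsub : tsupport ψ ⊆ I) :
    ∫ x in I, (N x * deriv ψ x + n x * ψ x) = 0 := by
  have hψ' := contDiff_infty_iff_deriv.1 hψ
  have hNc : ContinuousOn N I := fun x hx => (hN x hx).continuousAt.continuousWithinAt
  have hsub' : tsupport (deriv ψ) ⊆ I := tsupport_deriv_subset.trans hsub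
  have h1 := continuous_mul_of_tsupport_subset hI hNc hψ.continuous hsub
  have h2 := continuous_mul_of_tsupport_subset hI hNc hψ'.2.continuous hsub'
  have h3 := continuous_mul_of_tsupport_subset hI hn hψ.continuous hsub
  have h0 : ∀ x ∉ I, ψ x = 0 := fun x hx => image_eq_zero_of_notMem_tsupport fun h => hx (hsub h)
  have h0' : ∀ x ∉ I, deriv ψ x = 0 := fun x hx =>
    image_eq_zero_of_notMem_tsupport fun h => hx (hsub' h)
  rw [setIntegral_eq_integral_of_forall_compl_eq_zero fun x hx => by rw [h0 x hx, h0' x hx]; simp]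
  refine integral_eq_zero_of_hasDerivAt_of_integrable (f := fun x => N x * ψ x) (fun x => ?_)
    ((h2.integrable_of_hasCompactSupport (hc.deriv.mul_left)).add
      (h3.integrable_of_hasCompactSupport hc.mul_left))
    (h1.integrable_of_hasCompactSupport hc.mul_left)
  by_cases hx : x ∈ tsupport ψ
  · convert! (hN x (hsub hx)).mul (hψ'.1 x).hasDerivAt using 1
    ring
  · have hev : (fun x => N x * ψ x) =ᶠ[𝓝 x] fun _ => 0 := by
      filter_upwards [(isClosed_tsupport ψ).isOpen_compl.mem_nhds hx] with y hy
      rw [image_eq_zero_of_notMem_tsupport hy, mul_zero]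
    have e : N x * deriv ψ x + n x * ψ x = 0 := by
      rw [image_eq_zero_of_notMem_tsupport hx,
        image_eq_zero_of_notMem_tsupport fun h => hx (tsupport_deriv_subset h)]
      simp
    rw [e]
    exact (hasDerivAt_const x (0 : ℝ)).congr_of_eventuallyEq hev

lemma integrable_mul_of_tsupport_subset {I : Set ℝ} {F χ : ℝ → ℝ}
    (hF : LocallyIntegrableOn F I volume) (hχ : Continuous χ) (hc : HasCompactSupport χ)
    (hsub : tsupport χ ⊆ I) : Integrable fun x => F x * χ x := by
  rw [← integrableOn_iff_integrable_of_support_subset (s := tsupport χ)]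
  · exact (hF.integrableOn_compact_subset hsub hc).mul_continuousOn hχ.continuousOn hc
  · exact fun x hx => subset_tsupport χ fun h => hx (by simp [h])

/-- The lemma of du Bois-Reymond: a function on an open interval whose weak derivative vanishes is
almost everywhere constant. -/
lemma exists_ae_eq_const_of_integral_mul_deriv {I : Set ℝ} (hI : IsOpen I) (hc : I.OrdConnected)
    (hne : I.Nonempty) {F : ℝ → ℝ} (hF : LocallyIntegrableOn F I volume)
    (h : ∀ ψ : ℝ → ℝ, ContDiff ℝ (⊤ : ℕ∞) ψ → HasCompactSupport ψ → tsupport ψ ⊆ I →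
      ∫ x, F x * deriv ψ x = 0) : ∃ C, ∀ᵐ x, x ∈ I → F x = C := by
  obtain ⟨x₀, hx₀⟩ := hne
  obtain ⟨r, hr, hball⟩ := Metric.isOpen_iff.1 hI x₀ hx₀
  let bump : ContDiffBump x₀ := ⟨r / 4, r / 2, by linarith, by linarith⟩
  set ρ : ℝ → ℝ := bump.normed volume with hρ
  have hρs : ContDiff ℝ (⊤ : ℕ∞) ρ := bump.contDiff_normed
  have hρc : HasCompactSupport ρ := bump.hasCompactSupport_normed
  have hρI : tsupport ρ ⊆ I := by
    rw [hρ, bump.tsupport_normed_eq]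
    exact (Metric.closedBall_subset_ball (by simp only [bump]; linarith)).trans hball
  have hρ1 : ∫ x, ρ x = 1 := bump.integral_normed
  set C := ∫ x, F x * ρ x with hC
  refine ⟨C, ?_⟩
  suffices H : ∀ᵐ x, x ∈ I → F x - C = 0 by
    filter_upwards [H] with x hx hxI using sub_eq_zero.1 (hx hxI)
  refine hI.ae_eq_zero_of_integral_contDiff_smul_eq_zero
    (hF.sub (locallyIntegrableOn_const C)) fun χ hχs hχc hχI => ?_
  have hFχ := integrable_mul_of_tsupport_subset hF hχs.continuous hχc hχI
  have hFρ := integrable_mul_of_tsupport_subset hF hρs.continuous hρc hρI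
  have hχi := hχs.continuous.integrable_of_hasCompactSupport (μ := volume) hχc
  have hρi := hρs.continuous.integrable_of_hasCompactSupport (μ := volume) hρc
  set κ := ∫ x, χ x with hκ
  -- `χ - κ ρ` has mean zero, so it is the derivative of a test function
  let η : ℝ → ℝ := fun x => χ x - κ * ρ x
  have hηs : ContDiff ℝ (⊤ : ℕ∞) η := hχs.sub (contDiff_const.mul hρs)
  have hη0 : ∫ x, η x = 0 := by
    simp only [η]
    rw [integral_sub hχi (hρi.const_mul κ), integral_const_mul, hρ1]; simp [hκ]
  obtain ⟨A, B, hA, hB, hAB⟩ : ∃ A B, A ∈ I ∧ B ∈ I ∧ ∀ x, η x ≠ 0 → x ∈ Icc A B := by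
    have hK : IsCompact (insert x₀ (tsupport χ ∪ tsupport ρ)) := (hχc.isCompact.union hρc).insert x₀
    have hKI : insert x₀ (tsupport χ ∪ tsupport ρ) ⊆ I :=
      insert_subset hx₀ (union_subset hχI hρI)
    obtain ⟨A, hA⟩ := hK.exists_isLeast ⟨x₀, mem_insert _ _⟩
    obtain ⟨B, hB⟩ := hK.exists_isGreatest ⟨x₀, mem_insert _ _⟩
    refine ⟨A, B, hKI hA.1, hKI hB.1, fun x hx => ?_⟩
    have : x ∈ insert x₀ (tsupport χ ∪ tsupport ρ) := by
      by_contra hn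
      simp only [mem_insert_iff, mem_union, not_or] at hn
      exact hx (by simp [η, image_eq_zero_of_notMem_tsupport hn.2.1,
        image_eq_zero_of_notMem_tsupport hn.2.2])
    exact ⟨hA.2 this, hB.2 this⟩
  obtain ⟨A', hA'⟩ : ∃ A', A' < A := exists_lt A
  let ψ : ℝ → ℝ := fun x => ∫ t in A'..x, η t
  have hψd : ∀ x, HasDerivAt ψ (η x) x := fun x =>
    intervalIntegral.integral_hasDerivAt_right (hηs.continuous.intervalIntegrable _ _)
      (hηs.continuous.stronglyMeasurableAtFilter _ _) hηs.continuous.continuousAt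
  have hψ' : deriv ψ = η := funext fun x => (hψd x).deriv
  have hψs : ContDiff ℝ (⊤ : ℕ∞) ψ :=
    contDiff_infty_iff_deriv.2 ⟨fun x => (hψd x).differentiableAt, by rw [hψ']; exact hηs⟩
  have hψsupp : Function.support ψ ⊆ Icc A B := by
    intro x hx
    by_contra hn
    refine hx ?_
    rw [mem_Icc, not_and_or, not_le, not_le] at hn
    rcases hn with hn | hn
    · refine (intervalIntegral.integral_congr (g := fun _ => 0) fun t ht => ?_).trans (by simp)
      by_contra h0
      have h1 := (hAB t h0).1
      have h2 := ht.2
      have : max A' x < A := max_lt hA' hn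
      linarith
    · refine (intervalIntegral.integral_eq_integral_of_support_subset fun t ht => ?_).trans hη0
      have := hAB t ht
      exact ⟨hA'.trans_le this.1, this.2.trans hn.le⟩
  have hψt : tsupport ψ ⊆ Icc A B := closure_minimal hψsupp isClosed_Icc
  have key := h ψ hψs (HasCompactSupport.of_support_subset_isCompact isCompact_Icc hψsupp)
    (hψt.trans (hc.out hA hB))
  rw [hψ'] at key
  have e1 : ∫ x, F x * η x = (∫ x, F x * χ x) - κ * C := by
    rw [hC, ← integral_const_mul, ← integral_sub hFχ (hFρ.const_mul κ)]
    refine integral_congr_ae (Eventually.of_forall fun x => ?_)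
    simp only [η]; ring
  have e2 : ∫ x, χ x • (F x - C) = (∫ x, F x * χ x) - C * κ := by
    rw [hκ, ← integral_const_mul, ← integral_sub hFχ (hχi.const_mul C)]
    refine integral_congr_ae (Eventually.of_forall fun x => ?_)
    simp only [smul_eq_mul]; ring
  rw [e2, ← key, e1]; ring

/-- A monotone profile `φ` on `I` together with its flux `W`, a continuous representative of
`D(φ) φ'`: where the equation does not degenerate `φ` is differentiable, and the integrated profile
equation `W' = f(φ)' - c φ' - g(φ)` holds at every point. -/
structure IsStrongProfile (f D g : ℝ → ℝ) (c : ℝ) (I : Set ℝ) (φ W : ℝ → ℝ) : Prop where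
  continuousOn : ContinuousOn φ I
  mem_Icc : ∀ ξ ∈ I, φ ξ ∈ Icc (0 : ℝ) 1
  antitoneOn : AntitoneOn φ I
  flux_continuousOn : ContinuousOn W I
  flux_ae : ∀ᵐ ξ ∂(volume.restrict I), W ξ = D (φ ξ) * deriv φ ξ
  hasDerivAt : ∀ ξ ∈ I, D (φ ξ) ≠ 0 → HasDerivAt φ (W ξ / D (φ ξ)) ξ
  balance : ∀ ξ ∈ I, HasDerivAt (fun x => W x - f (φ x) + c * φ x) (-g (φ ξ)) ξ

/-- Every monotone travelling wave has a continuous flux and satisfies the equation in the strong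
form. -/
theorem IsTravelingWave.exists_isStrongProfile {f D g : ℝ → ℝ} {c : ℝ} {I : Set ℝ} {φ : ℝ → ℝ}
    (hf : ContinuousOn f (Icc 0 1)) (hD : ContinuousOn D (Icc 0 1)) (hg : ContinuousOn g (Icc 0 1))
    (hI : IsOpen I) (hc : I.OrdConnected) (hne : I.Nonempty)
    (h : IsTravelingWave f D g c I φ) (hanti : AntitoneOn φ I) :
    ∃ W, IsStrongProfile f D g c I φ W := by
  obtain ⟨x₀, hx₀⟩ := hne
  have hfφ : ContinuousOn (fun x => f (φ x)) I := hf.comp h.continuousOn h.mem_Icc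
  have hgφ : ContinuousOn (fun x => g (φ x)) I := hg.comp h.continuousOn h.mem_Icc
  have hDφ : ContinuousOn (fun x => D (φ x)) I := hD.comp h.continuousOn h.mem_Icc
  let G : ℝ → ℝ := fun x => ∫ t in x₀..x, g (φ t)
  have hG : ∀ x ∈ I, HasDerivAt G (g (φ x)) x := by
    intro x hx
    refine intervalIntegral.integral_hasDerivAt_right
      (ContinuousOn.intervalIntegrable (hgφ.mono (hc.uIcc_subset hx₀ hx))) ?_
      (hgφ.continuousAt (hI.mem_nhds hx))
    exact hgφ.stronglyMeasurableAtFilter hI x hx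
  have hGc : ContinuousOn G I := fun x hx => (hG x hx).continuousAt.continuousWithinAt
  let F : ℝ → ℝ := fun x => D (φ x) * deriv φ x - f (φ x) + c * φ x + G x
  have hFl₀ : LocallyIntegrableOn (fun x => D (φ x) * deriv φ x - f (φ x) + c * φ x) I volume :=
    (h.locallyIntegrable_flux.sub (hfφ.locallyIntegrableOn hI.measurableSet)).add
      ((continuousOn_const.mul h.continuousOn).locallyIntegrableOn hI.measurableSet)
  have hFl : LocallyIntegrableOn F I volume := hFl₀.add (hGc.locallyIntegrableOn hI.measurableSet)
  obtain ⟨C, hC⟩ := exists_ae_eq_const_of_integral_mul_deriv hI hc ⟨x₀, hx₀⟩ hFl (by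
    intro ψ hψ hψc hψI
    have hψ' := contDiff_infty_iff_deriv.1 hψ
    have hsub' : tsupport (deriv ψ) ⊆ I := tsupport_deriv_subset.trans hψI
    have h1 := h.weak_eq ψ hψ hψc hψI
    have h2 := setIntegral_mul_deriv_add hI hG hgφ hψ hψc hψI
    have i1 : Integrable fun x => (D (φ x) * deriv φ x - f (φ x) + c * φ x) * deriv ψ x :=
      integrable_mul_of_tsupport_subset hFl₀ hψ'.2.continuous hψc.deriv hsub'
    have i2 : Integrable fun x => g (φ x) * ψ x :=
      integrable_mul_of_tsupport_subset (hgφ.locallyIntegrableOn hI.measurableSet)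
        hψ.continuous hψc hψI
    have i3 : Integrable fun x => G x * deriv ψ x :=
      integrable_mul_of_tsupport_subset (hGc.locallyIntegrableOn hI.measurableSet)
        hψ'.2.continuous hψc.deriv hsub'
    have e : ∫ x, F x * deriv ψ x = ∫ x in I, F x * deriv ψ x :=
      (setIntegral_eq_integral_of_forall_compl_eq_zero fun x hx => by
        rw [image_eq_zero_of_notMem_tsupport fun hx' => hx (hsub' hx'), mul_zero]).symm
    have hsum := integral_add ((i1.sub i2).integrableOn (s := I)) ((i3.add i2).integrableOn (s := I))
    have h1' : ∫ x in I, ((fun x => (D (φ x) * deriv φ x - f (φ x) + c * φ x) * deriv ψ x)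
        - fun x => g (φ x) * ψ x) x = 0 := h1
    have h2' : ∫ x in I, ((fun x => G x * deriv ψ x) + fun x => g (φ x) * ψ x) x = 0 := h2
    rw [h1', h2', add_zero] at hsum
    rw [e, ← hsum]
    refine integral_congr_ae (Eventually.of_forall fun x => ?_)
    simp only [F, Pi.add_apply, Pi.sub_apply]; ring)
  let W : ℝ → ℝ := fun x => C - G x + f (φ x) - c * φ x
  have hWc : ContinuousOn W I :=
    ((continuousOn_const.sub hGc).add hfφ).sub (continuousOn_const.mul h.continuousOn)
  have hWae : ∀ᵐ x, x ∈ I → W x = D (φ x) * deriv φ x := by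
    filter_upwards [hC] with x hx hxI
    have := hx hxI
    simp only [F] at this
    simp only [W, ← this]; ring
  refine ⟨W, h.continuousOn, h.mem_Icc, hanti, hWc, (ae_restrict_iff' hI.measurableSet).2 hWae,
    fun ξ hξ hDξ => ?_, fun ξ hξ => ?_⟩
  · -- near `ξ` the absolutely continuous `φ` has the continuous derivative `W / D(φ)`
    have hopen : I ∩ (fun x => D (φ x)) ⁻¹' {0}ᶜ ∈ 𝓝 ξ :=
      (hDφ.isOpen_inter_preimage hI isOpen_compl_singleton).mem_nhds ⟨hξ, hDξ⟩
    obtain ⟨ε, hε, hball⟩ := Metric.nhds_basis_closedBall.mem_iff.1 hopen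
    rw [Real.closedBall_eq_Icc] at hball
    have hWD : ContinuousOn (fun x => W x / D (φ x)) (Icc (ξ - ε) (ξ + ε)) :=
      (hWc.mono fun x hx => (hball hx).1).div (hDφ.mono fun x hx => (hball hx).1)
        fun x hx => (hball hx).2
    have hint : ∀ x ∈ Icc (ξ - ε) (ξ + ε),
        φ x = φ (ξ - ε) + ∫ t in (ξ - ε)..x, W t / D (φ t) := by
      intro x hx
      have hsub : uIcc (ξ - ε) x ⊆ Icc (ξ - ε) (ξ + ε) := by
        rw [uIcc_of_le hx.1]; exact Icc_subset_Icc_right hx.2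
      have h1 := (h.locally_ac _ _ fun t ht => (hball (hsub ht)).1).integral_deriv_eq_sub
      have h2 : ∫ t in (ξ - ε)..x, W t / D (φ t) = ∫ t in (ξ - ε)..x, deriv φ t := by
        refine intervalIntegral.integral_congr_ae ?_
        filter_upwards [hWae] with t ht htI
        have h3 := hball (hsub (uIoc_subset_uIcc htI))
        rw [ht h3.1, mul_div_cancel_left₀ _ h3.2]
      rw [h2, h1]; ring
    have hmem : Icc (ξ - ε) (ξ + ε) ∈ 𝓝 ξ := Icc_mem_nhds (by linarith) (by linarith)
    have hder : HasDerivAt (fun x => φ (ξ - ε) + ∫ t in (ξ - ε)..x, W t / D (φ t))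
        (W ξ / D (φ ξ)) ξ := by
      refine HasDerivAt.const_add _ (intervalIntegral.integral_hasDerivAt_right ?_ ?_ ?_)
      · refine ContinuousOn.intervalIntegrable ?_
        rw [uIcc_of_le (by linarith)]; exact hWD.mono (Icc_subset_Icc_right (by linarith))
      · exact hWD.stronglyMeasurableAtFilter_nhdsWithin measurableSet_Icc ξ |>.filter_mono
          (by rw [nhdsWithin_eq_nhds.2 hmem])
      · exact hWD.continuousAt hmem
    refine hder.congr_of_eventuallyEq ?_
    filter_upwards [hmem] with x hx using hint x hx
  · have e : (fun x => W x - f (φ x) + c * φ x) = fun x => C - G x := by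
      funext x; simp only [W]; ring
    rw [e]
    exact (hG ξ hξ).const_sub C

lemma AbsolutelyContinuousOnInterval.congr {f g : ℝ → ℝ} {a b : ℝ}
    (hf : AbsolutelyContinuousOnInterval f a b) (h : EqOn f g (uIcc a b)) :
    AbsolutelyContinuousOnInterval g a b := by
  rw [absolutelyContinuousOnInterval_iff] at hf ⊢
  intro ε hε
  obtain ⟨δ, hδ, H⟩ := hf ε hε
  refine ⟨δ, hδ, fun E hE hlt => ?_⟩
  refine lt_of_eq_of_lt (Finset.sum_congr rfl fun i hi => ?_) (H E hE hlt)
  rw [h (hE.1 i hi).1, h (hE.1 i hi).2]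

/-- A continuous antitone function which is differentiable off a countable set is absolutely
continuous. -/
lemma AntitoneOn.absolutelyContinuousOnInterval {φ : ℝ → ℝ} {a b : ℝ} {s : Set ℝ}
    (hφ : AntitoneOn φ (uIcc a b)) (hc : ContinuousOn φ (uIcc a b)) (hs : s.Countable)
    (hd : ∀ x ∈ uIcc a b \ s, DifferentiableAt ℝ φ x) :
    AbsolutelyContinuousOnInterval φ a b := by
  have hint : IntervalIntegrable (deriv φ) volume a b := by
    have := (hφ.neg.intervalIntegrable_deriv).neg
    simpa [Pi.neg_def, deriv.neg] using this
  have h1 := hint.absolutelyContinuousOnInterval_intervalIntegral (c := a) left_mem_uIcc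
  have h2 : AbsolutelyContinuousOnInterval (fun _ : ℝ => φ a) a b :=
    (LipschitzWith.const (φ a)).lipschitzOnWith.absolutelyContinuousOnInterval
  refine (h2.add h1).congr fun x hx => ?_
  have hsub : uIcc a x ⊆ uIcc a b := uIcc_subset_uIcc_left hx
  have h3 : ∫ t in a..x, deriv φ t = φ x - φ a := by
    refine integral_eq_of_hasDerivAt_off_countable φ (deriv φ) hs (hc.mono hsub)
      (fun t ht => (hd t ⟨hsub (Ioo_subset_Icc_self ht.1), ht.2⟩).hasDerivAt)
      (hint.mono_set hsub)
  simp only [Pi.add_apply, h3]; ring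

/-- Conversely, a strong profile which is differentiable off a countable set is a travelling wave. -/
theorem IsStrongProfile.isTravelingWave {f D g : ℝ → ℝ} {c : ℝ} {I : Set ℝ} {φ W : ℝ → ℝ}
    (hg : ContinuousOn g (Icc 0 1)) (hI : IsOpen I) (h : IsStrongProfile f D g c I φ W)
    {s : Set ℝ} (hs : s.Countable) (hd : ∀ ξ ∈ I \ s, DifferentiableAt ℝ φ ξ) :
    IsTravelingWave f D g c I φ := by
  have hgφ : ContinuousOn (fun x => g (φ x)) I := hg.comp h.continuousOn h.mem_Icc
  refine ⟨h.continuousOn, h.mem_Icc, ?_, fun a b hab => ?_, ?_, fun ψ hψ hψc hψI => ?_⟩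
  · rw [ae_restrict_iff' hI.measurableSet]
    filter_upwards [hs.ae_notMem volume] with x hx hxI using hd x ⟨hxI, hx⟩
  · exact (h.antitoneOn.mono hab).absolutelyContinuousOnInterval (h.continuousOn.mono hab) hs
      fun x hx => hd x ⟨hab hx.1, hx.2⟩
  · exact (h.flux_continuousOn.locallyIntegrableOn hI.measurableSet).congr h.flux_ae
  · rw [← setIntegral_mul_deriv_add hI h.balance hgφ.neg hψ hψc hψI]
    refine integral_congr_ae ?_
    filter_upwards [h.flux_ae] with x hx
    rw [← hx]; ring

/-! ### Semi-wavefronts to zero -/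

/-- A semi-wavefront from `β` to `0` on `(a, ∞)`, in strong form, with its flux `W`. -/
structure IsStrongSemiWavefront (f D g : ℝ → ℝ) (β c a : ℝ) (φ W : ℝ → ℝ) : Prop
    extends IsStrongProfile f D g c (Ioi a) φ W where
  tendsto_right : Tendsto φ (𝓝[>] a) (𝓝 β)
  tendsto_atTop : Tendsto φ atTop (𝓝 0)

/-- Where the profile is constant its flux vanishes. -/
lemma IsStrongProfile.flux_eq_zero_of_const {f D g : ℝ → ℝ} {c : ℝ} {I : Set ℝ} {φ W : ℝ → ℝ}
    (h : IsStrongProfile f D g c I φ W) {U : Set ℝ} (hU : IsOpen U) (hUI : U ⊆ I) {v : ℝ}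
    (hv : ∀ ξ ∈ U, φ ξ = v) : ∀ ξ ∈ U, W ξ = 0 := by
  have h1 : W =ᵐ[volume.restrict U] fun _ => (0 : ℝ) := by
    have h2 := ae_restrict_of_ae_restrict_of_subset hUI h.flux_ae
    filter_upwards [h2, ae_restrict_mem hU.measurableSet] with x hx hxU
    have : φ =ᶠ[𝓝 x] fun _ => v := by
      filter_upwards [hU.mem_nhds hxU] with y hy using hv y hy
    rw [hx, this.deriv_eq, deriv_const, mul_zero]
  exact Measure.eqOn_open_of_ae_eq h1 hU (h.flux_continuousOn.mono hUI) continuousOn_const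

namespace IsStrongSemiWavefront

variable {f D g : ℝ → ℝ} {β c a : ℝ} {φ W : ℝ → ℝ}

lemma le_β (h : IsStrongSemiWavefront f D g β c a φ W) {ξ : ℝ} (hξ : a < ξ) : φ ξ ≤ β := by
  refine ge_of_tendsto h.tendsto_right ?_
  filter_upwards [Ioo_mem_nhdsGT hξ] with y hy using h.antitoneOn hy.1 hξ hy.2.le

lemma lt_β (S : IsAdmissible f D g β) (h : IsStrongSemiWavefront f D g β c a φ W) {ξ : ℝ}
    (hξ : a < ξ) : φ ξ < β := by
  refine lt_of_le_of_ne (h.le_β hξ) fun he => ?_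
  have hconst : ∀ y ∈ Ioo a ξ, φ y = β := fun y hy =>
    le_antisymm (h.le_β hy.1) (he ▸ h.antitoneOn hy.1 hξ hy.2.le)
  have hW := h.flux_eq_zero_of_const isOpen_Ioo (fun y hy => hy.1) hconst
  obtain ⟨y, hy⟩ := exists_between hξ
  have h1 := h.balance y hy.1
  have h2 : (fun x => W x - f (φ x) + c * φ x) =ᶠ[𝓝 y] fun _ => 0 - f β + c * β := by
    filter_upwards [Ioo_mem_nhds hy.1 hy.2] with x hx
    rw [hconst x hx, hW x hx]
  have h3 := h1.unique ((hasDerivAt_const y _).congr_of_eventuallyEq h2)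
  rw [hconst y hy] at h3
  have := S.g_pos β S.β_mem
  linarith

lemma mem_Ico (S : IsAdmissible f D g β) (h : IsStrongSemiWavefront f D g β c a φ W) {ξ : ℝ}
    (hξ : a < ξ) : φ ξ ∈ Ico 0 β := ⟨(h.mem_Icc ξ hξ).1, h.lt_β S hξ⟩

lemma eq_zero_of_le (h : IsStrongSemiWavefront f D g β c a φ W) {ξ ζ : ℝ}
    (hξ : a < ξ) (h0 : φ ξ = 0) (hle : ξ ≤ ζ) : φ ζ = 0 :=
  le_antisymm (h0 ▸ h.antitoneOn hξ (lt_of_lt_of_le hξ hle) hle)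
    (h.mem_Icc ζ (lt_of_lt_of_le hξ hle)).1

lemma flux_eq_zero (h : IsStrongSemiWavefront f D g β c a φ W) {ξ : ℝ}
    (hξ : a < ξ) (h0 : φ ξ = 0) : W ξ = 0 := by
  have hW := h.flux_eq_zero_of_const isOpen_Ioi (Ioi_subset_Ioi hξ.le)
    (fun y (hy : ξ < y) => h.eq_zero_of_le hξ h0 hy.le)
  have h1 : Tendsto W (𝓝[>] ξ) (𝓝 (W ξ)) :=
    (h.flux_continuousOn.continuousAt (Ioi_mem_nhds hξ)).mono_left nhdsWithin_le_nhds
  refine tendsto_nhds_unique h1 (tendsto_const_nhds.congr' ?_)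
  filter_upwards [self_mem_nhdsWithin] with y hy using (hW y hy).symm

lemma eventually_pos (h : IsStrongSemiWavefront f D g β c a φ W) {ξ : ℝ} (hξ : a < ξ)
    (hpos : 0 < φ ξ) : ∀ᶠ y in 𝓝 ξ, a < y ∧ 0 < φ y :=
  (eventually_gt_nhds hξ).and
    ((h.continuousOn.continuousAt (Ioi_mem_nhds hξ)).eventually (lt_mem_nhds hpos))

lemma D_neg (S : IsAdmissible f D g β) (h : IsStrongSemiWavefront f D g β c a φ W) {ξ : ℝ}
    (hξ : a < ξ) (hpos : 0 < φ ξ) : D (φ ξ) < 0 := S.D_neg _ ⟨hpos, h.lt_β S hξ⟩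

lemma flux_nonneg (S : IsAdmissible f D g β) (h : IsStrongSemiWavefront f D g β c a φ W) {ξ : ℝ}
    (hξ : a < ξ) (hpos : 0 < φ ξ) : 0 ≤ W ξ := by
  have hD := h.D_neg S hξ hpos
  have h1 := (h.hasDerivAt ξ hξ hD.ne).hasDerivWithinAt (s := Ioi ξ)
  rw [hasDerivWithinAt_iff_tendsto_slope' (by simp)] at h1
  have h2 : W ξ / D (φ ξ) ≤ 0 := by
    refine le_of_tendsto h1 ?_
    filter_upwards [self_mem_nhdsWithin] with y hy
    have hy : ξ < y := hy
    rw [slope_def_field]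
    exact div_nonpos_of_nonpos_of_nonneg
      (sub_nonpos.2 (h.antitoneOn hξ (hξ.trans hy) hy.le)) (by linarith)
  by_contra! hneg
  have := div_pos_of_neg_of_neg hneg hD
  linarith

/-- The derivative of the flux where the profile is positive. -/
lemma hasDerivAt_flux (S : IsAdmissible f D g β) (h : IsStrongSemiWavefront f D g β c a φ W) {ξ : ℝ}
    (hξ : a < ξ) (hpos : 0 < φ ξ) :
    HasDerivAt W ((unitDeriv f (φ ξ) - c) * (W ξ / D (φ ξ)) - g (φ ξ)) ξ := by
  have h1 := h.hasDerivAt ξ hξ (h.D_neg S hξ hpos).ne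
  have h2 := (hasDerivAt_unitDeriv S.f_contDiff
    (S.Ioo_subset ⟨hpos, h.lt_β S hξ⟩)).comp ξ h1
  have h3 := ((h.balance ξ hξ).add h2).sub (h1.const_mul c)
  convert! h3 using 1
  · funext x; simp only [Pi.add_apply, Pi.sub_apply, Function.comp]; ring
  · ring

lemma flux_pos (S : IsAdmissible f D g β) (h : IsStrongSemiWavefront f D g β c a φ W) {ξ : ℝ}
    (hξ : a < ξ) (hpos : 0 < φ ξ) : 0 < W ξ := by
  refine lt_of_le_of_ne (h.flux_nonneg S hξ hpos) fun h0 => ?_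
  have hmin : IsLocalMin W ξ := by
    filter_upwards [h.eventually_pos hξ hpos] with y hy
    rw [← h0]; exact h.flux_nonneg S hy.1 hy.2
  have h1 := hmin.hasDerivAt_eq_zero (h.hasDerivAt_flux S hξ hpos)
  rw [← h0] at h1
  have := S.g_pos _ (S.Ioo_subset ⟨hpos, h.lt_β S hξ⟩)
  simp at h1
  linarith

/-- The flux is the solution of the singular first-order problem, evaluated along the profile:
the difference `Δ` of the two satisfies `Δ' = (g / z) Δ`, so that `Δ²` increases, and it tends to zero
at the right end. -/
theorem flux_eq (S : IsAdmissible f D g β) (h : IsStrongSemiWavefront f D g β c a φ W) {ξ : ℝ}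
    (hξ : a < ξ) : W ξ = fluxProfile f D g β c (φ ξ) := by
  have hz := S.isFluxProfile c
  set z := fluxProfile f D g β c with hzdef
  rcases eq_or_lt_of_le (h.mem_Ico S hξ).1 with h0 | hpos
  · rw [h.flux_eq_zero hξ h0.symm, ← h0, hz.zero]
  have hzφ : ContinuousOn (fun x => z (φ x)) (Ioi a) :=
    hz.continuousOn.comp h.continuousOn fun x hx => Ico_subset_Icc_self (h.mem_Ico S hx)
  have hΔc : ContinuousOn (fun x => (W x - z (φ x)) ^ 2) (Ioi a) :=
    (h.flux_continuousOn.sub hzφ).pow 2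
  have hΔ : ∀ x, a < x → 0 < φ x → HasDerivAt (fun x => (W x - z (φ x)) ^ 2)
      (2 * (g (φ x) / z (φ x)) * (W x - z (φ x)) ^ 2) x := by
    intro x hx hxp
    have hI : φ x ∈ Ioo 0 β := ⟨hxp, h.lt_β S hx⟩
    have h1 := h.hasDerivAt x hx (h.D_neg S hx hxp).ne
    have h2 := (hz.hasDerivAt _ hI).comp x h1
    convert! ((h.hasDerivAt_flux S hx hxp).sub h2).pow 2 using 1
    have hz0 := (hz.pos _ hI).ne'
    have hD0 := (h.D_neg S hx hxp).ne
    simp only [Pi.sub_apply, Function.comp]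
    field_simp
    ring
  have hmono : ∀ ξ₁, ξ ≤ ξ₁ → (∀ x ∈ Ico ξ ξ₁, 0 < φ x) →
      (W ξ - z (φ ξ)) ^ 2 ≤ (W ξ₁ - z (φ ξ₁)) ^ 2 := by
    intro ξ₁ hle hp
    have hm : MonotoneOn (fun x => (W x - z (φ x)) ^ 2) (Icc ξ ξ₁) := by
      refine monotoneOn_of_deriv_nonneg (convex_Icc _ _)
        (hΔc.mono fun x hx => lt_of_lt_of_le hξ hx.1) ?_ ?_
      · rw [interior_Icc]
        exact fun x hx => (hΔ x (hξ.trans hx.1)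
          (hp x ⟨hx.1.le, hx.2⟩)).differentiableAt.differentiableWithinAt
      · rw [interior_Icc]
        intro x hx
        have hxa := hξ.trans hx.1
        have hxp := hp x ⟨hx.1.le, hx.2⟩
        rw [(hΔ x hxa hxp).deriv]
        have h1 := S.g_pos _ (S.Ioo_subset ⟨hxp, h.lt_β S hxa⟩)
        have h2 := hz.pos _ ⟨hxp, h.lt_β S hxa⟩
        positivity
    exact hm ⟨le_rfl, hle⟩ ⟨hle, le_rfl⟩ hle
  suffices H : (W ξ - z (φ ξ)) ^ 2 ≤ 0 by
    have := pow_eq_zero_iff two_ne_zero |>.1 (le_antisymm H (sq_nonneg _))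
    linarith
  by_cases hex : ∃ ξ₁, ξ ≤ ξ₁ ∧ φ ξ₁ = 0
  · obtain ⟨ξ₁, hle, h1⟩ := hex
    have hcl : IsCompact (Icc ξ ξ₁ ∩ φ ⁻¹' {0}) := isCompact_Icc.of_isClosed_subset
      ((h.continuousOn.mono fun x hx => lt_of_lt_of_le hξ hx.1).preimage_isClosed_of_isClosed
        isClosed_Icc isClosed_singleton) inter_subset_left
    obtain ⟨e, ⟨⟨he1, he2⟩, he0⟩, hmin⟩ := hcl.exists_isLeast ⟨ξ₁, ⟨hle, le_rfl⟩, h1⟩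
    have he0 : φ e = 0 := he0
    refine (hmono e he1 fun x hx => ?_).trans ?_
    · refine lt_of_le_of_ne (h.mem_Icc x (lt_of_lt_of_le hξ hx.1)).1 fun hx0 => ?_
      exact absurd (hmin ⟨⟨hx.1, hx.2.le.trans he2⟩, hx0.symm⟩) (not_le.2 hx.2)
    · rw [h.flux_eq_zero (lt_of_lt_of_le hξ he1) he0, he0, hz.zero]; simp
  · push Not at hex
    have hp : ∀ x, ξ ≤ x → 0 < φ x := fun x hx =>
      lt_of_le_of_ne (h.mem_Icc x (lt_of_lt_of_le hξ hx)).1 (hex x hx).symm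
    obtain ⟨M, hM⟩ := isCompact_Icc.exists_bound_of_continuousOn S.D_contDiff.continuousOn
    have hM1 : 0 < M + 1 := by
      have := (norm_nonneg _).trans (hM 0 ⟨le_rfl, zero_le_one⟩); linarith
    refine le_of_forall_pos_le_add fun ε' hε' => ?_
    rw [zero_add]
    obtain ⟨ε, hε, hεε⟩ : ∃ ε > 0, ε ^ 2 ≤ ε' := ⟨√ε', Real.sqrt_pos.2 hε', (Real.sq_sqrt hε'.le).le⟩
    have hzlim : Tendsto (fun x => z (φ x)) atTop (𝓝 0) := by
      have h1 : Tendsto z (𝓝[Icc 0 β] 0) (𝓝 0) := by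
        have := hz.continuousOn 0 ⟨le_rfl, S.β_mem.1.le⟩
        rwa [ContinuousWithinAt, hz.zero] at this
      refine h1.comp (tendsto_nhdsWithin_iff.2 ⟨h.tendsto_atTop, ?_⟩)
      filter_upwards [eventually_gt_atTop a] with x hx using Ico_subset_Icc_self (h.mem_Ico S hx)
    obtain ⟨ξ₀, hξ₀⟩ := eventually_atTop.1 (hzlim.eventually (gt_mem_nhds hε))
    -- the flux cannot stay above `ε`, since the profile would then become negative
    obtain ⟨ξ₁, hξ₁, hW⟩ : ∃ ξ₁, max ξ ξ₀ ≤ ξ₁ ∧ W ξ₁ < ε := by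
      by_contra! hbig
      set m := max ξ ξ₀ with hm
      have hma : ∀ x, m ≤ x → a < x := fun x hx =>
        lt_of_lt_of_le hξ ((le_max_left _ _).trans hx)
      have hmp : ∀ x, m ≤ x → 0 < φ x := fun x hx => hp x ((le_max_left _ _).trans hx)
      set b := m + (M + 1) / ε with hb
      have hmb : m ≤ b := by have := div_pos hM1 hε; linarith
      have key := nonneg_of_deriv_nonneg_of_neg
        (w := fun x => (φ m - ε / (M + 1) * (x - m)) - φ x) hmb
        (ContinuousOn.sub (by fun_prop) (h.continuousOn.mono fun x hx => hma x hx.1)) (by simp)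
        (fun x hx => ((((hasDerivAt_id x).sub_const m).const_mul _).const_sub _).sub
          (h.hasDerivAt x (hma x hx.1.le) (h.D_neg S (hma x hx.1.le) (hmp x hx.1.le)).ne)) ?_
      · have e : ε / (M + 1) * (b - m) = 1 := by rw [hb]; field_simp; ring
        have h2 := hmp b hmb
        have h3 := (h.mem_Icc m (hma m le_rfl)).2
        simp only [e] at key
        linarith
      · intro x hx _
        have hxa := hma x hx.1.le
        have hD := h.D_neg S hxa (hmp x hx.1.le)
        have h4 : -D (φ x) ≤ M + 1 := by
          have := neg_le_of_abs_le (hM _ (h.mem_Icc x hxa)); linarith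
        have h5 : ε / (M + 1) ≤ W x / (-D (φ x)) :=
          div_le_div₀ (hε.le.trans (hbig x hx.1.le)) (hbig x hx.1.le) (by linarith) h4
        rw [div_neg] at h5
        linarith
    have hle : ξ ≤ ξ₁ := (le_max_left _ _).trans hξ₁
    refine (hmono ξ₁ hle fun x hx => hp x hx.1).trans (le_trans ?_ hεε)
    have h1 := h.flux_nonneg S (lt_of_lt_of_le hξ hle) (hp ξ₁ hle)
    have h2 := hξ₀ ξ₁ ((le_max_right _ _).trans hξ₁)
    have h3 := hz.nonneg S.β_mem.1 (Ico_subset_Icc_self (h.mem_Ico S (lt_of_lt_of_le hξ hle)))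
    exact sq_le_sq' (by linarith) (by linarith)

lemma hasDerivAt_profile (S : IsAdmissible f D g β) (h : IsStrongSemiWavefront f D g β c a φ W)
    {ξ : ℝ} (hξ : a < ξ) (hpos : 0 < φ ξ) :
    HasDerivAt φ (fluxProfile f D g β c (φ ξ) / D (φ ξ)) ξ := by
  rw [← h.flux_eq S hξ]
  exact h.hasDerivAt ξ hξ (h.D_neg S hξ hpos).ne

lemma tendsto_flux (S : IsAdmissible f D g β) (h : IsStrongSemiWavefront f D g β c a φ W) :
    Tendsto W (𝓝[>] a) (𝓝 (fluxProfile f D g β c β)) := by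
  have h1 : Tendsto (fluxProfile f D g β c) (𝓝[Icc 0 β] β) (𝓝 (fluxProfile f D g β c β)) :=
    (S.isFluxProfile c).continuousOn β ⟨S.β_mem.1.le, le_rfl⟩
  have h2 : Tendsto φ (𝓝[>] a) (𝓝[Icc 0 β] β) := by
    refine tendsto_nhdsWithin_iff.2 ⟨h.tendsto_right, ?_⟩
    filter_upwards [self_mem_nhdsWithin] with x hx using Ico_subset_Icc_self (h.mem_Ico S hx)
  refine (h1.comp h2).congr' ?_
  filter_upwards [self_mem_nhdsWithin] with x hx using (h.flux_eq S hx).symm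

lemma eventually_pos_right (S : IsAdmissible f D g β)
    (h : IsStrongSemiWavefront f D g β c a φ W) : ∀ᶠ x in 𝓝[>] a, 0 < φ x :=
  h.tendsto_right.eventually (lt_mem_nhds S.β_mem.1)

lemma tendsto_flux' (S : IsAdmissible f D g β) (h : IsStrongSemiWavefront f D g β c a φ W) :
    Tendsto (fun ξ => D (φ ξ) * deriv φ ξ) (𝓝[>] a) (𝓝 (fluxProfile f D g β c β)) := by
  refine (h.tendsto_flux S).congr' ?_
  filter_upwards [self_mem_nhdsWithin, h.eventually_pos_right S] with x hx hxp
  have hD := (h.D_neg S hx hxp).ne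
  rw [(h.hasDerivAt x hx hD).deriv, mul_div_cancel₀ _ hD]

end IsStrongSemiWavefront

/-! ### The time function: uniqueness and existence of semi-wavefronts -/

/-- The time which a profile needs from `β` to `x`: an antiderivative of `D / z`, vanishing
at `β`. It is finite since `-D g / z` is the integrable part of the derivative of `z`. -/
lemma IsAdmissible.exists_time {f D g : ℝ → ℝ} {β : ℝ} (S : IsAdmissible f D g β) (c : ℝ) :
    ∃ T : ℝ → ℝ, (∀ x ∈ Ioo 0 β, HasDerivAt T (D x / fluxProfile f D g β c x) x) ∧
      Tendsto T (𝓝[<] β) (𝓝 0) := by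
  have hz := S.isFluxProfile c
  set z := fluxProfile f D g β c
  have hβ := S.β_mem.1
  have hr : ContinuousOn (fun x => D x / z x) (Ioo 0 β) :=
    (S.D_contDiff.continuousOn.mono (S.Ioo_subset.trans Ioo_subset_Icc_self)).div
      (hz.continuousOn.mono Ioo_subset_Icc_self) fun x hx => (hz.pos x hx).ne'
  let T₀ : ℝ → ℝ := fun x => ∫ t in (β / 2)..x, D t / z t
  have hT₀ : ∀ x ∈ Ioo 0 β, HasDerivAt T₀ (D x / z x) x := by
    intro x hx
    refine intervalIntegral.integral_hasDerivAt_right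
      (ContinuousOn.intervalIntegrable (hr.mono ?_)) ?_ (hr.continuousAt (isOpen_Ioo.mem_nhds hx))
    · exact ordConnected_Ioo.uIcc_subset ⟨by linarith, by linarith⟩ hx
    · exact hr.stronglyMeasurableAtFilter isOpen_Ioo x hx
  obtain ⟨H, hH⟩ := isCompact_Icc.exists_bound_of_continuousOn
    ((continuousOn_unitDeriv S.f_contDiff).sub (continuousOn_const (c := c)))
  obtain ⟨y₀, hy₀, hmin⟩ := isCompact_Icc.exists_isMinOn (s := Icc (β / 2) β)
    ⟨β, by linarith, le_rfl⟩ (S.g_cont.mono fun x hx => ⟨by linarith [hx.1], hx.2.trans S.β_mem.2.le⟩)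
  have hg₀ : 0 < g y₀ := S.g_pos y₀ ⟨by linarith [hy₀.1], hy₀.2.trans_lt S.β_mem.2⟩
  have hsub : Ioo (β / 2) β ⊆ Ioo 0 β := Ioo_subset_Ioo_left (by linarith)
  have hanti : AntitoneOn T₀ (Ioo (β / 2) β) := by
    refine antitoneOn_of_deriv_nonpos (convex_Ioo _ _)
      (fun x hx => (hT₀ x (hsub hx)).continuousAt.continuousWithinAt) ?_ ?_ <;> rw [interior_Ioo]
    · exact fun x hx => (hT₀ x (hsub hx)).differentiableAt.differentiableWithinAt
    · intro x hx
      rw [(hT₀ x (hsub hx)).deriv]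
      exact div_nonpos_of_nonpos_of_nonneg (S.D_neg x (hsub hx)).le (hz.pos x (hsub hx)).le
  obtain ⟨Cz, hCz⟩ := isCompact_Icc.exists_bound_of_continuousOn hz.continuousOn
  have hbdd : BddBelow (T₀ '' Ioo (β / 2) β) := by
    refine ⟨-((Cz + H * β) / g y₀), ?_⟩
    rintro _ ⟨x, hx, rfl⟩
    have hIcc : Icc (β / 2) x ⊆ Ioo 0 β := fun t ht => ⟨by linarith [ht.1], ht.2.trans_lt hx.2⟩
    have key := nonneg_of_deriv_nonneg_of_neg
      (w := fun t => T₀ t + (z t + H * t) / g y₀) hx.1.le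
      (ContinuousOn.add (fun t ht => (hT₀ t (hIcc ht)).continuousAt.continuousWithinAt)
        (((hz.continuousOn.mono (hIcc.trans Ioo_subset_Icc_self)).add (by fun_prop)).div_const _)) ?_
      (fun t ht => (hT₀ t (hIcc (Ioo_subset_Icc_self ht))).add
        (((hz.hasDerivAt t (hIcc (Ioo_subset_Icc_self ht))).add
          ((hasDerivAt_id t).const_mul H)).div_const (g y₀))) ?_
    · have h1 := le_of_abs_le (hCz x (Ioo_subset_Icc_self (hsub hx)))
      have h2 : H * x ≤ H * β := mul_le_mul_of_nonneg_left hx.2.le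
        ((norm_nonneg _).trans (hH 0 ⟨le_rfl, zero_le_one⟩))
      have h3 : (z x + H * x) / g y₀ ≤ (Cz + H * β) / g y₀ := by gcongr
      linarith
    · have h1 : T₀ (β / 2) = 0 := intervalIntegral.integral_same
      have h2 := (hz.pos (β / 2) ⟨by linarith, by linarith⟩).le
      have h3 := (norm_nonneg _).trans (hH 0 ⟨le_rfl, zero_le_one⟩)
      simp only [h1]
      positivity
    · intro t ht _
      have ht' := hIcc (Ioo_subset_Icc_self ht)
      have h1 : -H ≤ unitDeriv f t - c :=
        neg_le_of_abs_le (hH t (Ioo_subset_Icc_self (S.Ioo_subset ht')))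
      have h2 : g y₀ ≤ g t := hmin ⟨ht.1.le, (ht.2.trans hx.2).le⟩
      have h3 := S.ratio_pos hz ht'
      have h4 : g y₀ * (-D t / z t) ≤ -(D t * g t) / z t := by
        have := mul_le_mul_of_nonneg_right h2 h3.le
        have e : -(D t * g t) / z t = g t * (-D t / z t) := by ring
        rw [e]; exact this
      have h5 : 0 ≤ (unitDeriv f t - c + -(D t * g t) / z t + H * 1 - g y₀ * (-D t / z t)) / g y₀ :=
        div_nonneg (by linarith) hg₀.le
      have e : D t / z t + (unitDeriv f t - c + -(D t * g t) / z t + H * 1) / g y₀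
          = (unitDeriv f t - c + -(D t * g t) / z t + H * 1 - g y₀ * (-D t / z t)) / g y₀ := by
        have := (hz.pos t ht').ne'
        field_simp; ring
      rw [e]; exact h5
  obtain ⟨l, hl⟩ : ∃ l, Tendsto T₀ (𝓝[<] β) (𝓝 l) :=
    ⟨_, hanti.tendsto_nhdsWithin_Ioo_left (nonempty_Ioo.2 (by linarith)) hbdd⟩
  refine ⟨fun x => T₀ x - l, fun x hx => (hT₀ x hx).sub_const l, ?_⟩
  simpa using hl.sub_const l

/-- The time function of `IsAdmissible.exists_time`. -/
structure IsTimeFunction (f D g : ℝ → ℝ) (β c : ℝ) (T : ℝ → ℝ) : Prop where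
  hasDerivAt : ∀ x ∈ Ioo 0 β, HasDerivAt T (D x / fluxProfile f D g β c x) x
  tendsto : Tendsto T (𝓝[<] β) (𝓝 0)

namespace IsTimeFunction

variable {f D g : ℝ → ℝ} {β c : ℝ} {T : ℝ → ℝ}

lemma continuousOn (hT : IsTimeFunction f D g β c T) : ContinuousOn T (Ioo 0 β) :=
  fun x hx => (hT.hasDerivAt x hx).continuousAt.continuousWithinAt

lemma strictAntiOn (S : IsAdmissible f D g β) (hT : IsTimeFunction f D g β c T) :
    StrictAntiOn T (Ioo 0 β) := by
  refine strictAntiOn_of_deriv_neg (convex_Ioo _ _) hT.continuousOn fun x hx => ?_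
  rw [interior_Ioo] at hx
  rw [(hT.hasDerivAt x hx).deriv]
  exact div_neg_of_neg_of_pos (S.D_neg x hx) ((S.isFluxProfile c).pos x hx)

lemma pos (S : IsAdmissible f D g β) (hT : IsTimeFunction f D g β c T) {x : ℝ}
    (hx : x ∈ Ioo 0 β) : 0 < T x := by
  obtain ⟨y, hy⟩ := exists_between hx.2
  have hy' : y ∈ Ioo 0 β := ⟨hx.1.trans hy.1, hy.2⟩
  refine lt_of_le_of_lt (le_of_tendsto hT.tendsto ?_) (hT.strictAntiOn S hx hy' hy.1)
  filter_upwards [Ioo_mem_nhdsLT hy.2] with t ht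
  exact (hT.strictAntiOn S hy' ⟨hy'.1.trans ht.1, ht.2⟩ ht.1).le

lemma exists_eq (hT : IsTimeFunction f D g β c T) {x s : ℝ} (hx : x ∈ Ioo 0 β) (hs : 0 < s)
    (hsx : s ≤ T x) : ∃ y ∈ Ioo 0 β, T y = s := by
  obtain ⟨y, hy, hy'⟩ :=
    ((hT.tendsto.eventually (gt_mem_nhds hs)).and (Ioo_mem_nhdsLT hx.2)).exists
  have hsub : Icc x y ⊆ Ioo 0 β := fun t ht => ⟨hx.1.trans_le ht.1, ht.2.trans_lt hy'.2⟩
  obtain ⟨t, ht, hte⟩ := intermediate_value_Icc' hy'.1.le (hT.continuousOn.mono hsub) ⟨hy.le, hsx⟩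
  exact ⟨t, hsub ht, hte⟩

end IsTimeFunction

lemma IsAdmissible.exists_isTimeFunction {f D g : ℝ → ℝ} {β : ℝ} (S : IsAdmissible f D g β)
    (c : ℝ) : ∃ T, IsTimeFunction f D g β c T :=
  let ⟨T, h1, h2⟩ := S.exists_time c
  ⟨T, h1, h2⟩

namespace IsStrongSemiWavefront

variable {f D g : ℝ → ℝ} {β c a : ℝ} {φ W : ℝ → ℝ}

lemma time_eq (S : IsAdmissible f D g β) (h : IsStrongSemiWavefront f D g β c a φ W) {T : ℝ → ℝ}
    (hT : IsTimeFunction f D g β c T) {ξ : ℝ} (hξ : a < ξ) (hpos : 0 < φ ξ) : T (φ ξ) = ξ - a := by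
  have hp : ∀ x ∈ Ioc a ξ, 0 < φ x := fun x hx =>
    hpos.trans_le (h.antitoneOn hx.1 hξ hx.2)
  have hd : ∀ x ∈ Ioc a ξ, HasDerivAt (fun y => T (φ y) - y) 0 x := by
    intro x hx
    have hI : φ x ∈ Ioo 0 β := ⟨hp x hx, h.lt_β S hx.1⟩
    have h1 := ((hT.hasDerivAt _ hI).comp x (h.hasDerivAt_profile S hx.1 (hp x hx))).sub
      (hasDerivAt_id x)
    have hD := (S.D_neg _ hI).ne
    have hz := ((S.isFluxProfile c).pos _ hI).ne'
    convert! h1 using 1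
    field_simp; ring
  have hc : ∀ x ∈ Ioc a ξ, T (φ x) - x = T (φ ξ) - ξ := by
    intro x hx
    have := (convex_Icc x ξ).norm_image_sub_le_of_norm_hasDerivWithin_le (C := 0)
      (fun t ht => (hd t ⟨hx.1.trans_le ht.1, ht.2⟩).hasDerivWithinAt) (fun t _ => by simp)
      (left_mem_Icc.2 hx.2) (right_mem_Icc.2 hx.2)
    rw [zero_mul, norm_le_zero_iff, sub_eq_zero] at this
    exact this.symm
  have hlim : Tendsto (fun x => T (φ x) - x) (𝓝[>] a) (𝓝 (0 - a)) := by
    refine (hT.tendsto.comp (tendsto_nhdsWithin_iff.2 ⟨h.tendsto_right, ?_⟩)).sub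
      (tendsto_id.mono_left nhdsWithin_le_nhds)
    filter_upwards [self_mem_nhdsWithin] with x hx using h.lt_β S hx
  have h2 : Tendsto (fun x => T (φ x) - x) (𝓝[>] a) (𝓝 (T (φ ξ) - ξ)) := by
    refine tendsto_const_nhds.congr' ?_
    filter_upwards [Ioc_mem_nhdsGT hξ] with x hx using (hc x hx).symm
  have := tendsto_nhds_unique hlim h2
  linarith

/-- Every value in `(0, β)` is taken. -/
lemma exists_eq (h : IsStrongSemiWavefront f D g β c a φ W) {ξ x : ℝ}
    (hξ : a < ξ) (hx : x ∈ Ioo 0 β) (hle : φ ξ ≤ x) : ∃ ζ ∈ Ioc a ξ, φ ζ = x := by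
  obtain ⟨y, hy, hy'⟩ :=
    ((h.tendsto_right.eventually (lt_mem_nhds hx.2)).and (Ioo_mem_nhdsGT hξ)).exists
  obtain ⟨t, ht, hte⟩ := intermediate_value_Icc' hy'.2.le
    (h.continuousOn.mono fun t ht => hy'.1.trans_le ht.1) ⟨hle, hy.le⟩
  exact ⟨t, ⟨hy'.1.trans_le ht.1, ht.2⟩, hte⟩

/-- Semi-wavefronts with the same speed are shifts of each other. -/
theorem eq_shift (S : IsAdmissible f D g β) {a₁ a₂ : ℝ} {φ₁ φ₂ W₁ W₂ : ℝ → ℝ}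
    (h₁ : IsStrongSemiWavefront f D g β c a₁ φ₁ W₁)
    (h₂ : IsStrongSemiWavefront f D g β c a₂ φ₂ W₂) {s : ℝ} (hs : 0 < s) :
    φ₁ (a₁ + s) = φ₂ (a₂ + s) := by
  obtain ⟨T, hT⟩ := S.exists_isTimeFunction c
  -- a positive value cannot occur at the same time as the value zero
  have aux : ∀ {a₁ a₂ : ℝ} {φ₁ φ₂ W₁ W₂ : ℝ → ℝ},
      IsStrongSemiWavefront f D g β c a₁ φ₁ W₁ → IsStrongSemiWavefront f D g β c a₂ φ₂ W₂ →
      0 < φ₁ (a₁ + s) → 0 < φ₂ (a₂ + s) := by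
    intro a₁ a₂ φ₁ φ₂ W₁ W₂ h₁ h₂ hp
    have h1s : a₁ < a₁ + s := by linarith
    have h2s : a₂ < a₂ + s := by linarith
    refine lt_of_le_of_ne (h₂.mem_Ico S h2s).1 fun h0 => ?_
    obtain ⟨ζ, hζ, hζe⟩ := h₂.exists_eq h2s ⟨hp, h₁.lt_β S h1s⟩ (by rw [← h0]; exact hp.le)
    have e1 := h₁.time_eq S hT h1s hp
    have e2 := h₂.time_eq S hT hζ.1 (by rw [hζe]; exact hp)
    rw [hζe, e1] at e2
    have : ζ = a₂ + s := by linarith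
    rw [this, ← h0] at hζe
    linarith
  have h1s : a₁ < a₁ + s := by linarith
  have h2s : a₂ < a₂ + s := by linarith
  rcases eq_or_lt_of_le (h₁.mem_Ico S h1s).1 with h0 | hp
  · rcases eq_or_lt_of_le (h₂.mem_Ico S h2s).1 with h0' | hp'
    · rw [← h0, ← h0']
    · exact absurd (aux h₂ h₁ hp') (by rw [← h0]; exact lt_irrefl _)
  · have hp' := aux h₁ h₂ hp
    refine (hT.strictAntiOn S).injOn ⟨hp, h₁.lt_β S h1s⟩ ⟨hp', h₂.lt_β S h2s⟩ ?_
    rw [h₁.time_eq S hT h1s hp, h₂.time_eq S hT h2s hp']; ring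

end IsStrongSemiWavefront

/-- A function which is continuous at `x` and has the derivative `p` near `x`, but not necessarily
at `x`, is differentiable at `x` if `p` is continuous there. -/
lemma hasDerivAt_of_eventually_of_ne {w p : ℝ → ℝ} {x : ℝ}
    (h : ∀ᶠ y in 𝓝[≠] x, HasDerivAt w (p y) y) (hw : ContinuousAt w x) (hp : ContinuousAt p x) :
    HasDerivAt w (p x) x := by
  have hr := nhdsWithin_mono x (fun y (hy : x < y) => (ne_of_gt hy : y ≠ x)) h
  have hl := nhdsWithin_mono x (fun y (hy : y < x) => (ne_of_lt hy : y ≠ x)) h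
  have A : HasDerivWithinAt w (p x) (Ici x) x := by
    refine hasDerivWithinAt_Ici_of_tendsto_deriv (s := {y | HasDerivAt w (p y) y})
      (fun y hy => HasDerivAt.differentiableAt hy |>.differentiableWithinAt)
      hw.continuousWithinAt hr ((hp.mono_left nhdsWithin_le_nhds).congr' ?_)
    filter_upwards [hr] with y hy using (HasDerivAt.deriv hy).symm
  have B : HasDerivWithinAt w (p x) (Iic x) x := by
    refine hasDerivWithinAt_Iic_of_tendsto_deriv (s := {y | HasDerivAt w (p y) y})
      (fun y hy => HasDerivAt.differentiableAt hy |>.differentiableWithinAt)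
      hw.continuousWithinAt hl ((hp.mono_left nhdsWithin_le_nhds).congr' ?_)
    filter_upwards [hl] with y hy using (HasDerivAt.deriv hy).symm
  simpa using B.union A

section FirstZero

variable {φ : ℝ → ℝ} {a ξ : ℝ}

/-- The first zero of a profile on `(a, ∞)` (a junk value if there is none). -/
noncomputable def firstZero (φ : ℝ → ℝ) (a : ℝ) : ℝ := sInf {x | a < x ∧ φ x = 0}

lemma bddBelow_zeros : BddBelow {x | a < x ∧ φ x = 0} := ⟨a, fun _ hx => hx.1.le⟩

lemma firstZero_le (hξ : a < ξ) (h0 : φ ξ = 0) : firstZero φ a ≤ ξ :=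
  csInf_le bddBelow_zeros ⟨hξ, h0⟩

lemma eventually_eq_zero_of_ne_firstZero (hanti : AntitoneOn φ (Ioi a))
    (hnn : ∀ x, a < x → 0 ≤ φ x) (hξ : a < ξ) (h0 : φ ξ = 0) (hne : ξ ≠ firstZero φ a) :
    ∀ᶠ y in 𝓝 ξ, a < y ∧ φ y = 0 := by
  obtain ⟨ζ, ⟨hζ, hζ0⟩, hlt⟩ := exists_lt_of_csInf_lt (s := {x | a < x ∧ φ x = 0}) ⟨ξ, hξ, h0⟩
    (lt_of_le_of_ne (firstZero_le hξ h0) hne.symm)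
  filter_upwards [Ioi_mem_nhds hlt] with y hy
  have hay : a < y := hζ.trans hy
  exact ⟨hay, le_antisymm (hζ0 ▸ hanti hζ hay (le_of_lt hy)) (hnn y hay)⟩

end FirstZero

/-- Every speed admits a semi-wavefront from `β` to `0`; its profile is the inverse of the time
function, continued by zero. It is differentiable except possibly at the point where it reaches
zero. -/
theorem IsAdmissible.exists_isStrongSemiWavefront {f D g : ℝ → ℝ} {β : ℝ}
    (S : IsAdmissible f D g β) (c : ℝ) : ∃ φ W, IsStrongSemiWavefront f D g β c 0 φ W := by
  obtain ⟨T, hT⟩ := S.exists_isTimeFunction c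
  have hz := S.isFluxProfile c
  set z := fluxProfile f D g β c with hzdef
  have hTanti := hT.strictAntiOn S
  have hβ := S.β_mem.1
  classical
  let φ : ℝ → ℝ := fun ξ => if h : ∃ x ∈ Ioo 0 β, T x = ξ then h.choose else 0
  have hφ : ∀ ξ, (φ ξ ∈ Ioo 0 β ∧ T (φ ξ) = ξ) ∨ (φ ξ = 0 ∧ ∀ x ∈ Ioo 0 β, T x ≠ ξ) := by
    intro ξ
    by_cases h : ∃ x ∈ Ioo 0 β, T x = ξ
    · left; simp only [φ, dif_pos h]; exact h.choose_spec
    · right; refine ⟨by simp only [φ, dif_neg h], fun x hx he => h ⟨x, hx, he⟩⟩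
  have hnn : ∀ ξ, φ ξ ∈ Ico 0 β := fun ξ => by
    rcases hφ ξ with h | h
    · exact ⟨h.1.1.le, h.1.2⟩
    · rw [h.1]; exact ⟨le_rfl, hβ⟩
  have hpos : ∀ ξ, 0 < φ ξ → φ ξ ∈ Ioo 0 β ∧ T (φ ξ) = ξ := fun ξ hp =>
    (hφ ξ).resolve_right fun h => by linarith [h.1]
  have hinv : ∀ x ∈ Ioo 0 β, φ (T x) = x := by
    intro x hx
    rcases hφ (T x) with h | h
    · exact hTanti.injOn h.1 hx h.2
    · exact absurd rfl (h.2 x hx)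
  have hzero : ∀ ξ, 0 < ξ → φ ξ = 0 → ∀ x ∈ Ioo 0 β, T x < ξ := by
    intro ξ hξ h0 x hx
    by_contra! hle
    obtain ⟨y, hy, hye⟩ := hT.exists_eq hx hξ hle
    have := hinv y hy
    rw [hye, h0] at this
    linarith [hy.1]
  have hanti : AntitoneOn φ (Ioi 0) := by
    intro ξ₁ h1 ξ₂ h2 h12
    rcases eq_or_lt_of_le (hnn ξ₂).1 with h0 | hp
    · rw [← h0]; exact (hnn ξ₁).1
    have h3 := hpos ξ₂ hp
    rcases eq_or_lt_of_le (hnn ξ₁).1 with h0 | hp'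
    · have := hzero ξ₁ h1 h0.symm _ h3.1
      linarith [h3.2]
    · have h4 := hpos ξ₁ hp'
      by_contra! hlt
      have := hTanti h4.1 h3.1 hlt
      linarith [h3.2, h4.2]
  have hcont : ∀ ξ, 0 < ξ → ContinuousAt φ ξ := by
    intro ξ hξ
    refine tendsto_order.2 ⟨fun y hy => ?_, fun y hy => ?_⟩
    · rcases lt_or_ge y 0 with hy0 | hy0
      · exact Eventually.of_forall fun ζ => hy0.trans_le (hnn ζ).1
      obtain ⟨y', hy1, hy2⟩ := exists_between hy
      have h3 := hpos ξ (hy0.trans_lt hy)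
      have hI : y' ∈ Ioo 0 β := ⟨hy0.trans_lt hy1, hy2.trans h3.1.2⟩
      have h4 := hTanti hI h3.1 hy2
      rw [h3.2] at h4
      filter_upwards [Ioo_mem_nhds hξ h4] with ζ hζ
      have h5 := hanti hζ.1 (hT.pos S hI) hζ.2.le
      rw [hinv y' hI] at h5
      linarith
    · obtain ⟨y', hy1, hy2⟩ := exists_between (lt_min hy (hnn ξ).2)
      have hI : y' ∈ Ioo 0 β := ⟨(hnn ξ).1.trans_lt hy1, hy2.trans_le (min_le_right _ _)⟩
      have h4 : T y' < ξ := by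
        rcases eq_or_lt_of_le (hnn ξ).1 with h0 | hp
        · exact hzero ξ hξ h0.symm y' hI
        · have h3 := hpos ξ hp
          have := hTanti h3.1 hI hy1
          linarith [h3.2]
      filter_upwards [Ioi_mem_nhds h4] with ζ hζ
      have hζ : T y' < ζ := hζ
      have h5 := hanti (hT.pos S hI) ((hT.pos S hI).trans hζ) hζ.le
      rw [hinv y' hI] at h5
      exact h5.trans_lt (hy2.trans_le (min_le_left _ _))
  have hcontOn : ContinuousOn φ (Ioi 0) := fun ξ hξ => (hcont ξ hξ).continuousWithinAt
  have hderiv : ∀ ξ, 0 < ξ → 0 < φ ξ → HasDerivAt φ (z (φ ξ) / D (φ ξ)) ξ := by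
    intro ξ hξ hp
    have h3 := hpos ξ hp
    have hne : D (φ ξ) / z (φ ξ) ≠ 0 := div_ne_zero (S.D_neg _ h3.1).ne (hz.pos _ h3.1).ne'
    have := HasDerivAt.of_local_left_inverse (hcont ξ hξ) (hT.hasDerivAt _ h3.1) hne (by
      filter_upwards [(hcont ξ hξ).eventually (lt_mem_nhds hp)] with ζ hζ using (hpos ζ hζ).2)
    rwa [inv_div] at this
  have hIcc : ∀ ξ, φ ξ ∈ Icc 0 β := fun ξ => Ico_subset_Icc_self (hnn ξ)
  have hIcc1 : ∀ ξ, φ ξ ∈ Icc (0 : ℝ) 1 := fun ξ => S.Icc_subset (hIcc ξ)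
  have hWc : ContinuousOn (fun ξ => z (φ ξ)) (Ioi 0) :=
    hz.continuousOn.comp hcontOn fun ξ _ => hIcc ξ
  have hev0 : ∀ ξ, 0 < ξ → φ ξ = 0 → ξ ≠ firstZero φ 0 → φ =ᶠ[𝓝 ξ] fun _ => 0 :=
    fun ξ hξ h0 hne => (eventually_eq_zero_of_ne_firstZero hanti (fun x _ => (hnn x).1) hξ h0 hne).mono
      fun _ hy => hy.2
  have hcase : ∀ ξ, 0 < ξ → ξ ≠ firstZero φ 0 →
      0 < φ ξ ∨ (φ ξ = 0 ∧ φ =ᶠ[𝓝 ξ] fun _ => 0) := by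
    intro ξ hξ hne
    rcases eq_or_lt_of_le (hnn ξ).1 with h0 | hp
    · exact Or.inr ⟨h0.symm, hev0 ξ hξ h0.symm hne⟩
    · exact Or.inl hp
  have hnear : ∀ ξ, 0 < ξ → ∀ᶠ y in 𝓝[≠] ξ, 0 < y ∧ y ≠ firstZero φ 0 := by
    intro ξ hξ
    refine Filter.Eventually.and (p := fun y => 0 < y)
      (nhdsWithin_le_nhds (eventually_gt_nhds hξ)) ?_
    by_cases h : ξ = firstZero φ 0
    · rw [← h]; exact self_mem_nhdsWithin
    · exact nhdsWithin_le_nhds (isOpen_ne.mem_nhds h)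
  have hfφ : ContinuousOn (fun ξ => f (φ ξ)) (Ioi 0) :=
    S.f_contDiff.continuousOn.comp hcontOn fun ξ _ => hIcc1 ξ
  have hgφ : ContinuousOn (fun ξ => g (φ ξ)) (Ioi 0) := S.g_cont.comp hcontOn fun ξ _ => hIcc1 ξ
  have hDφ : ContinuousOn (fun ξ => D (φ ξ)) (Ioi 0) :=
    S.D_contDiff.continuousOn.comp hcontOn fun ξ _ => hIcc1 ξ
  refine ⟨φ, fun ξ => z (φ ξ), ⟨hcontOn, fun ξ _ => hIcc1 ξ, hanti, hWc, ?_, ?_, ?_⟩, ?_, ?_⟩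
  · rw [ae_restrict_iff' measurableSet_Ioi]
    filter_upwards [(countable_singleton (firstZero φ 0)).ae_notMem volume] with ξ hne hξ
    rcases hcase ξ hξ hne with hp | ⟨h0, hev⟩
    · rw [(hderiv ξ hξ hp).deriv, mul_div_cancel₀ _ (S.D_neg _ (hpos ξ hp).1).ne]
    · rw [hev.deriv_eq, deriv_const, h0, hz.zero, mul_zero]
  · intro ξ hξ hD
    refine hasDerivAt_of_eventually_of_ne (p := fun y => z (φ y) / D (φ y)) ?_ (hcont ξ hξ)
      ((hWc.continuousAt (Ioi_mem_nhds hξ)).div (hDφ.continuousAt (Ioi_mem_nhds hξ)) hD)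
    filter_upwards [hnear ξ hξ] with y hy
    rcases hcase y hy.1 hy.2 with hp | ⟨h0, hev⟩
    · exact hderiv y hy.1 hp
    · rw [h0, hz.zero, zero_div]; exact (hasDerivAt_const y 0).congr_of_eventuallyEq hev
  · intro ξ hξ
    have hmem : Ioi 0 ∈ 𝓝 ξ := Ioi_mem_nhds hξ
    refine hasDerivAt_of_eventually_of_ne (p := fun y => -g (φ y)) ?_
      (((hWc.continuousAt hmem).sub (hfφ.continuousAt hmem)).add
        (continuousAt_const.mul (hcont ξ hξ))) (hgφ.continuousAt hmem).neg
    filter_upwards [hnear ξ hξ] with y hy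
    rcases hcase y hy.1 hy.2 with hp | ⟨h0, hev⟩
    · have h1 := hderiv y hy.1 hp
      have hI := (hpos y hp).1
      have h2 := (hz.hasDerivAt _ hI).comp y h1
      have h3 := (hasDerivAt_unitDeriv S.f_contDiff (S.Ioo_subset hI)).comp y h1
      convert! (h2.sub h3).add (h1.const_mul c) using 1
      have hz0 := (hz.pos _ hI).ne'
      have hD0 := (S.D_neg _ hI).ne
      field_simp; ring
    · have hev' : (fun x => z (φ x) - f (φ x) + c * φ x) =ᶠ[𝓝 y] fun _ => z 0 - f 0 + c * 0 := by
        filter_upwards [hev] with x hx; rw [hx]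
      rw [h0, S.g_zero, neg_zero]
      exact (hasDerivAt_const y _).congr_of_eventuallyEq hev'
  · refine tendsto_order.2 ⟨fun y hy => ?_, fun y hy => ?_⟩
    · obtain ⟨y', hy1, hy2⟩ := exists_between (max_lt hy hβ)
      have hI : y' ∈ Ioo 0 β := ⟨(le_max_right _ _).trans_lt hy1, hy2⟩
      filter_upwards [Ioo_mem_nhdsGT (hT.pos S hI)] with ζ hζ
      have h5 := hanti hζ.1 (hT.pos S hI) hζ.2.le
      rw [hinv y' hI] at h5
      exact ((le_max_left _ _).trans_lt hy1).trans_le h5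
    · exact Eventually.of_forall fun ζ => (hnn ζ).2.trans hy
  · refine tendsto_order.2 ⟨fun y hy => ?_, fun y hy => ?_⟩
    · exact Eventually.of_forall fun ζ => hy.trans_le (hnn ζ).1
    · obtain ⟨y', hy1, hy2⟩ := exists_between (lt_min hy hβ)
      have hI : y' ∈ Ioo 0 β := ⟨hy1, hy2.trans_le (min_le_right _ _)⟩
      filter_upwards [eventually_gt_atTop (T y')] with ζ hζ
      have h5 := hanti (hT.pos S hI) ((hT.pos S hI).trans hζ) hζ.le
      rw [hinv y' hI] at h5
      exact h5.trans_lt (hy2.trans_le (min_le_left _ _))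

/-! ### One-sided slopes -/

lemma hasRightSlope_of_tendsto {φ : ℝ → ℝ} {ξ : ℝ} {L : EReal}
    (hc : Tendsto φ (𝓝[>] ξ) (𝓝 (φ ξ))) (hd : ∀ᶠ x in 𝓝[>] ξ, DifferentiableAt ℝ φ x)
    (hL : Tendsto (fun x => ((deriv φ x : ℝ) : EReal)) (𝓝[>] ξ) (𝓝 L)) : HasRightSlope φ ξ L := by
  refine ⟨hd, fun U hU => ?_, hL⟩
  obtain ⟨δ, hδ, hsub⟩ := mem_nhdsGT_iff_exists_Ioo_subset.1 (inter_mem hd (hL hU))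
  rw [mem_map]
  filter_upwards [Ioo_mem_nhdsGT hδ] with x hx
  have hcont : ContinuousOn φ (Icc ξ x) := by
    intro y hy
    rcases eq_or_lt_of_le hy.1 with rfl | h
    · exact (continuousWithinAt_Ioi_iff_Ici.1 hc).mono Icc_subset_Ici_self
    · exact (hsub ⟨h, hy.2.trans_lt hx.2⟩).1.continuousAt.continuousWithinAt
  obtain ⟨θ, hθ, he⟩ := exists_deriv_eq_slope φ hx.1 hcont fun y hy =>
    (hsub ⟨hy.1, hy.2.trans hx.2⟩).1.differentiableWithinAt
  have h1 := (hsub ⟨hθ.1, hθ.2.trans hx.2⟩).2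
  rwa [mem_preimage, he, ← slope_def_field] at h1

lemma hasLeftSlope_of_tendsto {φ : ℝ → ℝ} {ξ : ℝ} {L : EReal}
    (hc : Tendsto φ (𝓝[<] ξ) (𝓝 (φ ξ))) (hd : ∀ᶠ x in 𝓝[<] ξ, DifferentiableAt ℝ φ x)
    (hL : Tendsto (fun x => ((deriv φ x : ℝ) : EReal)) (𝓝[<] ξ) (𝓝 L)) : HasLeftSlope φ ξ L := by
  refine ⟨hd, fun U hU => ?_, hL⟩
  obtain ⟨δ, hδ, hsub⟩ := mem_nhdsLT_iff_exists_Ioo_subset.1 (inter_mem hd (hL hU))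
  rw [mem_map]
  filter_upwards [Ioo_mem_nhdsLT hδ] with x hx
  have hcont : ContinuousOn φ (Icc x ξ) := by
    intro y hy
    rcases eq_or_lt_of_le hy.2 with rfl | h
    · exact (continuousWithinAt_Iio_iff_Iic.1 hc).mono Icc_subset_Iic_self
    · exact (hsub ⟨hx.1.trans_le hy.1, h⟩).1.continuousAt.continuousWithinAt
  obtain ⟨θ, hθ, he⟩ := exists_deriv_eq_slope φ hx.2 hcont fun y hy =>
    (hsub ⟨hx.1.trans hy.1, hy.2⟩).1.differentiableWithinAt
  have h1 := (hsub ⟨hx.1.trans hθ.1, hθ.2⟩).2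
  rw [mem_preimage, he, ← slope_def_field] at h1
  rwa [mem_preimage, slope_comm]

lemma HasLeftSlope.not_differentiableAt {φ : ℝ → ℝ} {ξ : ℝ} {L : EReal} (h : HasLeftSlope φ ξ L)
    (hL : L ≠ 0) (hr : ∀ x, ξ ≤ x → φ x = φ ξ) : ¬ DifferentiableAt ℝ φ ξ := by
  intro hd
  have hs := (hasDerivAt_iff_tendsto_slope.1 hd.hasDerivAt)
  have hs1 : Tendsto (slope φ ξ) (𝓝[>] ξ) (𝓝 (deriv φ ξ)) :=
    hs.mono_left (nhdsWithin_mono ξ fun y (hy : ξ < y) => (ne_of_gt hy : y ≠ ξ))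
  have hs2 : Tendsto (slope φ ξ) (𝓝[<] ξ) (𝓝 (deriv φ ξ)) :=
    hs.mono_left (nhdsWithin_mono ξ fun y (hy : y < ξ) => (ne_of_lt hy : y ≠ ξ))
  have h0 : deriv φ ξ = 0 := by
    refine tendsto_nhds_unique hs1 (tendsto_const_nhds.congr' ?_)
    filter_upwards [self_mem_nhdsWithin] with y hy
    rw [slope_def_field, hr y (le_of_lt hy), sub_self, zero_div]
  rw [h0] at hs2
  exact hL (tendsto_nhds_unique h.2.1 ((continuous_coe_real_ereal.tendsto 0).comp hs2))

/-! ### Regularity of the profiles -/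

/-- At `ξ` the profile is differentiable, and its flux is `D(φ) φ'` there. -/
def IsRegularPoint (D φ W : ℝ → ℝ) (ξ : ℝ) : Prop :=
  DifferentiableAt ℝ φ ξ ∧ W ξ = D (φ ξ) * deriv φ ξ

lemma AbsolutelyContinuousOnInterval.lipschitzOnWith_comp {p φ : ℝ → ℝ} {a b : ℝ} {K : NNReal}
    {s : Set ℝ} (hp : LipschitzOnWith K p s) (hφ : AbsolutelyContinuousOnInterval φ a b)
    (hs : MapsTo φ (uIcc a b) s) : AbsolutelyContinuousOnInterval (fun x => p (φ x)) a b := by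
  rw [absolutelyContinuousOnInterval_iff] at hφ ⊢
  intro ε hε
  obtain ⟨δ, hδ, H⟩ := hφ (ε / (K + 1)) (by positivity)
  refine ⟨δ, hδ, fun E hE hlt => ?_⟩
  have h1 := H E hE hlt
  rw [lt_div_iff₀ (by positivity)] at h1
  have h2 : ∑ i ∈ Finset.range E.1, dist (p (φ (E.2 i).1)) (p (φ (E.2 i).2))
      ≤ K * ∑ i ∈ Finset.range E.1, dist (φ (E.2 i).1) (φ (E.2 i).2) := by
    rw [Finset.mul_sum]
    exact Finset.sum_le_sum fun i hi => hp.dist_le_mul _ (hs (hE.1 i hi).1) _ (hs (hE.1 i hi).2)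
  have h3 : 0 ≤ ∑ i ∈ Finset.range E.1, dist (φ (E.2 i).1) (φ (E.2 i).2) :=
    Finset.sum_nonneg fun _ _ => dist_nonneg
  linarith

/-- A profile is classical in any open set of regular points. -/
theorem IsStrongProfile.isClassicalOn {f D g : ℝ → ℝ} {c : ℝ} {I U : Set ℝ} {φ W : ℝ → ℝ}
    (hf : ContDiffOn ℝ 1 f (Icc 0 1)) (hg : ContinuousOn g (Icc 0 1))
    (h : IsStrongProfile f D g c I φ W) (hU : IsOpen U) (hUI : U ⊆ I)
    (hreg : ∀ ξ ∈ U, IsRegularPoint D φ W ξ) : IsClassicalOn f D g c φ U := by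
  refine ⟨fun ξ hξ => (hreg ξ hξ).1, fun a b hab => ?_, ?_⟩
  · have habI := hab.trans hUI
    have hφ : AbsolutelyContinuousOnInterval φ a b :=
      (h.antitoneOn.mono habI).absolutelyContinuousOnInterval (h.continuousOn.mono habI)
        countable_empty fun x hx => (hreg x (hab hx.1)).1
    obtain ⟨K, hK⟩ := hf.exists_lipschitzOnWith one_ne_zero (convex_Icc 0 1) isCompact_Icc
    have hfφ := hφ.lipschitzOnWith_comp hK fun x hx => h.mem_Icc x (habI hx)
    obtain ⟨G, hG⟩ := isCompact_Icc.exists_bound_of_continuousOn hg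
    have hN : AbsolutelyContinuousOnInterval (fun x => W x - f (φ x) + c * φ x) a b := by
      refine LipschitzOnWith.absolutelyContinuousOnInterval (K := G.toNNReal)
        ((convex_uIcc a b).lipschitzOnWith_of_nnnorm_hasDerivWithin_le
          (fun x hx => (h.balance x (habI hx)).hasDerivWithinAt) fun x hx => ?_)
      rw [← NNReal.coe_le_coe, coe_nnnorm, norm_neg]
      exact (hG _ (h.mem_Icc x (habI hx))).trans (Real.le_coe_toNNReal G)
    refine ((hN.fun_add hfφ).fun_sub (hφ.const_mul c)).congr fun x hx => ?_
    simp only [← (hreg x (hab hx)).2]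
    ring
  · refine (ae_restrict_iff' hU.measurableSet).2 (Eventually.of_forall fun ξ hξ => ?_)
    have hd := (hreg ξ hξ).1.hasDerivAt
    have hev : ∀ᶠ x in 𝓝 ξ, x ∈ U := hU.mem_nhds hξ
    have hfd : HasDerivAt (fun x => f (φ x)) (unitDeriv f (φ ξ) * deriv φ ξ) ξ := by
      have h1 := (hasDerivWithinAt_unitDeriv hf (h.mem_Icc ξ (hUI hξ))).comp ξ
        (hd.hasDerivWithinAt (s := U)) fun x hx => h.mem_Icc x (hUI hx)
      exact h1.hasDerivAt (hU.mem_nhds hξ)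
    have h2 := ((h.balance ξ (hUI hξ)).add hfd).sub (hd.const_mul c)
    refine (h2.congr_of_eventuallyEq ?_).congr_deriv (by ring)
    filter_upwards [hev] with x hx
    simp only [Pi.add_apply, Pi.sub_apply, ← (hreg x hx).2]
    ring

namespace IsStrongSemiWavefront

variable {f D g : ℝ → ℝ} {β c a : ℝ} {φ W : ℝ → ℝ}

lemma isRegularPoint_of_ne (h : IsStrongSemiWavefront f D g β c a φ W) {ξ : ℝ} (hξ : a < ξ)
    (hD : D (φ ξ) ≠ 0) : IsRegularPoint D φ W ξ := by
  have h1 := h.hasDerivAt ξ hξ hD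
  exact ⟨h1.differentiableAt, by rw [h1.deriv, mul_div_cancel₀ _ hD]⟩

lemma deriv_neg (S : IsAdmissible f D g β) (h : IsStrongSemiWavefront f D g β c a φ W) {ξ : ℝ}
    (hξ : a < ξ) (hpos : 0 < φ ξ) : DifferentiableAt ℝ φ ξ ∧ deriv φ ξ < 0 := by
  have hD := h.D_neg S hξ hpos
  have h1 := h.hasDerivAt ξ hξ hD.ne
  exact ⟨h1.differentiableAt, by
    rw [h1.deriv]; exact div_neg_of_pos_of_neg (h.flux_pos S hξ hpos) hD⟩

lemma isRegularPoint_of_differentiableAt (S : IsAdmissible f D g β)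
    (h : IsStrongSemiWavefront f D g β c a φ W) {ξ : ℝ} (hξ : a < ξ)
    (hd : DifferentiableAt ℝ φ ξ) : IsRegularPoint D φ W ξ := by
  rcases eq_or_lt_of_le (h.mem_Ico S hξ).1 with h0 | hpos
  · have hmin : IsLocalMin φ ξ := by
      filter_upwards [Ioi_mem_nhds hξ] with y hy
      rw [← h0]; exact (h.mem_Ico S hy).1
    exact ⟨hd, by rw [h.flux_eq_zero hξ h0.symm, hmin.deriv_eq_zero, mul_zero]⟩
  · exact h.isRegularPoint_of_ne hξ (h.D_neg S hξ hpos).ne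

lemma isRegularPoint_of_ne_firstZero (S : IsAdmissible f D g β)
    (h : IsStrongSemiWavefront f D g β c a φ W) {ξ : ℝ} (hξ : a < ξ)
    (hne : ξ ≠ firstZero φ a) : IsRegularPoint D φ W ξ := by
  rcases eq_or_lt_of_le (h.mem_Ico S hξ).1 with h0 | hpos
  · refine h.isRegularPoint_of_differentiableAt S hξ ?_
    have hev : φ =ᶠ[𝓝 ξ] fun _ => 0 := (eventually_eq_zero_of_ne_firstZero h.antitoneOn
      (fun x hx => (h.mem_Ico S hx).1) hξ h0.symm hne).mono fun _ hy => hy.2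
    exact ((hasDerivAt_const ξ (0 : ℝ)).congr_of_eventuallyEq hev).differentiableAt
  · exact h.isRegularPoint_of_ne hξ (h.D_neg S hξ hpos).ne

/-- The derivative along the profile, in a one-sided neighbourhood where it is positive. -/
lemma tendsto_deriv (S : IsAdmissible f D g β) (h : IsStrongSemiWavefront f D g β c a φ W)
    {l : Filter ℝ} {m : Filter ℝ} {L : EReal} (hpos : ∀ᶠ x in l, a < x ∧ 0 < φ x)
    (hφ : Tendsto φ l m)
    (hL : Tendsto (fun x => ((fluxProfile f D g β c x / D x : ℝ) : EReal)) m (𝓝 L)) :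
    Tendsto (fun x => ((deriv φ x : ℝ) : EReal)) l (𝓝 L) := by
  refine (hL.comp hφ).congr' ?_
  filter_upwards [hpos] with x hx
  rw [(h.hasDerivAt_profile S hx.1 hx.2).deriv, Function.comp]

lemma hasRightSlope (S : IsAdmissible f D g β) (h : IsStrongSemiWavefront f D g β c a φ W)
    (ha : φ a = β) {L : EReal}
    (hL : Tendsto (fun x => ((fluxProfile f D g β c x / D x : ℝ) : EReal)) (𝓝[<] β) (𝓝 L)) :
    HasRightSlope φ a L := by
  have hpos : ∀ᶠ x in 𝓝[>] a, a < x ∧ 0 < φ x :=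
    Filter.Eventually.and (p := fun x => a < x) self_mem_nhdsWithin (h.eventually_pos_right S)
  refine hasRightSlope_of_tendsto (by rw [ha]; exact h.tendsto_right) ?_
    (h.tendsto_deriv S hpos (tendsto_nhdsWithin_iff.2 ⟨h.tendsto_right, ?_⟩) hL)
  · filter_upwards [hpos] with x hx using (h.deriv_neg S hx.1 hx.2).1
  · filter_upwards [self_mem_nhdsWithin] with x hx using h.lt_β S hx

/-- Fast profiles are differentiable also where they reach zero. -/
theorem isRegularPoint_of_fast (S : IsAdmissible f D g β)
    (h : IsStrongSemiWavefront f D g β c a φ W) (hD0 : D 0 = 0)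
    (hc : unitDeriv f 0 < c ∨ (c = unitDeriv f 0 ∧ unitDeriv D 0 < 0)) {ξ : ℝ} (hξ : a < ξ) :
    IsRegularPoint D φ W ξ := by
  by_cases hne : ξ = firstZero φ a
  swap
  · exact h.isRegularPoint_of_ne_firstZero S hξ hne
  rcases eq_or_lt_of_le (h.mem_Ico S hξ).1 with h0 | hpos
  swap
  · exact h.isRegularPoint_of_ne hξ (h.D_neg S hξ hpos).ne
  set z := fluxProfile f D g β c with hz
  let r : ℝ → ℝ := fun x => z x / D x
  -- at `x = 0` the quotient is `0 / 0 = 0`, which is the correct slope there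
  have hr0 : r 0 = 0 := by simp [r, hD0]
  have hr : ContinuousWithinAt r (Ici 0) 0 := by
    rw [← continuousWithinAt_Ioi_iff_Ici, ContinuousWithinAt, hr0]
    have h1 := (S.tendsto_ratio_zero_atTop (S.isFluxProfile c) hD0 hc).inv_tendsto_atTop.neg
    rw [neg_zero] at h1
    refine h1.congr fun x => ?_
    simp only [Pi.inv_apply, r]
    rw [inv_div, div_neg, neg_neg]
  have hφc : ContinuousAt φ ξ := h.continuousOn.continuousAt (Ioi_mem_nhds hξ)
  refine h.isRegularPoint_of_differentiableAt S hξ (HasDerivAt.differentiableAt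
    (f' := r (φ ξ)) (hasDerivAt_of_eventually_of_ne (p := fun y => r (φ y)) ?_ hφc ?_))
  · filter_upwards [self_mem_nhdsWithin, nhdsWithin_le_nhds (Ioi_mem_nhds hξ)] with y hy hya
    rcases eq_or_lt_of_le (h.mem_Ico S hya).1 with hy0 | hyp
    · have hev : φ =ᶠ[𝓝 y] fun _ => 0 := (eventually_eq_zero_of_ne_firstZero h.antitoneOn
        (fun x hx => (h.mem_Ico S hx).1) hya hy0.symm (hne ▸ hy)).mono fun _ hy => hy.2
      rw [← hy0, hr0]
      exact (hasDerivAt_const y (0 : ℝ)).congr_of_eventuallyEq hev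
    · exact h.hasDerivAt_profile S hya hyp
  · have h2 : Tendsto φ (𝓝 ξ) (𝓝[Ici 0] (φ ξ)) := by
      refine tendsto_nhdsWithin_iff.2 ⟨hφc, ?_⟩
      filter_upwards [Ioi_mem_nhds hξ] with y hy using (h.mem_Ico S hy).1
    rw [← h0] at h2
    have h3 := hr.tendsto.comp h2
    rw [ContinuousAt, ← h0]
    exact h3

/-- Slow profiles reach zero, where they are sharp. -/
theorem exists_sharp_of_slow (S : IsAdmissible f D g β)
    (h : IsStrongSemiWavefront f D g β c a φ W) (hD0 : D 0 = 0) (hc : c < unitDeriv f 0) :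
    ∃ ξ₀ > a, φ ξ₀ = 0 ∧ (∀ ξ > a, ξ ≠ ξ₀ → IsRegularPoint D φ W ξ) ∧
      ¬ DifferentiableAt ℝ φ ξ₀ ∧ (∀ ξ > a, φ ξ = 0 ↔ ξ₀ ≤ ξ) ∧
      (unitDeriv D 0 < 0 →
        HasLeftSlope φ ξ₀ (((unitDeriv f 0 - c) / unitDeriv D 0 : ℝ) : EReal)) ∧
      (unitDeriv D 0 = 0 → HasLeftSlope φ ξ₀ ⊥) := by
  have hz := S.isFluxProfile c
  have hlim := S.tendsto_ratio_zero hz hD0 hc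
  have hD' := S.unitDeriv_D_zero_nonpos hD0
  have hhc : 0 < unitDeriv f 0 - c := sub_pos.2 hc
  set u := -unitDeriv D 0 / (unitDeriv f 0 - c) with hu
  have hu0 : 0 ≤ u := div_nonneg (by linarith) hhc.le
  have hnn : ∀ x, a < x → 0 ≤ φ x := fun x hx => (h.mem_Ico S hx).1
  -- near `0` the slope of the profile is bounded away from zero
  have hex : ∃ ξ, a < ξ ∧ φ ξ = 0 := by
    by_contra! hno
    have hp : ∀ x, a < x → 0 < φ x := fun x hx => lt_of_le_of_ne (hnn x hx) (hno x hx).symm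
    have h1 : Tendsto φ atTop (𝓝[>] 0) := by
      refine tendsto_nhdsWithin_iff.2 ⟨h.tendsto_atTop, ?_⟩
      filter_upwards [eventually_gt_atTop a] with x hx using hp x hx
    obtain ⟨m, hm⟩ := eventually_atTop.1 (((hlim.comp h1).eventually
      (gt_mem_nhds (show u < u + 1 by linarith))).and (eventually_gt_atTop a))
    have hma := (hm m le_rfl).2
    have hmb : m ≤ m + (u + 1) := by linarith
    have hxa : ∀ x, m ≤ x → a < x := fun x hx => hma.trans_le hx
    have key := nonneg_of_deriv_nonneg_of_neg
      (w := fun x => (φ m - 1 / (u + 1) * (x - m)) - φ x) hmb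
      (ContinuousOn.sub (by fun_prop) (h.continuousOn.mono fun x hx => hxa x hx.1)) (by simp)
      (fun x hx => ((((hasDerivAt_id x).sub_const m).const_mul _).const_sub _).sub
        (h.hasDerivAt_profile S (hxa x hx.1.le) (hp x (hxa x hx.1.le)))) ?_
    · have e : 1 / (u + 1) * (m + (u + 1) - m) = 1 := by
        have : u + 1 ≠ 0 := by positivity
        field_simp; ring
      have h2 := hp _ (hxa _ hmb)
      have h3 := h.lt_β S hma
      have h4 := S.β_mem.2
      simp only [e] at key
      linarith
    · intro x hx _
      have hI : φ x ∈ Ioo 0 β := ⟨hp x (hxa x hx.1.le), h.lt_β S (hxa x hx.1.le)⟩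
      have h2 : -D (φ x) / fluxProfile f D g β c (φ x) < u + 1 := (hm x hx.1.le).1
      have h3 := one_div_le_one_div_of_le (S.ratio_pos hz hI) h2.le
      have h4 : 1 / (-D (φ x) / fluxProfile f D g β c (φ x))
          = -(fluxProfile f D g β c (φ x) / D (φ x)) := by
        rw [one_div, inv_div, div_neg]
      linarith
  obtain ⟨ξ₁, hξ₁, hξ₁0⟩ := hex
  set ξ₀ := firstZero φ a with hξ₀
  have hgt : a < ξ₀ := by
    obtain ⟨y, hy, hy'⟩ := ((h.eventually_pos_right S).and
      (Ioo_mem_nhdsGT hξ₁)).exists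
    refine hy'.1.trans_le (le_csInf ⟨ξ₁, hξ₁, hξ₁0⟩ fun t ht => ?_)
    by_contra! hlt
    linarith [h.eq_zero_of_le ht.1 ht.2 hlt.le]
  have hcont : ContinuousAt φ ξ₀ := h.continuousOn.continuousAt (Ioi_mem_nhds hgt)
  have hzero_gt : ∀ ξ, ξ₀ < ξ → φ ξ = 0 := by
    intro ξ hξ
    obtain ⟨ζ, ⟨hζ, hζ0⟩, hlt⟩ := exists_lt_of_csInf_lt (s := {x | a < x ∧ φ x = 0})
      ⟨ξ₁, hξ₁, hξ₁0⟩ hξ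
    exact h.eq_zero_of_le hζ hζ0 hlt.le
  have h0 : φ ξ₀ = 0 := by
    refine tendsto_nhds_unique (hcont.mono_left (nhdsWithin_le_nhds (s := Ioi ξ₀)))
      (tendsto_const_nhds.congr' ?_)
    filter_upwards [self_mem_nhdsWithin] with y hy using (hzero_gt y hy).symm
  have hiff : ∀ ξ > a, φ ξ = 0 ↔ ξ₀ ≤ ξ := fun ξ hξ =>
    ⟨fun h => firstZero_le hξ h, fun hle => h.eq_zero_of_le hgt h0 hle⟩
  have hpos : ∀ᶠ x in 𝓝[<] ξ₀, a < x ∧ 0 < φ x := by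
    filter_upwards [Ioo_mem_nhdsLT hgt] with x hx
    exact ⟨hx.1, lt_of_le_of_ne (hnn x hx.1) fun he =>
      absurd ((hiff x hx.1).1 he.symm) (not_le.2 hx.2)⟩
  have hφlim : Tendsto φ (𝓝[<] ξ₀) (𝓝[>] 0) := by
    refine tendsto_nhdsWithin_iff.2 ⟨?_, hpos.mono fun x hx => hx.2⟩
    rw [← h0]; exact hcont.mono_left nhdsWithin_le_nhds
  have hslope : ∀ L : EReal,
      Tendsto (fun x => ((fluxProfile f D g β c x / D x : ℝ) : EReal)) (𝓝[>] 0) (𝓝 L) →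
      HasLeftSlope φ ξ₀ L := fun L hL =>
    hasLeftSlope_of_tendsto (hcont.mono_left nhdsWithin_le_nhds)
      (hpos.mono fun x hx => (h.deriv_neg S hx.1 hx.2).1) (h.tendsto_deriv S hpos hφlim hL)
  have hquot : ∀ x, -(-D x / fluxProfile f D g β c x)⁻¹ = fluxProfile f D g β c x / D x := by
    intro x; rw [inv_div, div_neg, neg_neg]
  have hs1 : unitDeriv D 0 < 0 →
      HasLeftSlope φ ξ₀ (((unitDeriv f 0 - c) / unitDeriv D 0 : ℝ) : EReal) := by
    intro hneg
    refine hslope _ ((continuous_coe_real_ereal.tendsto _).comp ?_)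
    have hune : u ≠ 0 := (div_pos (by linarith) hhc).ne'
    have h1 := (hlim.inv₀ hune).neg
    have e : -u⁻¹ = (unitDeriv f 0 - c) / unitDeriv D 0 := by
      rw [hu, inv_div, div_neg, neg_neg]
    rw [e] at h1
    exact h1.congr hquot
  have hs2 : unitDeriv D 0 = 0 → HasLeftSlope φ ξ₀ ⊥ := by
    intro hzero
    have hu' : u = 0 := by rw [hu, hzero]; simp
    rw [hu'] at hlim
    have h1 : Tendsto (fun x => -D x / fluxProfile f D g β c x) (𝓝[>] 0) (𝓝[>] 0) := by
      refine tendsto_nhdsWithin_iff.2 ⟨hlim, ?_⟩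
      filter_upwards [Ioo_mem_nhdsGT S.β_mem.1] with x hx using S.ratio_pos hz hx
    refine hslope _ (EReal.tendsto_coe_nhds_bot_iff.2 ?_)
    exact (tendsto_neg_atTop_atBot.comp (tendsto_inv_nhdsGT_zero.comp h1)).congr hquot
  refine ⟨ξ₀, hgt, h0, fun ξ hξ hne => h.isRegularPoint_of_ne_firstZero S hξ hne, ?_, hiff, hs1, hs2⟩
  have hr : ∀ x, ξ₀ ≤ x → φ x = φ ξ₀ := fun x hx => by rw [h0, (hiff x (hgt.trans_le hx)).2 hx]
  rcases lt_or_eq_of_le hD' with hneg | hzero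
  · refine (hs1 hneg).not_differentiableAt ?_ hr
    rw [← EReal.coe_zero, Ne, EReal.coe_eq_coe_iff]
    exact (div_neg_of_pos_of_neg hhc hneg).ne
  · exact (hs2 hzero).not_differentiableAt EReal.bot_ne_zero hr

end IsStrongSemiWavefront

/-! ### Reflection -/

/-- The reflection `ρ ↦ -q (1 - ρ)` of the convection or of the diffusivity, corresponding to the
change of variables `φ(ξ) ↦ 1 - φ(-ξ)`, which exchanges the two parts of a wavefront and keeps the
speed. -/
def oddReflect (q : ℝ → ℝ) (ρ : ℝ) : ℝ := -q (1 - ρ)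

/-- The reflection `ρ ↦ q (1 - ρ)` of the reaction. -/
def evenReflect (q : ℝ → ℝ) (ρ : ℝ) : ℝ := q (1 - ρ)

/-- The reflection `ξ ↦ 1 - φ (-ξ)` of a profile. -/
def reflectProfile (φ : ℝ → ℝ) (ξ : ℝ) : ℝ := 1 - φ (-ξ)

/-- The reflection `ξ ↦ -W (-ξ)` of the flux of a profile. -/
def reflectFlux (W : ℝ → ℝ) (ξ : ℝ) : ℝ := -W (-ξ)

@[simp] lemma oddReflect_oddReflect (q : ℝ → ℝ) : oddReflect (oddReflect q) = q := by
  funext x; simp [oddReflect]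

@[simp] lemma evenReflect_evenReflect (q : ℝ → ℝ) : evenReflect (evenReflect q) = q := by
  funext x; simp [evenReflect]

@[simp] lemma reflectProfile_reflectProfile (φ : ℝ → ℝ) :
    reflectProfile (reflectProfile φ) = φ := by
  funext x; simp [reflectProfile]

lemma mapsTo_one_sub_Icc : MapsTo (fun ρ : ℝ => 1 - ρ) (Icc 0 1) (Icc 0 1) := fun ρ hρ =>
  ⟨by linarith [hρ.2], by linarith [hρ.1]⟩

lemma unitDeriv_oddReflect {q : ℝ → ℝ} (hq : ContDiffOn ℝ 1 q (Icc 0 1)) {ρ : ℝ}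
    (hρ : ρ ∈ Icc (0 : ℝ) 1) : unitDeriv (oddReflect q) ρ = unitDeriv q (1 - ρ) := by
  have h1 := ((hasDerivWithinAt_unitDeriv hq (mapsTo_one_sub_Icc hρ)).comp ρ
    ((hasDerivWithinAt_id ρ (Icc 0 1)).const_sub 1) mapsTo_one_sub_Icc).neg
  have h2 := h1.derivWithin (uniqueDiffOn_Icc zero_lt_one ρ hρ)
  rw [mul_neg_one, neg_neg] at h2
  exact h2

lemma IsAdmissible.reflect {f D g : ℝ → ℝ} {β : ℝ} (S : IsAdmissible f D g β) :
    IsAdmissible (oddReflect f) (oddReflect D) (evenReflect g) (1 - β) where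
  f_contDiff := (S.f_contDiff.comp (by fun_prop) mapsTo_one_sub_Icc).neg
  g_cont := S.g_cont.comp (by fun_prop) mapsTo_one_sub_Icc
  g_pos := fun ρ hρ => S.g_pos _ ⟨by linarith [hρ.2], by linarith [hρ.1]⟩
  g_zero := by simp [evenReflect, S.g_one]
  g_one := by simp [evenReflect, S.g_zero]
  β_mem := ⟨by linarith [S.β_mem.2], by linarith [S.β_mem.1]⟩
  D_contDiff := (S.D_contDiff.comp (by fun_prop) mapsTo_one_sub_Icc).neg
  D_neg := fun ρ hρ => neg_neg_of_pos (S.D_pos _ ⟨by linarith [hρ.2], by linarith [hρ.1]⟩)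
  D_pos := fun ρ hρ => neg_pos.2 (S.D_neg _ ⟨by linarith [hρ.2], by linarith [hρ.1]⟩)

section
variable {f D g : ℝ → ℝ} {β : ℝ}

lemma IsAdmissible.unitDeriv_D_reflect (S : IsAdmissible f D g β) :
    unitDeriv (oddReflect D) (1 - β) = unitDeriv D β := by
  rw [unitDeriv_oddReflect S.D_contDiff (Ioo_subset_Icc_self S.reflect.β_mem), sub_sub_cancel]

lemma IsAdmissible.sDiscr_reflect (S : IsAdmissible f D g β) (c : ℝ) :
    sDiscr (oddReflect f) (oddReflect D) (evenReflect g) (1 - β) c = sDiscr f D g β c := by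
  rw [sDiscr, S.unitDeriv_D_reflect,
    unitDeriv_oddReflect S.f_contDiff (Ioo_subset_Icc_self S.reflect.β_mem), evenReflect,
    sub_sub_cancel, sDiscr]

lemma IsAdmissible.sMinus_reflect (S : IsAdmissible f D g β) (c : ℝ) :
    sMinus (oddReflect f) (oddReflect D) (evenReflect g) (1 - β) c = sMinus f D g β c := by
  rw [sMinus, S.sDiscr_reflect,
    unitDeriv_oddReflect S.f_contDiff (Ioo_subset_Icc_self S.reflect.β_mem), sub_sub_cancel, sMinus]

lemma IsAdmissible.sPlus_reflect (S : IsAdmissible f D g β) (c : ℝ) :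
    sPlus (oddReflect f) (oddReflect D) (evenReflect g) (1 - β) c = sPlus f D g β c := by
  rw [sPlus, S.sDiscr_reflect,
    unitDeriv_oddReflect S.f_contDiff (Ioo_subset_Icc_self S.reflect.β_mem), sub_sub_cancel, sPlus]

end

lemma deriv_reflectProfile (φ : ℝ → ℝ) (ξ : ℝ) : deriv (reflectProfile φ) ξ = deriv φ (-ξ) := by
  have h := deriv_comp_neg φ ξ
  unfold reflectProfile
  rw [deriv_const_sub, h, neg_neg]

lemma DifferentiableAt.reflectProfile {φ : ℝ → ℝ} {ξ : ℝ} (h : DifferentiableAt ℝ φ (-ξ)) :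
    DifferentiableAt ℝ (reflectProfile φ) ξ :=
  (DifferentiableAt.comp ξ h differentiableAt_id.neg).const_sub 1

lemma differentiableAt_of_reflectProfile {φ : ℝ → ℝ} {ξ : ℝ}
    (h : DifferentiableAt ℝ (reflectProfile φ) (-ξ)) : DifferentiableAt ℝ φ ξ := by
  have := h.reflectProfile
  rwa [reflectProfile_reflectProfile] at this

lemma IsRegularPoint.of_reflect {D φ W : ℝ → ℝ} {ξ : ℝ}
    (h : IsRegularPoint (oddReflect D) (reflectProfile φ) (reflectFlux W) (-ξ)) :
    IsRegularPoint D φ W ξ := by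
  refine ⟨differentiableAt_of_reflectProfile h.1, ?_⟩
  have h2 := h.2
  rw [deriv_reflectProfile] at h2
  simp only [reflectFlux, oddReflect, reflectProfile, neg_neg, sub_sub_cancel] at h2
  linarith

lemma slope_reflectProfile (φ : ℝ → ℝ) (ξ x : ℝ) :
    slope (reflectProfile φ) (-ξ) (-x) = slope φ ξ x := by
  simp only [slope_def_field, reflectProfile, neg_neg]
  rw [← neg_div_neg_eq]; ring_nf

lemma HasRightSlope.of_reflect {φ : ℝ → ℝ} {ξ : ℝ} {L : EReal}
    (h : HasRightSlope (reflectProfile φ) (-ξ) L) : HasLeftSlope φ ξ L := by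
  have ht : Tendsto (fun x : ℝ => -x) (𝓝[<] ξ) (𝓝[>] (-ξ)) := tendsto_neg_nhdsLT
  refine ⟨(ht.eventually h.1).mono fun x hx => differentiableAt_of_reflectProfile hx,
    (h.2.1.comp ht).congr fun x => ?_, (h.2.2.comp ht).congr fun x => ?_⟩
  · rw [Function.comp, slope_reflectProfile]
  · rw [Function.comp, deriv_reflectProfile, neg_neg]

lemma HasLeftSlope.of_reflect {φ : ℝ → ℝ} {ξ : ℝ} {L : EReal}
    (h : HasLeftSlope (reflectProfile φ) (-ξ) L) : HasRightSlope φ ξ L := by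
  have ht : Tendsto (fun x : ℝ => -x) (𝓝[>] ξ) (𝓝[<] (-ξ)) := tendsto_neg_nhdsGT
  refine ⟨(ht.eventually h.1).mono fun x hx => differentiableAt_of_reflectProfile hx,
    (h.2.1.comp ht).congr fun x => ?_, (h.2.2.comp ht).congr fun x => ?_⟩
  · rw [Function.comp, slope_reflectProfile]
  · rw [Function.comp, deriv_reflectProfile, neg_neg]

section
variable {f D g : ℝ → ℝ} {c : ℝ} {I J : Set ℝ} {φ W : ℝ → ℝ}

theorem IsStrongProfile.reflect (h : IsStrongProfile f D g c I φ W) (hI : IsOpen I)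
    (hJ : IsOpen J) (hIJ : ∀ ξ ∈ J, -ξ ∈ I) :
    IsStrongProfile (oddReflect f) (oddReflect D) (evenReflect g) c J
      (reflectProfile φ) (reflectFlux W) where
  continuousOn := continuousOn_const.sub (h.continuousOn.comp continuousOn_neg hIJ)
  mem_Icc := fun ξ hξ => mapsTo_one_sub_Icc (h.mem_Icc _ (hIJ ξ hξ))
  antitoneOn := fun ξ hξ ζ hζ hle =>
    sub_le_sub_left (h.antitoneOn (hIJ ζ hζ) (hIJ ξ hξ) (neg_le_neg hle)) 1
  flux_continuousOn := (h.flux_continuousOn.comp continuousOn_neg hIJ).neg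
  flux_ae := by
    have h1 := (ae_restrict_iff' hI.measurableSet).1 h.flux_ae
    have h2 := (Measure.measurePreserving_neg (volume : Measure ℝ)).quasiMeasurePreserving.ae h1
    rw [ae_restrict_iff' hJ.measurableSet]
    filter_upwards [h2] with ξ hξ hξJ
    rw [deriv_reflectProfile]
    simp only [reflectFlux, oddReflect, reflectProfile, sub_sub_cancel, hξ (hIJ ξ hξJ)]
    ring
  hasDerivAt := fun ξ hξ hD => by
    simp only [oddReflect, reflectProfile, sub_sub_cancel] at hD ⊢
    have h1 := ((h.hasDerivAt _ (hIJ ξ hξ) (neg_ne_zero.1 hD)).comp ξ (hasDerivAt_neg ξ)).const_sub 1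
    refine h1.congr_deriv ?_
    rw [reflectFlux, neg_div_neg_eq]; ring
  balance := fun ξ hξ => by
    have h1 := (((h.balance _ (hIJ ξ hξ)).comp ξ (hasDerivAt_neg ξ)).const_sub c)
    convert! h1 using 1
    · funext x
      simp only [oddReflect, reflectProfile, reflectFlux, sub_sub_cancel, Function.comp]
      ring
    · simp only [evenReflect, reflectProfile, sub_sub_cancel]
      ring

lemma IsStrongProfile.mono (h : IsStrongProfile f D g c I φ W) (hJI : J ⊆ I) :
    IsStrongProfile f D g c J φ W where
  continuousOn := h.continuousOn.mono hJI
  mem_Icc := fun ξ hξ => h.mem_Icc ξ (hJI hξ)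
  antitoneOn := h.antitoneOn.mono hJI
  flux_continuousOn := h.flux_continuousOn.mono hJI
  flux_ae := ae_restrict_of_ae_restrict_of_subset hJI h.flux_ae
  hasDerivAt := fun ξ hξ => h.hasDerivAt ξ (hJI hξ)
  balance := fun ξ hξ => h.balance ξ (hJI hξ)

lemma IsStrongProfile.congr {φ' W' : ℝ → ℝ} (h : IsStrongProfile f D g c I φ W) (hI : IsOpen I)
    (hφ : EqOn φ' φ I) (hW : EqOn W' W I) : IsStrongProfile f D g c I φ' W' where
  continuousOn := h.continuousOn.congr hφ
  mem_Icc := fun ξ hξ => by rw [hφ hξ]; exact h.mem_Icc ξ hξ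
  antitoneOn := h.antitoneOn.congr hφ.symm
  flux_continuousOn := h.flux_continuousOn.congr hW
  flux_ae := by
    filter_upwards [h.flux_ae, ae_restrict_mem hI.measurableSet] with ξ hξ hξI
    rw [hW hξI, hφ hξI, (hφ.eventuallyEq_of_mem (hI.mem_nhds hξI)).deriv_eq, hξ]
  hasDerivAt := fun ξ hξ hD => by
    rw [hφ hξ] at hD ⊢
    rw [hW hξ]
    exact (h.hasDerivAt ξ hξ hD).congr_of_eventuallyEq (hφ.eventuallyEq_of_mem (hI.mem_nhds hξ))
  balance := fun ξ hξ => by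
    rw [hφ hξ]
    refine (h.balance ξ hξ).congr_of_eventuallyEq ?_
    filter_upwards [hI.mem_nhds hξ] with x hx
    rw [hφ hx, hW hx]

/-- Two profiles can be glued at a point where the diffusivity vanishes, as soon as the glued profile
and its flux are continuous. -/
theorem IsStrongProfile.glue {p : ℝ} (hf : ContinuousOn f (Icc 0 1))
    (hg : ContinuousOn g (Icc 0 1)) (hl : IsStrongProfile f D g c (Iio p) φ W)
    (hr : IsStrongProfile f D g c (Ioi p) φ W) (hφ : ContinuousAt φ p) (hW : ContinuousAt W p)
    (hp : φ p ∈ Icc 0 1) (hD : D (φ p) = 0) : IsStrongProfile f D g c univ φ W := by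
  have hcases : ∀ {P : ℝ → Prop}, (∀ ξ < p, P ξ) → P p → (∀ ξ, p < ξ → P ξ) → ∀ ξ, P ξ := by
    intro P h1 h2 h3 ξ
    rcases lt_trichotomy ξ p with h | rfl | h
    exacts [h1 ξ h, h2, h3 ξ h]
  have hφc : Continuous φ := continuous_iff_continuousAt.2 (hcases
    (fun ξ hξ => hl.continuousOn.continuousAt (Iio_mem_nhds hξ)) hφ
    (fun ξ hξ => hr.continuousOn.continuousAt (Ioi_mem_nhds hξ)))
  have hWc : Continuous W := continuous_iff_continuousAt.2 (hcases
    (fun ξ hξ => hl.flux_continuousOn.continuousAt (Iio_mem_nhds hξ)) hW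
    (fun ξ hξ => hr.flux_continuousOn.continuousAt (Ioi_mem_nhds hξ)))
  have hIcc : ∀ ξ, φ ξ ∈ Icc 0 1 := hcases hl.mem_Icc hp hr.mem_Icc
  have hge : ∀ ξ < p, φ p ≤ φ ξ := fun ξ hξ =>
    le_of_tendsto (hφ.mono_left (nhdsWithin_le_nhds (s := Iio p)))
      (by filter_upwards [Ioo_mem_nhdsLT hξ] with y hy using hl.antitoneOn hξ hy.2 hy.1.le)
  have hle : ∀ ξ, p < ξ → φ ξ ≤ φ p := fun ξ hξ =>
    ge_of_tendsto (hφ.mono_left (nhdsWithin_le_nhds (s := Ioi p)))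
      (by filter_upwards [Ioo_mem_nhdsGT hξ] with y hy using hr.antitoneOn hy.1 hξ hy.2.le)
  have hfφ : Continuous fun x => f (φ x) := hf.comp_continuous hφc hIcc
  have hgφ : Continuous fun x => g (φ x) := hg.comp_continuous hφc hIcc
  have hbal : ∀ ξ, ξ ≠ p → HasDerivAt (fun x => W x - f (φ x) + c * φ x) (-g (φ ξ)) ξ := by
    intro ξ hξ
    rcases lt_or_gt_of_ne hξ with h | h
    exacts [hl.balance ξ h, hr.balance ξ h]
  refine ⟨hφc.continuousOn, fun ξ _ => hIcc ξ, fun x _ y _ hxy => ?_, hWc.continuousOn, ?_, ?_, ?_⟩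
  · rcases lt_trichotomy y p with hy | rfl | hy
    · exact hl.antitoneOn (hxy.trans_lt hy) hy hxy
    · rcases eq_or_lt_of_le hxy with rfl | hx
      exacts [le_rfl, hge x hx]
    · rcases lt_trichotomy x p with hx | rfl | hx
      exacts [(hle y hy).trans (hge x hx), hle y hy, hr.antitoneOn hx hy hxy]
  · rw [Measure.restrict_univ]
    have h1 := (ae_restrict_iff' measurableSet_Iio).1 hl.flux_ae
    have h2 := (ae_restrict_iff' measurableSet_Ioi).1 hr.flux_ae
    filter_upwards [h1, h2, (countable_singleton p).ae_notMem volume] with x hx1 hx2 hne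
    rcases lt_or_gt_of_ne (show x ≠ p from hne) with h | h
    exacts [hx1 h, hx2 h]
  · intro ξ _ hξ
    rcases lt_trichotomy ξ p with h | rfl | h
    exacts [hl.hasDerivAt ξ h hξ, absurd hD hξ, hr.hasDerivAt ξ h hξ]
  · intro ξ _
    by_cases hne : ξ = p
    · refine hasDerivAt_of_eventually_of_ne (p := fun x => -g (φ x)) ?_
        ((hWc.sub hfφ).add (hφc.const_mul c)).continuousAt hgφ.neg.continuousAt
      filter_upwards [self_mem_nhdsWithin] with y hy
      exact hbal y (by rw [← hne]; exact hy)
    · exact hbal ξ hne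

end

/-! ### Semi-wavefronts and thresholds -/

section
variable {f D g : ℝ → ℝ} {β c : ℝ} {φ W : ℝ → ℝ}

lemma IsSemiWavefrontToZero.exists_isStrongSemiWavefront (S : IsAdmissible f D g β) {a : ℝ}
    (h : IsSemiWavefrontToZero f D g β c a φ) : ∃ W, IsStrongSemiWavefront f D g β c a φ W := by
  obtain ⟨W, hW⟩ := h.travelingWave.exists_isStrongProfile S.f_contDiff.continuousOn
    S.D_contDiff.continuousOn S.g_cont isOpen_Ioi ordConnected_Ioi nonempty_Ioi h.antitoneOn
  exact ⟨W, hW, h.tendsto_right, h.tendsto_atTop⟩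

lemma IsSemiWavefrontFromOne.exists_isStrongSemiWavefront (S : IsAdmissible f D g β) {b : ℝ}
    (h : IsSemiWavefrontFromOne f D g β c b φ) :
    ∃ W, IsStrongSemiWavefront (oddReflect f) (oddReflect D) (evenReflect g) (1 - β) c (-b)
      (reflectProfile φ) W := by
  obtain ⟨W, hW⟩ := h.travelingWave.exists_isStrongProfile S.f_contDiff.continuousOn
    S.D_contDiff.continuousOn S.g_cont isOpen_Iio ordConnected_Iio nonempty_Iio h.antitoneOn
  refine ⟨reflectFlux W, hW.reflect isOpen_Iio isOpen_Ioi fun ξ (hξ : -b < ξ) =>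
    neg_lt.1 hξ, ?_, ?_⟩
  · have ht : Tendsto (fun x : ℝ => -x) (𝓝[>] (-b)) (𝓝[<] b) := by
      simpa using (tendsto_neg_nhdsGT (a := -b))
    exact (h.tendsto_left.comp ht).const_sub 1
  · have := (h.tendsto_atBot.comp tendsto_neg_atTop_atBot).const_sub 1
    rwa [sub_self] at this

lemma IsStrongSemiWavefront.isSemiWavefrontToZero (S : IsAdmissible f D g β) {a : ℝ}
    (h : IsStrongSemiWavefront f D g β c a φ W) : IsSemiWavefrontToZero f D g β c a φ where
  travelingWave := h.isTravelingWave S.g_cont isOpen_Ioi (countable_singleton (firstZero φ a))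
    fun _ hξ => (h.isRegularPoint_of_ne_firstZero S hξ.1 hξ.2).1
  antitoneOn := h.antitoneOn
  tendsto_right := h.tendsto_right
  tendsto_atTop := h.tendsto_atTop

lemma IsStrongSemiWavefront.isSemiWavefrontFromOne (S : IsAdmissible f D g β) {b : ℝ}
    (h : IsStrongSemiWavefront (oddReflect f) (oddReflect D) (evenReflect g) (1 - β) c (-b)
      (reflectProfile φ) W) : IsSemiWavefrontFromOne f D g β c b φ := by
  have hs := h.toIsStrongProfile.reflect isOpen_Ioi (J := Iio b) isOpen_Iio
    fun ξ (hξ : ξ < b) => neg_lt_neg hξ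
  simp only [oddReflect_oddReflect, evenReflect_evenReflect, reflectProfile_reflectProfile] at hs
  refine ⟨hs.isTravelingWave S.g_cont isOpen_Iio
    (countable_singleton (-firstZero (reflectProfile φ) (-b))) fun ξ hξ => ?_, hs.antitoneOn, ?_, ?_⟩
  · exact differentiableAt_of_reflectProfile (h.isRegularPoint_of_ne_firstZero S.reflect
      (neg_lt_neg hξ.1) fun he => hξ.2 (neg_eq_iff_eq_neg.1 he)).1
  · have h1 := (h.tendsto_atTop.comp tendsto_neg_atBot_atTop).const_sub 1
    rw [sub_zero] at h1
    exact h1.congr fun x => by simp [reflectProfile]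
  · have h1 := (h.tendsto_right.comp (tendsto_neg_nhdsLT (a := b))).const_sub 1
    rw [sub_sub_cancel] at h1
    exact h1.congr fun x => by simp [reflectProfile]

theorem IsAdmissible.fluxProfile_β_nonneg (S : IsAdmissible f D g β) (c : ℝ) :
    0 ≤ fluxProfile f D g β c β :=
  (S.isFluxProfile c).nonneg S.β_mem.1 ⟨S.β_mem.1.le, le_rfl⟩

lemma IsAdmissible.fluxProfile_β_pos (S : IsAdmissible f D g β) (hc : c < fluxThreshold f D g β) :
    0 < fluxProfile f D g β c β :=
  lt_of_le_of_ne (S.fluxProfile_β_nonneg c) fun h => not_le.2 hc (S.fluxThreshold_le_iff.2 h.symm)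

theorem IsAdmissible.isThresholdNR (S : IsAdmissible f D g β) :
    IsThresholdNR f D g β (fluxThreshold f D g β) := by
  intro c
  obtain ⟨φ, W, h⟩ := S.exists_isStrongSemiWavefront c
  refine ⟨⟨0, φ, h.isSemiWavefrontToZero S⟩, fun a φ h => ?_⟩
  obtain ⟨W, hW⟩ := h.exists_isStrongSemiWavefront S
  refine ⟨fun hc => ?_, fun hc => ⟨_, S.fluxProfile_β_pos hc, hW.tendsto_flux' S⟩⟩
  rw [← S.fluxThreshold_le_iff.1 hc]
  exact hW.tendsto_flux' S

theorem IsAdmissible.isThresholdPL (S : IsAdmissible f D g β) :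
    IsThresholdPL f D g β
      (fluxThreshold (oddReflect f) (oddReflect D) (evenReflect g) (1 - β)) := by
  intro c
  obtain ⟨φ, W, h⟩ := S.reflect.exists_isStrongSemiWavefront c
  refine ⟨⟨0, reflectProfile φ, ?_⟩, fun b φ h => ?_⟩
  · refine IsStrongSemiWavefront.isSemiWavefrontFromOne (W := W) S ?_
    rwa [neg_zero, reflectProfile_reflectProfile]
  obtain ⟨W, hW⟩ := h.exists_isStrongSemiWavefront S
  have h1 := ((hW.tendsto_flux' S.reflect).comp (tendsto_neg_nhdsLT (a := b))).neg
  have h2 : Tendsto (fun ξ => D (φ ξ) * deriv φ ξ) (𝓝[<] b) (𝓝 (-fluxProfile (oddReflect f)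
      (oddReflect D) (evenReflect g) (1 - β) c (1 - β))) := by
    refine h1.congr fun x => ?_
    simp only [Function.comp, deriv_reflectProfile, oddReflect, reflectProfile, neg_neg,
      sub_sub_cancel]
    ring
  refine ⟨fun hc => ?_, fun hc => ⟨_, neg_neg_of_pos (S.reflect.fluxProfile_β_pos hc), h2⟩⟩
  rwa [S.reflect.fluxThreshold_le_iff.1 hc, neg_zero] at h2

end

/-! ### Wavefronts -/

/-- A wavefront which takes the value `β` at `ξβ`, with its flux `W`: a profile in strong form whose
restrictions to the two half-lines are, up to a reflection on the left, semi-wavefronts to zero. -/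
structure IsStrongWavefront (f D g : ℝ → ℝ) (β c ξβ : ℝ) (φ W : ℝ → ℝ) : Prop where
  profile : IsStrongProfile f D g c univ φ W
  eq_β : φ ξβ = β
  right : IsStrongSemiWavefront f D g β c ξβ φ W
  left : IsStrongSemiWavefront (oddReflect f) (oddReflect D) (evenReflect g) (1 - β) c (-ξβ)
    (reflectProfile φ) (reflectFlux W)

section
variable {f D g : ℝ → ℝ} {β c : ℝ} {φ W : ℝ → ℝ}

theorem IsWavefront.exists_isStrongWavefront (S : IsAdmissible f D g β)
    (h : IsWavefront f D g c φ) : ∃ ξβ W, IsStrongWavefront f D g β c ξβ φ W := by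
  obtain ⟨W, hW⟩ := h.travelingWave.exists_isStrongProfile S.f_contDiff.continuousOn
    S.D_contDiff.continuousOn S.g_cont isOpen_univ ordConnected_univ univ_nonempty
    (h.antitone.antitoneOn _)
  have hcont : Continuous φ := continuousOn_univ.1 hW.continuousOn
  obtain ⟨ξβ, hβ⟩ : ∃ ξ, φ ξ = β := by
    obtain ⟨x, hx⟩ := (h.tendsto_atBot.eventually (lt_mem_nhds S.β_mem.2)).exists
    obtain ⟨y, hy⟩ := (h.tendsto_atTop.eventually (gt_mem_nhds S.β_mem.1)).exists
    exact mem_range_of_exists_le_of_exists_ge hcont ⟨y, hy.le⟩ ⟨x, hx.le⟩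
  refine ⟨ξβ, W, hW, hβ, ⟨hW.mono (subset_univ _), ?_, h.tendsto_atTop⟩,
    ⟨hW.reflect isOpen_univ isOpen_Ioi fun _ _ => mem_univ _, ?_, ?_⟩⟩
  · rw [← hβ]; exact hcont.continuousAt.mono_left nhdsWithin_le_nhds
  · have h1 : Continuous (reflectProfile φ) := continuous_const.sub (hcont.comp continuous_neg)
    have h2 : reflectProfile φ (-ξβ) = 1 - β := by rw [reflectProfile, neg_neg, hβ]
    rw [← h2]; exact h1.continuousAt.mono_left nhdsWithin_le_nhds
  · have := (h.tendsto_atBot.comp tendsto_neg_atTop_atBot).const_sub 1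
    rwa [sub_self] at this

namespace IsStrongWavefront

variable {ξβ : ℝ}

lemma lt_β (S : IsAdmissible f D g β) (h : IsStrongWavefront f D g β c ξβ φ W) {ξ : ℝ}
    (hξ : ξβ < ξ) : φ ξ < β := h.right.lt_β S hξ

lemma β_lt (S : IsAdmissible f D g β) (h : IsStrongWavefront f D g β c ξβ φ W) {ξ : ℝ}
    (hξ : ξ < ξβ) : β < φ ξ := by
  have := h.left.lt_β S.reflect (neg_lt_neg hξ)
  simp only [reflectProfile, neg_neg] at this
  linarith

lemma eq_of_eq_β (S : IsAdmissible f D g β) (h : IsStrongWavefront f D g β c ξβ φ W) {ξ : ℝ}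
    (hξ : φ ξ = β) : ξ = ξβ := by
  rcases lt_trichotomy ξ ξβ with hlt | he | hlt
  exacts [absurd hξ (h.β_lt S hlt).ne', he, absurd hξ (h.lt_β S hlt).ne]

/-- The flux at `ξβ` is nonnegative by its values on the right and nonpositive by its values on the
left; hence it vanishes, and so do both end values of the flux profiles. -/
theorem max_fluxThreshold_le (S : IsAdmissible f D g β)
    (h : IsStrongWavefront f D g β c ξβ φ W) :
    max (fluxThreshold f D g β)
      (fluxThreshold (oddReflect f) (oddReflect D) (evenReflect g) (1 - β)) ≤ c := by
  have hW : Continuous W := continuousOn_univ.1 h.profile.flux_continuousOn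
  have hW' : Continuous (reflectFlux W) := (hW.comp continuous_neg).neg
  have h1 := tendsto_nhds_unique (h.right.tendsto_flux S)
    (hW.continuousAt.mono_left nhdsWithin_le_nhds)
  have h2 := tendsto_nhds_unique (h.left.tendsto_flux S.reflect)
    (hW'.continuousAt.mono_left nhdsWithin_le_nhds)
  rw [reflectFlux, neg_neg] at h2
  have h3 := S.fluxProfile_β_nonneg c
  have h4 := S.reflect.fluxProfile_β_nonneg c
  exact max_le (S.fluxThreshold_le_iff.2 (by linarith))
    (S.reflect.fluxThreshold_le_iff.2 (by linarith))

/-- Two wavefronts coincide on each side of the point where they take the value `β`. -/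
theorem exists_shift (S : IsAdmissible f D g β) {φ₁ φ₂ W₁ W₂ : ℝ → ℝ} {ξ₁ ξ₂ : ℝ}
    (h₁ : IsStrongWavefront f D g β c ξ₁ φ₁ W₁) (h₂ : IsStrongWavefront f D g β c ξ₂ φ₂ W₂) :
    ∃ τ : ℝ, ∀ ξ, φ₂ ξ = φ₁ (ξ + τ) := by
  refine ⟨ξ₁ - ξ₂, fun ξ => ?_⟩
  rcases lt_trichotomy ξ ξ₂ with hlt | rfl | hlt
  · have := h₁.left.eq_shift S.reflect h₂.left (sub_pos.2 hlt)
    simp only [reflectProfile] at this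
    have e1 : -(-ξ₁ + (ξ₂ - ξ)) = ξ + (ξ₁ - ξ₂) := by ring
    have e2 : -(-ξ₂ + (ξ₂ - ξ)) = ξ := by ring
    rw [e1, e2] at this
    linarith
  · rw [h₂.eq_β, add_sub_cancel, h₁.eq_β]
  · have := h₁.right.eq_shift S h₂.right (sub_pos.2 hlt)
    rw [add_sub_cancel] at this
    rw [← this]; ring_nf

lemma deriv_neg (S : IsAdmissible f D g β) (h : IsStrongWavefront f D g β c ξβ φ W) {ξ : ℝ}
    (hξ : φ ξ ∈ Ioo (0 : ℝ) 1 \ {β}) : DifferentiableAt ℝ φ ξ ∧ deriv φ ξ < 0 := by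
  rcases lt_trichotomy ξ ξβ with hlt | rfl | hlt
  · have h1 := h.left.deriv_neg S.reflect (neg_lt_neg hlt)
      (by rw [reflectProfile, neg_neg]; linarith [hξ.1.2])
    rw [deriv_reflectProfile, neg_neg] at h1
    exact ⟨differentiableAt_of_reflectProfile h1.1, h1.2⟩
  · exact absurd h.eq_β hξ.2
  · exact h.right.deriv_neg S hlt hξ.1.1

end IsStrongWavefront

/-- Above both thresholds the two semi-wavefronts meet with zero flux, and can be glued. -/
theorem IsAdmissible.exists_isWavefront (S : IsAdmissible f D g β)
    (hc : max (fluxThreshold f D g β)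
      (fluxThreshold (oddReflect f) (oddReflect D) (evenReflect g) (1 - β)) ≤ c) :
    ∃ φ, IsWavefront f D g c φ := by
  obtain ⟨φr, Wr, hr⟩ := S.exists_isStrongSemiWavefront c
  obtain ⟨φl, Wl, hl⟩ := S.reflect.exists_isStrongSemiWavefront c
  have hz := S.fluxThreshold_le_iff.1 ((le_max_left _ _).trans hc)
  have hz' := S.reflect.fluxThreshold_le_iff.1 ((le_max_right _ _).trans hc)
  have hl' := hl.toIsStrongProfile.reflect isOpen_Ioi (J := Iio 0) isOpen_Iio
    fun ξ (hξ : ξ < 0) => neg_pos.2 hξ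
  simp only [oddReflect_oddReflect, evenReflect_evenReflect] at hl'
  let φ : ℝ → ℝ := fun x => if x < 0 then reflectProfile φl x else if 0 < x then φr x else β
  let W : ℝ → ℝ := fun x => if x < 0 then reflectFlux Wl x else if 0 < x then Wr x else 0
  have e1 : EqOn φ (reflectProfile φl) (Iio 0) := fun x (hx : x < 0) => if_pos hx
  have e2 : EqOn W (reflectFlux Wl) (Iio 0) := fun x (hx : x < 0) => if_pos hx
  have e3 : EqOn φ φr (Ioi 0) := fun x (hx : 0 < x) => by
    simp only [φ, if_neg hx.not_gt, if_pos hx]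
  have e4 : EqOn W Wr (Ioi 0) := fun x (hx : 0 < x) => by
    simp only [W, if_neg hx.not_gt, if_pos hx]
  have hφ0 : φ 0 = β := by simp [φ]
  have hW0 : W 0 = 0 := by simp [W]
  have htneg : Tendsto (fun x : ℝ => -x) (𝓝[<] 0) (𝓝[>] 0) := by
    simpa using (tendsto_neg_nhdsLT (a := (0 : ℝ)))
  have hφ : ContinuousAt φ 0 := by
    refine continuousAt_iff_continuous_left'_right'.2 ⟨?_, ?_⟩
    · have h1 := (hl.tendsto_right.comp htneg).const_sub 1
      rw [sub_sub_cancel, ← hφ0] at h1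
      exact h1.congr' (e1.symm.eventuallyEq_of_mem self_mem_nhdsWithin)
    · have h1 := hr.tendsto_right
      rw [← hφ0] at h1
      exact h1.congr' (e3.symm.eventuallyEq_of_mem self_mem_nhdsWithin)
  have hW : ContinuousAt W 0 := by
    refine continuousAt_iff_continuous_left'_right'.2 ⟨?_, ?_⟩
    · have h1 := ((hl.tendsto_flux S.reflect).comp htneg).neg
      rw [hz', neg_zero] at h1
      rw [ContinuousWithinAt, hW0]
      exact h1.congr' (e2.symm.eventuallyEq_of_mem self_mem_nhdsWithin)
    · have h1 := hr.tendsto_flux S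
      rw [hz] at h1
      rw [ContinuousWithinAt, hW0]
      exact h1.congr' (e4.symm.eventuallyEq_of_mem self_mem_nhdsWithin)
  have h := IsStrongProfile.glue S.f_contDiff.continuousOn S.g_cont (hl'.congr isOpen_Iio e1 e2)
    (hr.toIsStrongProfile.congr isOpen_Ioi e3 e4) hφ hW
    (by rw [hφ0]; exact Ioo_subset_Icc_self S.β_mem) (by rw [hφ0]; exact S.D_β)
  refine ⟨φ, h.isTravelingWave S.g_cont isOpen_univ
    (s := {0, firstZero φr 0, -firstZero φl 0}) (by simp) fun ξ hξ => ?_,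
    fun x y hxy => h.antitoneOn (mem_univ x) (mem_univ y) hxy, ?_, ?_⟩
  · simp only [Set.mem_sdiff, mem_univ, mem_insert_iff, mem_singleton_iff, not_or, true_and] at hξ
    obtain ⟨hξ0, hξr, hξl⟩ := hξ
    rcases lt_or_gt_of_ne hξ0 with hlt | hgt
    · have h1 : DifferentiableAt ℝ (reflectProfile φl) ξ :=
        (hl.isRegularPoint_of_ne_firstZero S.reflect (neg_pos.2 hlt) fun he =>
          hξl (neg_eq_iff_eq_neg.1 he)).1.reflectProfile
      exact h1.congr_of_eventuallyEq (e1.eventuallyEq_of_mem (Iio_mem_nhds hlt))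
    · exact (hr.isRegularPoint_of_ne_firstZero S hgt hξr).1.congr_of_eventuallyEq
        (e3.eventuallyEq_of_mem (Ioi_mem_nhds hgt))
  · have h1 := (hl.tendsto_atTop.comp tendsto_neg_atBot_atTop).const_sub 1
    rw [sub_zero] at h1
    exact h1.congr' (e1.symm.eventuallyEq_of_mem (Iio_mem_atBot 0))
  · exact hr.tendsto_atTop.congr' (e3.symm.eventuallyEq_of_mem (Ioi_mem_atTop 0))

end

/-! ### Regularity of the wavefronts -/

lemma IsClassicalOn.mono {f D g : ℝ → ℝ} {c : ℝ} {φ : ℝ → ℝ} {U V : Set ℝ}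
    (h : IsClassicalOn f D g c φ U) (hV : V ⊆ U) : IsClassicalOn f D g c φ V where
  differentiableAt := fun ξ hξ => h.differentiableAt ξ (hV hξ)
  flux_ac := fun a b hab => h.flux_ac a b (hab.trans hV)
  ode := ae_restrict_of_ae_restrict_of_subset hV h.ode

lemma IsClassicalOn.isClassicalAt {f D g : ℝ → ℝ} {c l : ℝ} {φ : ℝ → ℝ} {U : Set ℝ}
    (h : IsClassicalOn f D g c φ U) (hU : IsOpen U) (hl : ∀ ξ, φ ξ = l → ξ ∈ U) :
    IsClassicalAt f D g c φ l := by
  intro ξ hξ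
  obtain ⟨ε, hε, hsub⟩ := Metric.isOpen_iff.1 hU ξ (hl ξ hξ)
  exact ⟨ε, hε, h.mono (by rwa [← Real.ball_eq_Ioo])⟩

namespace IsStrongWavefront

variable {f D g : ℝ → ℝ} {β c ξβ : ℝ} {φ W : ℝ → ℝ}

lemma lt_of_eq_zero (S : IsAdmissible f D g β) (h : IsStrongWavefront f D g β c ξβ φ W) {ξ : ℝ}
    (hξ : φ ξ = 0) : ξβ < ξ := by
  by_contra! hle
  have h1 := h.profile.antitoneOn (mem_univ ξ) (mem_univ ξβ) hle
  rw [h.eq_β, hξ] at h1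
  exact absurd h1 (not_le.2 S.β_mem.1)

lemma lt_of_eq_one (S : IsAdmissible f D g β) (h : IsStrongWavefront f D g β c ξβ φ W) {ξ : ℝ}
    (hξ : φ ξ = 1) : ξ < ξβ := by
  by_contra! hle
  have h1 := h.profile.antitoneOn (mem_univ ξβ) (mem_univ ξ) hle
  rw [h.eq_β, hξ] at h1
  exact absurd h1 (not_le.2 S.β_mem.2)

lemma hasRightSlope (S : IsAdmissible f D g β) (h : IsStrongWavefront f D g β c ξβ φ W) :
    (fluxThreshold f D g β < c → sMinus f D g β c < 0 ∧
      HasRightSlope φ ξβ ((g β / sMinus f D g β c : ℝ) : EReal)) ∧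
    (c = fluxThreshold f D g β → 0 < unitDeriv D β → sPlus f D g β c < 0 ∧
      HasRightSlope φ ξβ ((g β / sPlus f D g β c : ℝ) : EReal)) ∧
    (c = fluxThreshold f D g β → unitDeriv D β = 0 → HasRightSlope φ ξβ ⊥) := by
  refine ⟨fun hc => ?_, fun hc hD => ?_, fun hc hD => ?_⟩
  · obtain ⟨hs, hl⟩ := S.tendsto_slope_β_of_lt hc
    exact ⟨hs, h.right.hasRightSlope S h.eq_β ((continuous_coe_real_ereal.tendsto _).comp hl)⟩
  · obtain ⟨hs, hl⟩ := S.tendsto_slope_β_of_eq hc hD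
    exact ⟨hs, h.right.hasRightSlope S h.eq_β ((continuous_coe_real_ereal.tendsto _).comp hl)⟩
  · exact h.right.hasRightSlope S h.eq_β
      (EReal.tendsto_coe_nhds_bot_iff.2 (S.tendsto_slope_β_atBot hc hD))

lemma hasLeftSlope (S : IsAdmissible f D g β) (h : IsStrongWavefront f D g β c ξβ φ W) {cpl : ℝ}
    (hcpl : cpl = fluxThreshold (oddReflect f) (oddReflect D) (evenReflect g) (1 - β)) :
    (cpl < c → sMinus f D g β c < 0 ∧
      HasLeftSlope φ ξβ ((g β / sMinus f D g β c : ℝ) : EReal)) ∧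
    (c = cpl → 0 < unitDeriv D β → sPlus f D g β c < 0 ∧
      HasLeftSlope φ ξβ ((g β / sPlus f D g β c : ℝ) : EReal)) ∧
    (c = cpl → unitDeriv D β = 0 → HasLeftSlope φ ξβ ⊥) := by
  have S' := S.reflect
  have h0 : reflectProfile φ (-ξβ) = 1 - β := by rw [reflectProfile, neg_neg, h.eq_β]
  have hg : evenReflect g (1 - β) = g β := by rw [evenReflect, sub_sub_cancel]
  refine ⟨fun hc => ?_, fun hc hD => ?_, fun hc hD => ?_⟩
  · obtain ⟨hs, hl⟩ := S'.tendsto_slope_β_of_lt (hcpl ▸ hc)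
    rw [S.sMinus_reflect] at hs hl
    rw [hg] at hl
    exact ⟨hs, (h.left.hasRightSlope S' h0
      ((continuous_coe_real_ereal.tendsto _).comp hl)).of_reflect⟩
  · obtain ⟨hs, hl⟩ := S'.tendsto_slope_β_of_eq (hc.trans hcpl) (by rwa [S.unitDeriv_D_reflect])
    rw [S.sPlus_reflect] at hs hl
    rw [hg] at hl
    exact ⟨hs, (h.left.hasRightSlope S' h0
      ((continuous_coe_real_ereal.tendsto _).comp hl)).of_reflect⟩
  · exact (h.left.hasRightSlope S' h0 (EReal.tendsto_coe_nhds_bot_iff.2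
      (S'.tendsto_slope_β_atBot (hc.trans hcpl) (by rwa [S.unitDeriv_D_reflect])))).of_reflect

/-- If the diffusivity vanishes at neither end point, it vanishes along the profile only at `ξβ`. -/
theorem isClassicalOn_compl (S : IsAdmissible f D g β) (h : IsStrongWavefront f D g β c ξβ φ W)
    (h01 : D 0 * D 1 < 0) : IsClassicalOn f D g c φ {ξβ}ᶜ := by
  have hne := h01.ne
  rw [mul_ne_zero_iff] at hne
  refine h.profile.isClassicalOn S.f_contDiff S.g_cont isOpen_compl_singleton (subset_univ _)
    fun ξ hξ => ?_
  have hD : D (φ ξ) ≠ 0 := by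
    have hI := h.profile.mem_Icc ξ (mem_univ ξ)
    rcases lt_trichotomy ξ ξβ with hlt | he | hlt
    · rcases eq_or_lt_of_le hI.2 with h1 | h1
      exacts [h1 ▸ hne.2, (S.D_pos _ ⟨h.β_lt S hlt, h1⟩).ne']
    · exact absurd he hξ
    · rcases eq_or_lt_of_le hI.1 with h1 | h1
      exacts [h1 ▸ hne.1, (S.D_neg _ ⟨h1, h.lt_β S hlt⟩).ne]
  have h1 := h.profile.hasDerivAt ξ (mem_univ ξ) hD
  exact ⟨h1.differentiableAt, by rw [h1.deriv, mul_div_cancel₀ _ hD]⟩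

theorem isClassicalOn_Ioi (S : IsAdmissible f D g β) (h : IsStrongWavefront f D g β c ξβ φ W)
    (hD0 : D 0 = 0) (hc : unitDeriv f 0 < c ∨ (c = unitDeriv f 0 ∧ unitDeriv D 0 < 0)) :
    IsClassicalOn f D g c φ (Ioi ξβ) :=
  h.profile.isClassicalOn S.f_contDiff S.g_cont isOpen_Ioi (subset_univ _) fun _ hξ =>
    h.right.isRegularPoint_of_fast S hD0 hc hξ

theorem isClassicalOn_Iio (S : IsAdmissible f D g β) (h : IsStrongWavefront f D g β c ξβ φ W)
    (hD1 : D 1 = 0) (hc : unitDeriv f 1 < c ∨ (c = unitDeriv f 1 ∧ unitDeriv D 1 < 0)) :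
    IsClassicalOn f D g c φ (Iio ξβ) := by
  refine h.profile.isClassicalOn S.f_contDiff S.g_cont isOpen_Iio (subset_univ _) fun ξ hξ =>
    IsRegularPoint.of_reflect
      (h.left.isRegularPoint_of_fast S.reflect (by simp [oddReflect, hD1]) ?_ (neg_lt_neg hξ))
  rwa [unitDeriv_oddReflect S.f_contDiff ⟨le_rfl, zero_le_one⟩,
    unitDeriv_oddReflect S.D_contDiff ⟨le_rfl, zero_le_one⟩, sub_zero]

theorem exists_isSharpAt_zero (S : IsAdmissible f D g β)
    (h : IsStrongWavefront f D g β c ξβ φ W) (hD0 : D 0 = 0) (hc : c < unitDeriv f 0) :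
    ∃ ξ₀ > ξβ, IsSharpAt f D g c φ (Ioi ξβ) 0 ξ₀ ∧ (∀ ξ, φ ξ = 0 ↔ ξ₀ ≤ ξ) ∧
      (unitDeriv D 0 < 0 →
        HasLeftSlope φ ξ₀ (((unitDeriv f 0 - c) / unitDeriv D 0 : ℝ) : EReal)) ∧
      (unitDeriv D 0 = 0 → HasLeftSlope φ ξ₀ ⊥) := by
  obtain ⟨ξ₀, hgt, h0, hreg, hnd, hiff, hs1, hs2⟩ := h.right.exists_sharp_of_slow S hD0 hc
  refine ⟨ξ₀, hgt, ⟨hgt, h0, ?_, hnd⟩, fun ξ => ⟨fun hξ => ?_, fun hle => ?_⟩, hs1, hs2⟩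
  · exact h.profile.isClassicalOn S.f_contDiff S.g_cont (isOpen_Ioi.sdiff isClosed_singleton)
      (subset_univ _) fun ξ hξ => hreg ξ hξ.1 hξ.2
  · exact (hiff ξ (h.lt_of_eq_zero S hξ)).1 hξ
  · exact (hiff ξ (lt_of_lt_of_le hgt hle)).2 hle

theorem exists_isSharpAt_one (S : IsAdmissible f D g β)
    (h : IsStrongWavefront f D g β c ξβ φ W) (hD1 : D 1 = 0) (hc : c < unitDeriv f 1) :
    ∃ ξ₁ < ξβ, IsSharpAt f D g c φ (Iio ξβ) 1 ξ₁ ∧ (∀ ξ, φ ξ = 1 ↔ ξ ≤ ξ₁) ∧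
      (unitDeriv D 1 < 0 →
        HasRightSlope φ ξ₁ (((unitDeriv f 1 - c) / unitDeriv D 1 : ℝ) : EReal)) ∧
      (unitDeriv D 1 = 0 → HasRightSlope φ ξ₁ ⊥) := by
  have ef := unitDeriv_oddReflect S.f_contDiff (ρ := 0) ⟨le_rfl, zero_le_one⟩
  have eD := unitDeriv_oddReflect S.D_contDiff (ρ := 0) ⟨le_rfl, zero_le_one⟩
  rw [sub_zero] at ef eD
  obtain ⟨ξ₀, hgt, h0, hreg, hnd, hiff, hs1, hs2⟩ := h.left.exists_sharp_of_slow S.reflect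
    (by simp [oddReflect, hD1]) (by rwa [ef])
  rw [ef, eD] at hs1
  rw [eD] at hs2
  have hlt : -ξ₀ < ξβ := neg_lt.1 hgt
  have hφ : ∀ ξ, reflectProfile φ (-ξ) = 0 ↔ φ ξ = 1 := fun ξ => by
    rw [reflectProfile, neg_neg, sub_eq_zero, eq_comm]
  have hiff' : ∀ ξ < ξβ, φ ξ = 1 ↔ ξ ≤ -ξ₀ := fun ξ hξ => by
    rw [← hφ, hiff (-ξ) (neg_lt_neg hξ), le_neg]
  refine ⟨-ξ₀, hlt, ⟨hlt, (hiff' _ hlt).2 le_rfl, ?_, fun hd => hnd ?_⟩,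
    fun ξ => ⟨fun hξ => ?_, fun hle => ?_⟩, fun hneg => ?_, fun hzero => ?_⟩
  · exact h.profile.isClassicalOn S.f_contDiff S.g_cont (isOpen_Iio.sdiff isClosed_singleton)
      (subset_univ _) fun ξ hξ => (hreg (-ξ) (neg_lt_neg hξ.1) fun he =>
        hξ.2 (neg_eq_iff_eq_neg.1 he)).of_reflect
  · exact hd.reflectProfile
  · exact (hiff' ξ (h.lt_of_eq_one S hξ)).1 hξ
  · exact (hiff' ξ (lt_of_le_of_lt hle hlt)).2 hle
  · exact HasLeftSlope.of_reflect (by rw [neg_neg]; exact hs1 hneg)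
  · exact HasLeftSlope.of_reflect (by rw [neg_neg]; exact hs2 hzero)

end IsStrongWavefront

theorem theorem2p2 (f D g : ℝ → ℝ) (β : ℝ)
    (hf : ContDiffOn ℝ 1 f (Icc 0 1)) (hf0 : f 0 = 0)
    (hg : ContinuousOn g (Icc 0 1)) (hg_pos : ∀ ρ ∈ Ioo (0 : ℝ) 1, 0 < g ρ)
    (hg0 : g 0 = 0) (hg1 : g 1 = 0)
    (hβ : β ∈ Ioo (0 : ℝ) 1)
    (hD : ContDiffOn ℝ 1 D (Icc 0 1))
    (hD_neg : ∀ ρ ∈ Ioo 0 β, D ρ < 0) (hD_pos : ∀ ρ ∈ Ioo β 1, 0 < D ρ) :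
    ∃ cnr cpl : ℝ, IsThresholdNR f D g β cnr ∧ IsThresholdPL f D g β cpl ∧
      -- existence if and only if `c ≥ max cnr cpl`, and uniqueness up to shifts
      (∀ c : ℝ, (∃ φ, IsWavefront f D g c φ) ↔ max cnr cpl ≤ c) ∧
      (∀ (c : ℝ) (φ₁ φ₂ : ℝ → ℝ), IsWavefront f D g c φ₁ → IsWavefront f D g c φ₂ →
        ∃ τ : ℝ, ∀ ξ, φ₂ ξ = φ₁ (ξ + τ)) ∧
      -- the numbers `s₋(β, c)`, `s₊(β, c)` are well defined
      (∀ c : ℝ, max cnr cpl ≤ c → 0 ≤ sDiscr f D g β c) ∧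
      -- properties of the profiles
      ∀ (c : ℝ) (φ : ℝ → ℝ), max cnr cpl ≤ c → IsWavefront f D g c φ →
        (∀ ξ, φ ξ ∈ Ioo (0 : ℝ) 1 \ {β} → DifferentiableAt ℝ φ ξ ∧ deriv φ ξ < 0) ∧
        ∃ ξβ : ℝ, φ ξβ = β ∧ (∀ ξ, φ ξ = β → ξ = ξβ) ∧
          -- the left slope at `ξβ`
          (cpl < c → sMinus f D g β c < 0 ∧
            HasLeftSlope φ ξβ ((g β / sMinus f D g β c : ℝ) : EReal)) ∧
          (c = cpl → 0 < unitDeriv D β → sPlus f D g β cpl < 0 ∧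
            HasLeftSlope φ ξβ ((g β / sPlus f D g β cpl : ℝ) : EReal)) ∧
          (c = cpl → unitDeriv D β = 0 → HasLeftSlope φ ξβ ⊥) ∧
          -- the right slope at `ξβ`
          (cnr < c → sMinus f D g β c < 0 ∧
            HasRightSlope φ ξβ ((g β / sMinus f D g β c : ℝ) : EReal)) ∧
          (c = cnr → 0 < unitDeriv D β → sPlus f D g β cnr < 0 ∧
            HasRightSlope φ ξβ ((g β / sPlus f D g β cnr : ℝ) : EReal)) ∧
          (c = cnr → unitDeriv D β = 0 → HasRightSlope φ ξβ ⊥) ∧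
          -- (i)
          (D 0 * D 1 < 0 → IsClassicalOn f D g c φ {ξβ}ᶜ) ∧
          -- (ii)
          (D 0 = 0 → (unitDeriv f 0 < c ∨ (c = unitDeriv f 0 ∧ unitDeriv D 0 < 0)) →
            IsClassicalAt f D g c φ 0 ∧ IsClassicalOn f D g c φ (Ioi ξβ)) ∧
          (D 1 = 0 → (unitDeriv f 1 < c ∨ (c = unitDeriv f 1 ∧ unitDeriv D 1 < 0)) →
            IsClassicalAt f D g c φ 1 ∧ IsClassicalOn f D g c φ (Iio ξβ)) ∧
          -- (iii)
          (D 0 = 0 → c < unitDeriv f 0 →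
            ∃ ξ₀ > ξβ, IsSharpAt f D g c φ (Ioi ξβ) 0 ξ₀ ∧ (∀ ξ, φ ξ = 0 ↔ ξ₀ ≤ ξ) ∧
              (unitDeriv D 0 < 0 →
                HasLeftSlope φ ξ₀ (((unitDeriv f 0 - c) / unitDeriv D 0 : ℝ) : EReal)) ∧
              (unitDeriv D 0 = 0 → HasLeftSlope φ ξ₀ ⊥)) ∧
          (D 1 = 0 → c < unitDeriv f 1 →
            ∃ ξ₁ < ξβ, IsSharpAt f D g c φ (Iio ξβ) 1 ξ₁ ∧ (∀ ξ, φ ξ = 1 ↔ ξ ≤ ξ₁) ∧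
              (unitDeriv D 1 < 0 →
                HasRightSlope φ ξ₁ (((unitDeriv f 1 - c) / unitDeriv D 1 : ℝ) : EReal)) ∧
              (unitDeriv D 1 = 0 → HasRightSlope φ ξ₁ ⊥)) := by
  have S : IsAdmissible f D g β := ⟨hf, hg, hg_pos, hg0, hg1, hβ, hD, hD_neg, hD_pos⟩
  refine ⟨fluxThreshold f D g β,
    fluxThreshold (oddReflect f) (oddReflect D) (evenReflect g) (1 - β), S.isThresholdNR,
    S.isThresholdPL, fun c => ⟨fun ⟨φ, h⟩ => ?_, S.exists_isWavefront⟩,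
    fun c φ₁ φ₂ h₁ h₂ => ?_, fun c hc => S.sDiscr_nonneg ((le_max_left _ _).trans hc),
    fun c φ _ h => ?_⟩
  · obtain ⟨ξβ, W, hW⟩ := h.exists_isStrongWavefront S
    exact hW.max_fluxThreshold_le S
  · obtain ⟨ξ₁, W₁, hW₁⟩ := h₁.exists_isStrongWavefront S
    obtain ⟨ξ₂, W₂, hW₂⟩ := h₂.exists_isStrongWavefront S
    exact hW₁.exists_shift S hW₂
  obtain ⟨ξβ, W, hW⟩ := h.exists_isStrongWavefront S
  obtain ⟨hl1, hl2, hl3⟩ := hW.hasLeftSlope S rfl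
  obtain ⟨hr1, hr2, hr3⟩ := hW.hasRightSlope S
  exact ⟨fun ξ hξ => hW.deriv_neg S hξ, ξβ, hW.eq_β, fun ξ => hW.eq_of_eq_β S,
    hl1, fun hc hD' => hc ▸ hl2 hc hD', hl3, hr1, fun hc hD' => hc ▸ hr2 hc hD', hr3,
    hW.isClassicalOn_compl S,
    fun hD0 hc => ⟨(hW.isClassicalOn_Ioi S hD0 hc).isClassicalAt isOpen_Ioi
      fun ξ => hW.lt_of_eq_zero S, hW.isClassicalOn_Ioi S hD0 hc⟩,
    fun hD1 hc => ⟨(hW.isClassicalOn_Iio S hD1 hc).isClassicalAt isOpen_Iio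
      fun ξ => hW.lt_of_eq_one S, hW.isClassicalOn_Iio S hD1 hc⟩,
    hW.exists_isSharpAt_zero S, hW.exists_isSharpAt_one S⟩
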